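/- **Setting.** Fix a generalized linear model with canonical link: a $\sigma$-finite measure $\nu$ on $\mathbb R$, a dispersion $\phi>0$ and measurable functions $a\ge 0$, $d(\cdot\,;\cdot)$ and a differentiable mean function $g:\mathbb R\to\mathbb R$ such that, for every $\eta\in\mathbb R$, $f_\eta(y)=a(y)\exp\{-d(y;g(\eta))/(2\phi)\}$ is a probability density with respect to $\nu$ with mean $g(\eta)$, and $\frac{\partial}{\partial\eta}d(y;g(\eta))=g(\eta)-y$ for all $y$. Consider a sequence of experiments (the index of the sequence is suppressed). In each of them, observations $(x_i,y_i)\in\mathbb R^p\times\mathbb R$ arrive in batches $\mathcal D_1,\dots,\mathcal D_b$ of sizes $n_1,\dots,n_b$, with $N_j=n_1+\dots+n_j$. The pairs $(x_i,y_i)$ are i.i.d., and given $x_i$ the response $y_i$ has density $f_{x_i^\top\beta^0}$. Write $X^{(j)},y^{(j)}$ for the design matrix and response vector of batch $j$. Put $J^{(j)}(\beta)=\sum_{i\in\mathcal D_j}g'(x_i^\top\beta)x_ix_i^\top$, $J=\mathbb E[J^{(1)}(\beta^0)]/N_1$, $\Theta=J^{-1}$; fix a coordinate $r$, and let $\gamma_r^0$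 minimize $J_{r,r}-2J_{r,-r}\gamma+\gamma^\top J_{-r,-r}\gamma$ over $\gamma\in\mathbb R^{p-1}$. Let $s_0=\max(1,|\{k:\beta^0_k\ne0\}|)$ and $s_r=\max(1,|\{k\neq r:\Theta_{k,r}\ne0\}|)$. **Estimators.** With $\lambda_j=C\sqrt{\log p/N_j}$ and $\widetilde J^{(j)}=\sum_{i\le j}J^{(i)}(\widehat\beta^{(i)})$, let, for $j=1,\dots,b$, $$\widehat\beta^{(j)}\in\arg\min_{\beta\in\mathbb R^p}\ \frac1{2N_j}\Big\{\sum_{i\in\mathcal D_j}d(y_i;g(x_i^\top\beta))+\tfrac12(\beta-\widehat\beta^{(j-1)})^\top\widetilde J^{(j-1)}(\beta-\widehat\beta^{(j-1)})\Big\}+\lambda_j\|\beta\|_1,$$ $$\widehat\gamma_r^{(j)}\in\arg\min_{\gamma\in\mathbb R^{p-1}}\ \frac1{2N_j}\big(\widetilde J^{(j)}_{r,r}-2\widetilde J^{(j)}_{r,-r}\gamma+\gamma^\top\widetilde J^{(j)}_{-r,-r}\gamma\big)+\lambda_j\|\gamma\|_1$$ ($\widetilde J^{(0)}=0$), let $\widehat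 z_r^{(j)}=X^{(j)}_{\cdot r}-X^{(j)}_{\cdot,-r}\widehat\gamma^{(j)}_r$, $\widehat\tau^{(j)}_r=\widetilde J^{(j)}_{r,r}-\widetilde J^{(j)}_{r,-r}\widehat\gamma_r^{(j)}$, let $\widetilde\gamma_r^{(j)}\in\mathbb R^p$ be $\widehat\gamma_r^{(j)}$ with an additional $r$-th entry $-1$, and $$\widehat\beta^{(b)}_{\mathrm{on},r}=\widehat\beta^{(b)}_r+\frac1{\widehat\tau_r^{(b)}}\Big[\sum_{j=1}^b\{\widehat z_r^{(j)}\}^\top\{y^{(j)}-g(X^{(j)}\widehat\beta^{(j)})\}+\sum_{j=1}^b\{\widetilde\gamma_r^{(j)}\}^\top J^{(j)}(\widehat\beta^{(j)})\{\widehat\beta^{(b)}-\widehat\beta^{(j)}\}\Big].$$ **Regularity.** There are constants $K,M,L,K_2,K_3$ and $\delta,\kappa>0$, the same for all experiments, such that almost surely for all $i$: $\|x_i\|_\infty\le K$; $|x_i^\top\beta^0|\le M$ and $|(x_i)_{-r}^\top\gamma_r^0|\le M$; for all $\beta,\beta'$ with $\|\beta-\beta^0\|_1,\|\beta'-\beta^0\|_1\le\delta$,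 $|g'(x_i^\top\beta)-g'(x_i^\top\beta')|\le L|x_i^\top\beta-x_i^\top\beta'|$, $|g'(x_i^\top\beta)|\le K_2$, $g'(x_i^\top\beta)\neq 0$ and $|1/g'(x_i^\top\beta)|\le K_3$; and every eigenvalue of $J$ is at least $\kappa$. **Theorem 3.** There is $C_0>0$, depending only on the model and the constants above, such that for every $C\ge C_0$ there are $A\ge1$ and $c>0$, depending only on these and $C$, with the following property. Put $c_1^{(j)}=A^j$, and suppose that along the sequence $N_b\to\infty$, $p\to\infty$, $b=o(\log N_b)$, $n_1\ge c\,s_0\log p$, $N_j\ge c\,c_1^{(j)}s_0^2s_r^2\log p$ for $j=1,\dots,b$, and that for some $\epsilon>0$ $$s_0^2\log(p)\log(N_b)N_b^{-1/2+\epsilon}=o(1),\qquad s_0s_r\log(p)N_b^{-1/2+\epsilon}=o(1).$$ Then, with probability tending to one, $\|\widehat\beta^{(j)}-\beta^0\|_1\le c_1^{(j)}s_0\lambda_j$ for all $j=1,\dots,b$ and $\widehat\tau_r^{(b)}>0$; and $$\frac{\widehat\tau_r^{(b)}}{\sqrt{N_b}}\big(\widehat\beta^{(b)}_{\mathrm{on},r}-\beta^0_r\big)=W_r+V_r,\qquad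 W_r=\frac1{\sqrt{N_b}}\sum_{j=1}^b\{\widehat z_r^{(j)}\}^\top\big(y^{(j)}-g(X^{(j)}\beta^0)\big),\qquad V_r=o_p(1).$$ -/

import Mathlib

open MeasureTheory ProbabilityTheory Filter Topology Asymptotics
open scoped Matrix

noncomputable section

namespace OnlineGLM

/-- The exponential dispersion density `a(y; φ) exp (-d(y; mean) / (2 φ))`. -/
def edmDensity (a : ℝ → ℝ) (d : ℝ → ℝ → ℝ) (φ mean y : ℝ) : ℝ :=
  a y * Real.exp (-(d y mean) / (2 * φ))

/-- A generalized linear model: an exponential dispersion family of densities with respect to a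
σ-finite measure `ν` on `ℝ` (Lebesgue or counting measure, say), with mean `g η` at the linear
predictor `η`.  The link is canonical, `∂/∂η d(y; g η) = g η - y`, so that the Hessian of
`β ↦ ∑ᵢ d(yᵢ; g (xᵢᵀ β))` is the information matrix `∑ᵢ g'(xᵢᵀ β) xᵢ xᵢᵀ`. -/
structure GLM where
  ν : Measure ℝ
  sigmaFinite : SigmaFinite ν
  a : ℝ → ℝ
  d : ℝ → ℝ → ℝ
  φ : ℝ
  g : ℝ → ℝ
  φ_pos : 0 < φ
  a_nonneg : ∀ y, 0 ≤ a y
  measurable_a : Measurable a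
  measurable_d : ∀ η, Measurable fun y => d y (g η)
  differentiable_g : Differentiable ℝ g
  hasDerivAt_d : ∀ y η, HasDerivAt (fun t => d y (g t)) (g η - y) η
  lintegral_density : ∀ η, ∫⁻ y, ENNReal.ofReal (edmDensity a d φ (g η) y) ∂ν = 1
  integrable_density : ∀ η, Integrable (fun y => y * edmDensity a d φ (g η) y) ν
  mean_density : ∀ η, ∫ y, y * edmDensity a d φ (g η) y ∂ν = g η

/-- The `ℓ₁` norm of a vector. -/
def l1 {ι : Type*} [Fintype ι] (v : ι → ℝ) : ℝ := ∑ k, |v k|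

/-- `M_{r,r} - 2 M_{r,-r} γ + γᵀ M_{-r,-r} γ`, for `γ` indexed by the coordinates other
than `r`. -/
def projQuad {p : ℕ} (M : Matrix (Fin p) (Fin p) ℝ) (r : Fin p) (γ : {k // k ≠ r} → ℝ) : ℝ :=
  M r r - 2 * ∑ k, M r k.1 * γ k + ∑ k, ∑ l, γ k * M k.1 l.1 * γ l

/-- The raw data of one streaming experiment.  Observations are numbered `0, 1, 2, …` in their
order of arrival; batches are numbered from `1` to `b`, and batch `j` has `n j` observations.
Only the observations in batches `1, …, b` and the estimators at steps `1, …, b` matter. -/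
structure Stream (Ω : Type*) where
  /-- dimension -/
  p : ℕ
  /-- number of batches -/
  b : ℕ
  /-- batch sizes -/
  n : ℕ → ℕ
  /-- covariates -/
  x : ℕ → Ω → Fin p → ℝ
  /-- responses -/
  y : ℕ → Ω → ℝ
  /-- true coefficient vector -/
  β₀ : Fin p → ℝ
  /-- the coordinate of interest -/
  r : Fin p
  /-- population projection coefficient -/
  γ₀ : {k // k ≠ r} → ℝ
  /-- online lasso estimators -/
  βhat : ℕ → Ω → Fin p → ℝ
  /-- low-dimensional projections -/
  γhat : ℕ → Ω → {k // k ≠ r} → ℝ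

namespace Stream

variable {Ω : Type*} (S : Stream Ω) (G : GLM)

/-- Cumulative sample size `N_j = n_1 + ⋯ + n_j`. -/
def N (j : ℕ) : ℕ := ∑ i ∈ Finset.Icc 1 j, S.n i

/-- The observations in batch `j ≥ 1`. -/
def batch (j : ℕ) : Finset ℕ := Finset.Ico (S.N (j - 1)) (S.N j)

/-- The tuning parameter `λ_j = C √(log p / N_j)`. -/
def lam (C : ℝ) (j : ℕ) : ℝ := C * √(Real.log S.p / S.N j)

/-- Information matrix of batch `j` at `β`. -/
def J (j : ℕ) (β : Fin S.p → ℝ) (ω : Ω) : Matrix (Fin S.p) (Fin S.p) ℝ :=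
  Matrix.of fun k l => ∑ i ∈ S.batch j, deriv G.g (S.x i ω ⬝ᵥ β) * S.x i ω k * S.x i ω l

/-- Aggregated information matrix `∑_{i ≤ j} J^{(i)}(βhat^{(i)})`. -/
def Jtilde (j : ℕ) (ω : Ω) : Matrix (Fin S.p) (Fin S.p) ℝ :=
  ∑ i ∈ Finset.Icc 1 j, S.J G i (S.βhat i ω) ω

/-- The objective function of the online lasso at step `j`.  For `j = 1` the quadratic term
vanishes and this is the objective function of the ordinary lasso on the first batch. -/
def lassoObjective (C : ℝ) (j : ℕ) (ω : Ω) (β : Fin S.p → ℝ) : ℝ :=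
  1 / (2 * (S.N j : ℝ)) *
      (∑ i ∈ S.batch j, G.d (S.y i ω) (G.g (S.x i ω ⬝ᵥ β)) +
        1 / 2 * ((β - S.βhat (j - 1) ω) ⬝ᵥ
          (S.Jtilde G (j - 1) ω *ᵥ (β - S.βhat (j - 1) ω)))) +
    S.lam C j * l1 β

/-- The objective function of the low-dimensional projection at step `j`. -/
def projObjective (C : ℝ) (j : ℕ) (ω : Ω) (γ : {k // k ≠ S.r} → ℝ) : ℝ :=
  1 / (2 * (S.N j : ℝ)) * projQuad (S.Jtilde G j ω) S.r γ + S.lam C j * l1 γ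

/-- The extension of `γhat^{(j)}` to all coordinates, with `r`-th entry `-1`. -/
def γtilde (j : ℕ) (ω : Ω) (k : Fin S.p) : ℝ :=
  if h : k = S.r then -1 else S.γhat j ω ⟨k, h⟩

/-- The entry at observation `i` of `zhat^{(j)} = x_r^{(j)} - X_{-r}^{(j)} γhat^{(j)}`. -/
def zhat (j i : ℕ) (ω : Ω) : ℝ :=
  S.x i ω S.r - ∑ k : {k // k ≠ S.r}, S.x i ω k.1 * S.γhat j ω k

/-- `τhat^{(j)} = Jtilde^{(j)}_{r,r} - Jtilde^{(j)}_{r,-r} γhat^{(j)}`. -/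
def τhat (j : ℕ) (ω : Ω) : ℝ :=
  S.Jtilde G j ω S.r S.r - ∑ k : {k // k ≠ S.r}, S.Jtilde G j ω S.r k.1 * S.γhat j ω k

/-- The online debiased lasso estimator of the `r`-th coefficient after the last batch. -/
def βon (ω : Ω) : ℝ :=
  S.βhat S.b ω S.r + 1 / S.τhat G S.b ω *
    (∑ j ∈ Finset.Icc 1 S.b, ∑ i ∈ S.batch j,
        S.zhat j i ω * (S.y i ω - G.g (S.x i ω ⬝ᵥ S.βhat j ω)) +
      ∑ j ∈ Finset.Icc 1 S.b,
        S.γtilde j ω ⬝ᵥ (S.J G j (S.βhat j ω) ω *ᵥ (S.βhat S.b ω - S.βhat j ω)))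

/-- The leading term `W_r`. -/
def W (ω : Ω) : ℝ :=
  1 / √(S.N S.b : ℝ) * ∑ j ∈ Finset.Icc 1 S.b, ∑ i ∈ S.batch j,
    S.zhat j i ω * (S.y i ω - G.g (S.x i ω ⬝ᵥ S.β₀))

variable [MeasurableSpace Ω] (μ : Measure Ω)

/-- Population information matrix `𝔼[J^{(1)}(β₀)] / N_1`. -/
def popJ : Matrix (Fin S.p) (Fin S.p) ℝ :=
  Matrix.of fun k l => (∫ ω, S.J G 1 S.β₀ ω k l ∂μ) / S.N 1

/-- `s_0`, the number of nonzero entries of `β₀` (read as `1` if there is none). -/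
def s₀ : ℕ := max 1 (Nat.card {k // S.β₀ k ≠ 0})

/-- `s_r`, the number of nonzero off-diagonal entries in column `r` of the inverse of the
population information matrix (read as `1` if there is none). -/
def sr : ℕ := max 1 (Nat.card {k // k ≠ S.r ∧ (S.popJ G μ)⁻¹ k S.r ≠ 0})

/-- The observations `(x_i, y_i)` of the `b` batches are i.i.d., and given `x_i` the response
`y_i` has the density of the model at the linear predictor `x_iᵀ β₀`. -/
structure IsSample : Prop where
  measurable_x : ∀ i < S.N S.b, Measurable (S.x i)
  measurable_y : ∀ i < S.N S.b, Measurable (S.y i)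
  indep : iIndepFun (fun (i : Fin (S.N S.b)) ω => (S.x i ω, S.y i ω)) μ
  ident : ∀ i < S.N S.b, ∀ i' < S.N S.b,
    IdentDistrib (fun ω => (S.x i ω, S.y i ω)) (fun ω => (S.x i' ω, S.y i' ω)) μ μ
  condDensity : ∀ i < S.N S.b, ∀ A : Set (Fin S.p → ℝ), MeasurableSet A →
    ∀ B : Set ℝ, MeasurableSet B →
      μ (S.x i ⁻¹' A ∩ S.y i ⁻¹' B) =
        ∫⁻ ω in S.x i ⁻¹' A, ∫⁻ y in B,
          ENNReal.ofReal (edmDensity G.a G.d G.φ (G.g (S.x i ω ⬝ᵥ S.β₀)) y) ∂G.ν ∂μ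

/-- The regularity conditions (A1)-(A4), with explicit constants; (A3) is required on the
`ℓ₁`-ball of radius `δ` around `β₀`. -/
structure Regular (K M L δ K₂ K₃ κ : ℝ) : Prop where
  bounded_x : ∀ᵐ ω ∂μ, ∀ i < S.N S.b, ∀ k, |S.x i ω k| ≤ K
  isMinOn_γ₀ : IsMinOn (projQuad (S.popJ G μ) S.r) Set.univ S.γ₀
  bounded_predictor : ∀ᵐ ω ∂μ, ∀ i < S.N S.b, |S.x i ω ⬝ᵥ S.β₀| ≤ M
  bounded_projection : ∀ᵐ ω ∂μ, ∀ i < S.N S.b,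
    |∑ k : {k // k ≠ S.r}, S.x i ω k.1 * S.γ₀ k| ≤ M
  lipschitz : ∀ᵐ ω ∂μ, ∀ i < S.N S.b, ∀ β β' : Fin S.p → ℝ,
    l1 (β - S.β₀) ≤ δ → l1 (β' - S.β₀) ≤ δ →
      |deriv G.g (S.x i ω ⬝ᵥ β) - deriv G.g (S.x i ω ⬝ᵥ β')| ≤
        L * |S.x i ω ⬝ᵥ β - S.x i ω ⬝ᵥ β'|
  bounded_deriv : ∀ᵐ ω ∂μ, ∀ i < S.N S.b, ∀ β : Fin S.p → ℝ, l1 (β - S.β₀) ≤ δ →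
    |deriv G.g (S.x i ω ⬝ᵥ β)| ≤ K₂
  bounded_inv_deriv : ∀ᵐ ω ∂μ, ∀ i < S.N S.b, ∀ β : Fin S.p → ℝ, l1 (β - S.β₀) ≤ δ →
    deriv G.g (S.x i ω ⬝ᵥ β) ≠ 0 ∧ |1 / deriv G.g (S.x i ω ⬝ᵥ β)| ≤ K₃
  eigenvalue : ∀ t : ℝ, Module.End.HasEigenvalue (Matrix.toLin' (S.popJ G μ)) t → κ ≤ t

/-- `βhat` and `γhat` are (some choice of) the online lasso estimators and low-dimensional
projections with tuning parameters `λ_j = C √(log p / N_j)`. -/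
structure IsEstimator (C : ℝ) : Prop where
  lasso : ∀ᵐ ω ∂μ, ∀ j ∈ Finset.Icc 1 S.b,
    IsMinOn (S.lassoObjective G C j ω) Set.univ (S.βhat j ω)
  proj : ∀ᵐ ω ∂μ, ∀ j ∈ Finset.Icc 1 S.b,
    IsMinOn (S.projObjective G C j ω) Set.univ (S.γhat j ω)

end Stream

end OnlineGLM

end

/-!
With probability tending to one, the scores, the empirical information matrices and the projection
residuals of all batches deviate from their means by at most a constant times
`√(N_j (log p + j))`. Indeed their summands are sub-exponential, because the cumulant function of
the exponential family has bounded curvature near `β₀`, and the term `j` makes the union bound over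
the batches geometric.

On this event everything is deterministic. In the basic inequality of the `j`-th online lasso, the
quadratic surrogate for the past batches costs their prediction errors, so the error bounds
deteriorate by a constant factor from one batch to the next, which `A ^ j` absorbs. Convexity
localizes the estimators to the `ℓ₁`-ball of radius `δ` on which the regularity conditions hold.

The projection is a lasso for the quadratic form `Jtilde`, and its stationarity conditions make the
linear term in the expansion of the debiased estimator small. Together with the drift of the
projections and the quadratic Taylor terms, the remainder is of order
`b A^{2b} (s₀ + s_r) s₀ log p / √N_b`, and `b = o(log N_b)` gives `b A^{2b} ≤ N_b^ε`.
-/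

noncomputable section

namespace OnlineGLM

/-! ### The exponential family -/

section Calculus

lemma exists_sub_sub_mul_eq_half_mul_sq {F f f' : ℝ → ℝ} (hF : ∀ t, HasDerivAt F (f t) t)
    (hf : ∀ t, HasDerivAt f (f' t) t) (η t : ℝ) :
    ∃ θ ∈ Set.Icc (0 : ℝ) 1, F (η + t) - F η - t * f η = f' (η + θ * t) / 2 * t ^ 2 := by
  have hpath (u : ℝ) : HasDerivAt (fun u : ℝ => η + u * t) t u := by
    simpa using ((hasDerivAt_id u).mul_const t).const_add η
  have hψ (u : ℝ) : HasDerivAt (fun u => F (η + u * t) - u * (t * f η))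
      (f (η + u * t) * t - t * f η) u :=
    (((hF _).comp u (hpath u)).sub ((hasDerivAt_id u).mul_const _)).congr_deriv (by simp)
  have hχ (u : ℝ) : HasDerivAt (fun u => f (η + u * t)) (f' (η + u * t) * t) u :=
    (hf _).comp u (hpath u)
  -- Cauchy's mean value theorem against `u ↦ u ^ 2`, then the mean value theorem for `f`.
  obtain ⟨u, hu, hFu⟩ := exists_ratio_hasDerivAt_eq_ratio_slope _ _ zero_lt_one
    (fun u _ => (hψ u).continuousAt.continuousWithinAt) (fun u _ => hψ u)
    (fun u => u ^ 2) (fun u => 2 * u) (by fun_prop)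
    (fun u _ => by simpa using hasDerivAt_pow 2 u)
  obtain ⟨θ, hθ, hfθ⟩ := exists_hasDerivAt_eq_slope _ _ hu.1
    (fun u _ => (hχ u).continuousAt.continuousWithinAt) (fun u _ => hχ u)
  have hu₀ : u ≠ 0 := hu.1.ne'
  refine ⟨θ, ⟨hθ.1.le, (hθ.2.trans hu.2).le⟩, ?_⟩
  simp only [zero_mul, add_zero, sub_zero, one_mul] at hFu hfθ
  rw [eq_div_iff hu₀] at hfθ
  apply mul_right_cancel₀ (mul_ne_zero two_ne_zero hu₀)
  linear_combination -hFu - t * hfθ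

lemma abs_sub_add_deriv_mul_le {g : ℝ → ℝ} (hg : Differentiable ℝ g) {u v B : ℝ}
    (h : ∀ θ ∈ Set.Icc (0 : ℝ) 1, |deriv g (u + θ * (v - u)) - deriv g v| ≤ B) :
    |g u - g v + deriv g v * (v - u)| ≤ B * |v - u| := by
  have hder : ∀ w ∈ segment ℝ u v,
      HasDerivWithinAt (fun w => g w - deriv g v * w) (deriv g w - deriv g v) (segment ℝ u v) w :=
    fun w _ => ((hg w).hasDerivAt.sub
      ((hasDerivAt_id w).const_mul (deriv g v))).hasDerivWithinAt.congr_deriv (by simp)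
  have hbound : ∀ w ∈ segment ℝ u v, ‖deriv g w - deriv g v‖ ≤ B := by
    rw [segment_eq_image']
    rintro _ ⟨θ, hθ, rfl⟩
    exact h θ hθ
  have hmvt := (convex_segment u v).norm_image_sub_le_of_norm_hasDerivWithin_le hder hbound
    (right_mem_segment ℝ u v) (left_mem_segment ℝ u v)
  rw [Real.norm_eq_abs, Real.norm_eq_abs, abs_sub_comm u v] at hmvt
  convert hmvt using 2
  ring

lemma mul_exp_mul_sub_one_nonneg {c : ℝ} (hc : 0 ≤ c) (z : ℝ) : 0 ≤ z * (Real.exp (c * z) - 1) := by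
  rcases le_total 0 z with hz | hz
  · exact mul_nonneg hz (sub_nonneg.2 (Real.one_le_exp (mul_nonneg hc hz)))
  · exact mul_nonneg_of_nonpos_of_nonpos hz
      (sub_nonpos.2 (Real.exp_le_one_iff.2 (mul_nonpos_of_nonneg_of_nonpos hc hz)))

end Calculus

namespace GLM

variable (G : GLM)

/-- The cumulant function of the exponential dispersion family, a primitive of the mean function.
It is normalized to be `d(0; g ·)`. -/
def cumulant (t : ℝ) : ℝ := G.d 0 (G.g t)

lemma hasDerivAt_cumulant (t : ℝ) : HasDerivAt G.cumulant (G.g t) t :=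
  (G.hasDerivAt_d 0 t).congr_deriv (sub_zero _)

lemma hasDerivAt_g (t : ℝ) : HasDerivAt G.g (deriv G.g t) t :=
  (G.differentiable_g t).hasDerivAt

lemma d_sub_d (y s t : ℝ) :
    G.d y (G.g t) - G.d y (G.g s) = G.cumulant t - G.cumulant s - y * (t - s) := by
  have h (u : ℝ) : HasDerivAt (fun u => G.d y (G.g u) - G.cumulant u + y * u) 0 u :=
    (((G.hasDerivAt_d y u).sub (G.hasDerivAt_cumulant u)).add
      ((hasDerivAt_id u).const_mul y)).congr_deriv (by ring)
  have := is_const_of_deriv_eq_zero (fun u => (h u).differentiableAt) (fun u => (h u).deriv) t s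
  linarith

/-- The density of the response at the linear predictor `η`. -/
def density (η y : ℝ) : ℝ := edmDensity G.a G.d G.φ (G.g η) y

lemma density_nonneg (η y : ℝ) : 0 ≤ G.density η y :=
  mul_nonneg (G.a_nonneg y) (Real.exp_pos _).le

lemma measurable_density (η : ℝ) : Measurable (G.density η) :=
  G.measurable_a.mul (((G.measurable_d η).neg.div_const _).exp)

lemma measurable_uncurry_density : Measurable (Function.uncurry G.density) := by
  refine measurable_uncurry_of_continuous_of_measurable (fun y => ?_) G.measurable_density
  have : Continuous fun t => G.d y (G.g t) :=
    continuous_iff_continuousAt.2 fun t => (G.hasDerivAt_d y t).continuousAt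
  unfold density edmDensity
  fun_prop

lemma lintegral_density_eq_one (η : ℝ) : ∫⁻ y, ENNReal.ofReal (G.density η y) ∂G.ν = 1 :=
  G.lintegral_density η

lemma density_add (η t y : ℝ) :
    G.density (η + t) y = G.density η y *
      Real.exp ((t * y - (G.cumulant (η + t) - G.cumulant η)) / (2 * G.φ)) := by
  unfold density edmDensity
  rw [mul_assoc, ← Real.exp_add, ← add_div]
  congr 3
  linarith [G.d_sub_d y η (η + t)]

lemma integrable_density_self (η : ℝ) : Integrable (G.density η) G.ν := by
  refine ⟨(G.measurable_density η).aestronglyMeasurable, ?_⟩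
  rw [hasFiniteIntegral_iff_ofReal (ae_of_all _ (G.density_nonneg η)), lintegral_density_eq_one]
  exact ENNReal.one_lt_top

lemma integral_density (η : ℝ) : ∫ y, G.density η y ∂G.ν = 1 := by
  rw [integral_eq_lintegral_of_nonneg_ae (ae_of_all _ (G.density_nonneg η))
    (G.measurable_density η).aestronglyMeasurable, lintegral_density_eq_one, ENNReal.toReal_one]

lemma integral_sub_mul_density (η m : ℝ) : ∫ y, (y - m) * G.density η y ∂G.ν = G.g η - m := by
  have hint : Integrable (fun y => y * G.density η y) G.ν := G.integrable_density η
  have hmean : ∫ y, y * G.density η y ∂G.ν = G.g η := G.mean_density η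
  simp_rw [sub_mul]
  rw [integral_sub hint ((G.integrable_density_self η).const_mul m), hmean,
    integral_const_mul, integral_density, mul_one]

lemma integrable_sub_mul_density (η m : ℝ) :
    Integrable (fun y => (y - m) * G.density η y) G.ν := by
  simp_rw [sub_mul]
  exact (G.integrable_density η).sub ((G.integrable_density_self η).const_mul m)

lemma monotone_g : Monotone G.g := by
  intro η η' h
  obtain ⟨t, rfl⟩ : ∃ t, η' = η + t := ⟨η' - η, by ring⟩
  rcases (le_add_iff_nonneg_right η).1 h |>.eq_or_lt with rfl | ht
  · rw [add_zero]
  have hφ := G.φ_pos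
  -- The likelihood ratio of the two densities is increasing and crosses `1` at `m`.
  set m := (G.cumulant (η + t) - G.cumulant η) / t with hm
  have hpointwise (y : ℝ) :
      0 ≤ (y - m) * G.density (η + t) y - (y - m) * G.density η y := by
    have hexp : (t * y - (G.cumulant (η + t) - G.cumulant η)) / (2 * G.φ) =
        t / (2 * G.φ) * (y - m) := by
      rw [hm]; field_simp
    rw [G.density_add η t y, hexp]
    have := mul_nonneg (mul_exp_mul_sub_one_nonneg (c := t / (2 * G.φ)) (by positivity) (y - m))
      (G.density_nonneg η y)
    linarith
  have hint := integral_nonneg_of_ae (μ := G.ν) (ae_of_all _ hpointwise)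
  rw [integral_sub (G.integrable_sub_mul_density _ m) (G.integrable_sub_mul_density _ m),
    integral_sub_mul_density, integral_sub_mul_density] at hint
  linarith

lemma deriv_g_nonneg (t : ℝ) : 0 ≤ deriv G.g t := G.monotone_g.deriv_nonneg

lemma cumulant_sub_sub_le {η t B : ℝ} (h : ∀ θ ∈ Set.Icc (0 : ℝ) 1, deriv G.g (η + θ * t) ≤ B) :
    G.cumulant (η + t) - G.cumulant η - t * G.g η ≤ B / 2 * t ^ 2 := by
  obtain ⟨θ, hθ, heq⟩ :=
    exists_sub_sub_mul_eq_half_mul_sq G.hasDerivAt_cumulant G.hasDerivAt_g η t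
  rw [heq]
  gcongr
  exact h θ hθ

lemma le_cumulant_sub_sub {η t m : ℝ} (h : ∀ θ ∈ Set.Icc (0 : ℝ) 1, m ≤ deriv G.g (η + θ * t)) :
    m / 2 * t ^ 2 ≤ G.cumulant (η + t) - G.cumulant η - t * G.g η := by
  obtain ⟨θ, hθ, heq⟩ :=
    exists_sub_sub_mul_eq_half_mul_sq G.hasDerivAt_cumulant G.hasDerivAt_g η t
  rw [heq]
  gcongr
  exact h θ hθ

lemma lintegral_exp_mul_density (η θ : ℝ) :
    ∫⁻ y, ENNReal.ofReal (Real.exp (θ * (y - G.g η))) * ENNReal.ofReal (G.density η y) ∂G.ν =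
      ENNReal.ofReal (Real.exp ((G.cumulant (η + 2 * G.φ * θ) - G.cumulant η -
        2 * G.φ * θ * G.g η) / (2 * G.φ))) := by
  have hφ := G.φ_pos
  set c := (G.cumulant (η + 2 * G.φ * θ) - G.cumulant η - 2 * G.φ * θ * G.g η) / (2 * G.φ)
    with hc
  have htilt (y : ℝ) :
      ENNReal.ofReal (Real.exp (θ * (y - G.g η))) * ENNReal.ofReal (G.density η y) =
        ENNReal.ofReal (Real.exp c) * ENNReal.ofReal (G.density (η + 2 * G.φ * θ) y) := by
    rw [← ENNReal.ofReal_mul (Real.exp_pos _).le, ← ENNReal.ofReal_mul (Real.exp_pos _).le,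
      G.density_add η (2 * G.φ * θ) y, mul_left_comm, ← Real.exp_add, mul_comm]
    congr 3
    rw [hc]
    field_simp
    ring
  simp_rw [htilt]
  rw [lintegral_const_mul _ (G.measurable_density _).ennreal_ofReal, lintegral_density_eq_one,
    mul_one]

end GLM

section Chernoff

/-- `X` is sub-exponential: on `[-ρ, ρ]` its moment generating function exists and is at most
`exp (σ θ²)`, that of a centered Gaussian with variance `2 σ`. -/
structure IsSubExponential {Ω : Type*} [MeasurableSpace Ω] (X : Ω → ℝ) (σ ρ : ℝ)
    (μ : Measure Ω) : Prop where
  integrable : ∀ θ : ℝ, |θ| ≤ ρ → Integrable (fun ω => Real.exp (θ * X ω)) μ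
  mgf_le : ∀ θ : ℝ, |θ| ≤ ρ → mgf X μ θ ≤ Real.exp (σ * θ ^ 2)

variable {Ω ι : Type*} [MeasurableSpace Ω] {μ : Measure Ω} {X : ι → Ω → ℝ} {Y : Ω → ℝ}
  {σ ρ q N t B : ℝ}

lemma IsSubExponential.neg (h : IsSubExponential Y σ ρ μ) :
    IsSubExponential (fun ω => -Y ω) σ ρ μ where
  integrable θ hθ := by simpa using h.integrable (-θ) (by rwa [abs_neg])
  mgf_le θ hθ := by simpa [mgf] using h.mgf_le (-θ) (by rwa [abs_neg])

lemma isSubExponential_of_abs_le [IsProbabilityMeasure μ] (hm : Measurable Y)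
    (hB : ∀ᵐ ω ∂μ, |Y ω| ≤ B) (h₀ : ∫ ω, Y ω ∂μ = 0) : IsSubExponential Y (B ^ 2) ρ μ := by
  have h := hasSubgaussianMGF_of_mem_Icc_of_integral_eq_zero (a := -B) (b := B) hm.aemeasurable
    (hB.mono fun ω hω => abs_le.1 hω) h₀
  refine ⟨fun θ _ => h.integrable_exp_mul θ,
    fun θ _ => (h.mgf_le θ).trans (Real.exp_le_exp.2 ?_)⟩
  have hproxy : (((‖B - -B‖₊ / 2) ^ 2 : NNReal) : ℝ) = B ^ 2 := by
    push_cast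
    rw [Real.norm_eq_abs, show B - -B = 2 * B by ring, abs_mul]
    simp
  rw [hproxy]
  nlinarith [sq_nonneg (B * θ)]

lemma measureReal_sum_ge_le (hind : iIndepFun X μ) (hm : ∀ i, Measurable (X i)) (s : Finset ι)
    (hσ : 0 ≤ σ) (hN₀ : 0 < N) (hN : (s.card : ℝ) ≤ N) (ht : 0 ≤ t) (hρ : √(t / N) ≤ ρ)
    (h : ∀ i ∈ s, IsSubExponential (X i) σ ρ μ) :
    μ.real {ω | (σ + q) * √(N * t) ≤ ∑ i ∈ s, X i ω} ≤ Real.exp (-(q * t)) := by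
  have : IsProbabilityMeasure μ := hind.isProbabilityMeasure
  have habs : |√(t / N)| ≤ ρ := by rwa [abs_of_nonneg (Real.sqrt_nonneg _)]
  have hsq : √(t / N) ^ 2 = t / N := Real.sq_sqrt (by positivity)
  have hmul : √(t / N) * √(N * t) = t := by
    rw [← Real.sqrt_mul (by positivity), show t / N * (N * t) = t ^ 2 by field_simp,
      Real.sqrt_sq ht]
  have hprod : ∏ i ∈ s, mgf (X i) μ √(t / N) ≤ Real.exp (σ * t) :=
    calc ∏ i ∈ s, mgf (X i) μ √(t / N) ≤ ∏ _i ∈ s, Real.exp (σ * √(t / N) ^ 2) :=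
          Finset.prod_le_prod (fun i _ => mgf_nonneg) fun i hi => (h i hi).mgf_le _ habs
      _ = Real.exp (s.card * (σ * (t / N))) := by
          rw [Finset.prod_const, ← Real.exp_nat_mul, hsq]
      _ ≤ Real.exp (N * (σ * (t / N))) := by gcongr
      _ = Real.exp (σ * t) := by congr 1; field_simp
  have hmarkov := measure_ge_le_exp_mul_mgf (μ := μ) (X := ∑ i ∈ s, X i) ((σ + q) * √(N * t))
    (Real.sqrt_nonneg (t / N))
    (hind.integrable_exp_mul_sum hm fun i hi => (h i hi).integrable _ habs)
  simp only [Finset.sum_apply] at hmarkov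
  rw [hind.mgf_sum hm] at hmarkov
  calc μ.real {ω | (σ + q) * √(N * t) ≤ ∑ i ∈ s, X i ω}
      ≤ Real.exp (-√(t / N) * ((σ + q) * √(N * t))) * Real.exp (σ * t) := hmarkov.trans (by gcongr)
    _ = Real.exp (-(q * t)) := by
        rw [← Real.exp_add]
        congr 1
        linear_combination -(σ + q) * hmul

lemma measure_abs_sum_gt_le (hind : iIndepFun X μ) (hm : ∀ i, Measurable (X i)) (s : Finset ι)
    (hσ : 0 ≤ σ) (hN₀ : 0 < N) (hN : (s.card : ℝ) ≤ N) (ht : 0 ≤ t) (hρ : √(t / N) ≤ ρ)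
    (h : ∀ i ∈ s, IsSubExponential (X i) σ ρ μ) :
    μ {ω | (σ + q) * √(N * t) < |∑ i ∈ s, X i ω|} ≤ ENNReal.ofReal (2 * Real.exp (-(q * t))) := by
  have : IsProbabilityMeasure μ := hind.isProbabilityMeasure
  have hupper := measureReal_sum_ge_le (q := q) hind hm s hσ hN₀ hN ht hρ h
  have hlower := measureReal_sum_ge_le (q := q) (X := fun i ω => -X i ω)
    (hind.comp (fun _ x => -x) (fun _ => measurable_neg)) (fun i => (hm i).neg) s hσ hN₀ hN ht
    hρ fun i hi => (h i hi).neg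
  have hcover : {ω | (σ + q) * √(N * t) < |∑ i ∈ s, X i ω|} ⊆
      {ω | (σ + q) * √(N * t) ≤ ∑ i ∈ s, X i ω} ∪
      {ω | (σ + q) * √(N * t) ≤ ∑ i ∈ s, -X i ω} := by
    intro ω hω
    simp only [Set.mem_ofPred_eq, Set.mem_union, Finset.sum_neg_distrib] at hω ⊢
    exact (lt_abs.1 hω).imp le_of_lt le_of_lt
  refine (measure_mono hcover).trans ((measure_union_le _ _).trans ?_)
  rw [two_mul, ENNReal.ofReal_add (Real.exp_pos _).le (Real.exp_pos _).le]
  exact add_le_add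
    ((ENNReal.le_ofReal_iff_toReal_le (measure_ne_top _ _) (Real.exp_pos _).le).2 hupper)
    ((ENNReal.le_ofReal_iff_toReal_le (measure_ne_top _ _) (Real.exp_pos _).le).2 hlower)

end Chernoff

namespace Stream

variable {Ω : Type*} {S : Stream Ω} {G : GLM} [MeasurableSpace Ω] {μ : Measure Ω}

lemma measurable_dotProduct_left {ι : Type*} [Fintype ι] {f : Ω → ι → ℝ} (hf : Measurable f)
    (v : ι → ℝ) : Measurable fun ω => f ω ⬝ᵥ v := by
  unfold dotProduct
  fun_prop

lemma measurable_density_dotProduct {i : ℕ} (hx : Measurable (S.x i)) :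
    Measurable fun z : Ω × ℝ => ENNReal.ofReal (G.density (S.x i z.1 ⬝ᵥ S.β₀) z.2) :=
  (G.measurable_uncurry_density.comp
    (((measurable_dotProduct_left hx S.β₀).comp measurable_fst).prodMk
      measurable_snd)).ennreal_ofReal

lemma IsSample.map_eq [IsProbabilityMeasure μ] (hS : S.IsSample G μ) {i : ℕ} (hi : i < S.N S.b) :
    μ.map (fun ω => (S.x i ω, S.y i ω)) =
      ((μ.prod G.ν).withDensity fun z =>
        ENNReal.ofReal (G.density (S.x i z.1 ⬝ᵥ S.β₀) z.2)).map
          (fun z : Ω × ℝ => (S.x i z.1, z.2)) := by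
  have := G.sigmaFinite
  have hx := hS.measurable_x i hi
  have hxy := hx.prodMk (hS.measurable_y i hi)
  have hmap : Measurable fun z : Ω × ℝ => (S.x i z.1, z.2) :=
    (hx.comp measurable_fst).prodMk measurable_snd
  have : IsProbabilityMeasure (μ.map (fun ω => (S.x i ω, S.y i ω))) :=
    Measure.isProbabilityMeasure_map hxy.aemeasurable
  refine Measure.ext_prod fun {A B} hA hB => ?_
  rw [Measure.map_apply hxy (hA.prod hB), Measure.map_apply hmap (hA.prod hB),
    Set.mk_preimage_prod, hS.condDensity i hi A hA B hB,
    show (fun z : Ω × ℝ => (S.x i z.1, z.2)) ⁻¹' A ×ˢ B = (S.x i ⁻¹' A) ×ˢ B from rfl,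
    withDensity_apply _ ((hx hA).prod hB), ← Measure.prod_restrict,
    lintegral_prod _ (measurable_density_dotProduct hx).aemeasurable]
  rfl

lemma IsSample.lintegral_comp [IsProbabilityMeasure μ] (hS : S.IsSample G μ) {i : ℕ}
    (hi : i < S.N S.b) {h : (Fin S.p → ℝ) × ℝ → ENNReal} (hh : Measurable h) :
    ∫⁻ ω, h (S.x i ω, S.y i ω) ∂μ = ∫⁻ ω, ∫⁻ y, h (S.x i ω, y) *
      ENNReal.ofReal (G.density (S.x i ω ⬝ᵥ S.β₀) y) ∂G.ν ∂μ := by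
  have := G.sigmaFinite
  have hx := hS.measurable_x i hi
  have hmap : Measurable fun z : Ω × ℝ => (S.x i z.1, z.2) :=
    (hx.comp measurable_fst).prodMk measurable_snd
  have hdensity := measurable_density_dotProduct (G := G) hx
  have hcomp : Measurable fun z : Ω × ℝ => h (S.x i z.1, z.2) := hh.comp hmap
  rw [← lintegral_map hh (hx.prodMk (hS.measurable_y i hi)), hS.map_eq hi,
    lintegral_map hh hmap, lintegral_withDensity_eq_lintegral_mul _ hdensity hcomp,
    lintegral_prod _ (hdensity.mul hcomp).aemeasurable]
  simp only [Pi.mul_apply, mul_comm]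

end Stream

/-! ### Lasso inequalities -/

section LOne

variable {ι : Type*} [Fintype ι]

lemma l1_nonneg (v : ι → ℝ) : 0 ≤ l1 v := Finset.sum_nonneg fun _ _ => abs_nonneg _

lemma l1_add_le (u v : ι → ℝ) : l1 (u + v) ≤ l1 u + l1 v := by
  unfold l1
  rw [← Finset.sum_add_distrib]
  exact Finset.sum_le_sum fun k _ => abs_add_le _ _

lemma l1_smul (c : ℝ) (v : ι → ℝ) : l1 (c • v) = |c| * l1 v := by
  simp [l1, abs_mul, Finset.mul_sum]

lemma l1_single [DecidableEq ι] (k : ι) (t : ℝ) : l1 (Pi.single k t) = |t| := by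
  rw [l1, Finset.sum_eq_single_of_mem k (Finset.mem_univ k) fun l _ hl => by simp [hl],
    Pi.single_eq_same]

lemma l1_neg (v : ι → ℝ) : l1 (-v) = l1 v := by simp [l1]

lemma l1_sub_le (u v : ι → ℝ) : l1 (u - v) ≤ l1 u + l1 v := by
  rw [sub_eq_add_neg, ← l1_neg v]; exact l1_add_le _ _

lemma convexOn_l1 : ConvexOn ℝ Set.univ (l1 : (ι → ℝ) → ℝ) := by
  refine ⟨convex_univ, fun u _ v _ a b ha hb _ => (l1_add_le _ _).trans_eq ?_⟩
  rw [l1_smul, l1_smul, abs_of_nonneg ha, abs_of_nonneg hb, smul_eq_mul, smul_eq_mul]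

lemma abs_dotProduct_le_l1 {u v : ι → ℝ} {B : ℝ} (h : ∀ k, |u k| ≤ B) : |u ⬝ᵥ v| ≤ B * l1 v := by
  unfold dotProduct l1
  rw [Finset.mul_sum]
  refine (Finset.abs_sum_le_sum_abs _ _).trans (Finset.sum_le_sum fun k _ => ?_)
  rw [abs_mul]
  exact mul_le_mul_of_nonneg_right (h k) (abs_nonneg _)

lemma abs_dotProduct_mulVec_le_l1 {M : Matrix ι ι ℝ} {B : ℝ} (h : ∀ k l, |M k l| ≤ B)
    (u v : ι → ℝ) : |u ⬝ᵥ (M *ᵥ v)| ≤ B * l1 u * l1 v := by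
  rw [dotProduct_comm]
  exact (abs_dotProduct_le_l1 fun k => abs_dotProduct_le_l1 (h k)).trans_eq (by ring)

lemma sum_abs_le_sqrt_card_mul (T : Finset ι) (v : ι → ℝ) :
    ∑ k ∈ T, |v k| ≤ √(T.card : ℝ) * √(∑ k, v k ^ 2) := by
  rw [← Real.sqrt_mul (by positivity)]
  refine Real.le_sqrt_of_sq_le ?_
  calc (∑ k ∈ T, |v k|) ^ 2 ≤ T.card * ∑ k ∈ T, |v k| ^ 2 := sq_sum_le_card_mul_sum_sq
    _ ≤ T.card * ∑ k, v k ^ 2 := by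
        gcongr
        simp only [sq_abs]
        exact Finset.sum_le_sum_of_subset_of_nonneg (Finset.subset_univ _)
          fun _ _ _ => sq_nonneg _

lemma l1_sub_two_mul_le (β₀ v : ι → ℝ) {s : ℝ} (hs : (Nat.card {k // β₀ k ≠ 0} : ℝ) ≤ s) :
    l1 v - 2 * (√s * √(∑ k, v k ^ 2)) ≤ l1 (β₀ + v) - l1 β₀ := by
  classical
  set T : Finset ι := Finset.univ.filter fun k => β₀ k ≠ 0
  rw [Nat.card_eq_fintype_card, Fintype.card_subtype] at hs
  have hsupport : ∑ k ∈ T, |v k| ≤ √s * √(∑ k, v k ^ 2) :=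
    (sum_abs_le_sqrt_card_mul T v).trans (by gcongr)
  have hsplit : l1 v - 2 * ∑ k ∈ T, |v k| ≤ l1 (β₀ + v) - l1 β₀ := by
    unfold l1
    rw [Finset.sum_filter, Finset.mul_sum, ← Finset.sum_sub_distrib, ← Finset.sum_sub_distrib]
    refine Finset.sum_le_sum fun k _ => ?_
    by_cases hk : β₀ k = 0
    · simp [hk]
    · rw [if_pos hk, Pi.add_apply]
      have := abs_sub_abs_le_abs_sub (β₀ k) (β₀ k + v k)
      rw [show β₀ k - (β₀ k + v k) = -v k by ring, abs_neg] at this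
      linarith
  linarith

end LOne

section Lasso

lemma lasso_bounds_of_curvature {Q w H E q ρ a₁ a₂ : ℝ} (ha₁ : 0 ≤ a₁)
    (hw : 0 < w) (hq : 0 < q) (hE : 0 ≤ E) (hρ : 0 ≤ ρ) (hQ : 0 ≤ Q)
    (hbasic : Q + w / 2 * a₁ ≤ H * a₂ + E) (hcurv : q * a₂ ^ 2 - ρ * a₁ ^ 2 ≤ Q)
    (hH : 16 * ρ * H ^ 2 ≤ q * w ^ 2) (hρE : 8 * ρ * E ≤ w ^ 2) :
    Q ≤ 2 * E + 3 * (H ^ 2 / q) ∧ w * a₁ ≤ 3 * E + 4 * (H ^ 2 / q) := by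
  have hcone : w ^ 2 * a₁ ^ 2 ≤ 8 * H ^ 2 * a₂ ^ 2 + 8 * E ^ 2 := by
    have hsq : (w / 2 * a₁) ^ 2 ≤ (H * a₂ + E) ^ 2 := by gcongr; linarith
    nlinarith [sq_nonneg (H * a₂ - E)]
  have hdeviation : ρ * a₁ ^ 2 ≤ q / 2 * a₂ ^ 2 + E := by
    refine le_of_mul_le_mul_left ?_ (by positivity : 0 < w ^ 2)
    calc w ^ 2 * (ρ * a₁ ^ 2) = ρ * (w ^ 2 * a₁ ^ 2) := by ring
      _ ≤ ρ * (8 * H ^ 2 * a₂ ^ 2 + 8 * E ^ 2) := by gcongr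
      _ = 16 * ρ * H ^ 2 * (a₂ ^ 2 / 2) + 8 * ρ * E * E := by ring
      _ ≤ q * w ^ 2 * (a₂ ^ 2 / 2) + w ^ 2 * E := by gcongr
      _ = w ^ 2 * (q / 2 * a₂ ^ 2 + E) := by ring
  have hyoung : H * a₂ ≤ q / 8 * a₂ ^ 2 + 2 * (H ^ 2 / q) := by
    have hsq : q / 8 * a₂ ^ 2 + 2 * (H ^ 2 / q) - H * a₂ = (q * a₂ - 4 * H) ^ 2 / (8 * q) := by
      field_simp; ring
    have : 0 ≤ (q * a₂ - 4 * H) ^ 2 / (8 * q) := by positivity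
    linarith
  have hwa : 0 ≤ w * a₁ := by positivity
  have : 0 ≤ H ^ 2 / q := by positivity
  constructor <;> linarith

variable {ι : Type*} [Fintype ι] {β₀ v : ι → ℝ} {C C₁ N ℓ s t E Q : ℝ} {j : ℕ}

lemma lasso_cone_of_noise_le {w η : ℝ} (hw : 0 ≤ w) (hη : η ≤ w / 2)
    (hcard : (Nat.card {k // β₀ k ≠ 0} : ℝ) ≤ s)
    (hbasic : Q + w * (l1 (β₀ + v) - l1 β₀) ≤ η * l1 v + E) :
    Q + w / 2 * l1 v ≤ 2 * w * √s * √(∑ k, v k ^ 2) + E := by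
  have hpenalty := mul_le_mul_of_nonneg_left (l1_sub_two_mul_le β₀ v hcard) hw
  have hnoise := mul_le_mul_of_nonneg_right hη (l1_nonneg v)
  linarith

lemma lasso_cone_of_card {w η : ℝ} (hw : 0 ≤ w) (hη : 0 ≤ η)
    (hbasic : Q + w * (l1 (β₀ + v) - l1 β₀) ≤ η * l1 v + E) :
    Q + w / 2 * l1 v ≤ 2 * (w + η) * √(Fintype.card ι) * √(∑ k, v k ^ 2) + E := by
  have hl1 : l1 v ≤ √(Fintype.card ι : ℝ) * √(∑ k, v k ^ 2) :=
    sum_abs_le_sqrt_card_mul Finset.univ v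
  have hpenalty : -l1 v ≤ l1 (β₀ + v) - l1 β₀ := by
    have := l1_sub_le (β₀ + v) v
    rw [add_sub_cancel_right] at this
    linarith
  have hscaled := mul_le_mul_of_nonneg_left hpenalty hw
  have htotal := mul_le_mul_of_nonneg_left hl1 (by positivity : 0 ≤ 2 * (w + η))
  nlinarith [mul_nonneg hw (l1_nonneg v), mul_nonneg hη (l1_nonneg v)]

lemma lasso_cone_of_card_sq_le (hC₁ : 0 ≤ C₁) (hC : 3 * C₁ ≤ C) (hN : 0 ≤ N) (hℓ : 1 ≤ ℓ)
    (hjℓ : ℓ ≤ j) (hs : 1 ≤ s) (ht : Real.exp (2 * j) ≤ t)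
    (hι : (Fintype.card ι : ℝ) ≤ Real.exp ℓ) :
    (2 * (2 * C * √(N * ℓ) + 2 * C₁ * √(N * (ℓ + j))) * √(Fintype.card ι)) ^ 2 ≤
      72 * C ^ 2 * N * (t * s * ℓ) := by
  have hC₀ : 0 ≤ C := by linarith
  have hfactor : 2 * C * √(N * ℓ) + 2 * C₁ * √(N * (ℓ + j)) ≤ 3 * C * √(N * (ℓ + j)) :=
    calc 2 * C * √(N * ℓ) + 2 * C₁ * √(N * (ℓ + j))
        ≤ 2 * C * √(N * (ℓ + j)) + 2 * C₁ * √(N * (ℓ + j)) := by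
          gcongr
          exact le_add_of_nonneg_right (Nat.cast_nonneg j)
      _ ≤ 3 * C * √(N * (ℓ + j)) := by
          rw [← add_mul]
          gcongr
          linarith
  have ht₀ : 0 ≤ t := (Real.exp_pos _).le.trans ht
  have hdim : (Fintype.card ι : ℝ) ≤ Real.exp j := hι.trans (Real.exp_le_exp.2 hjℓ)
  have hjexp : (j : ℝ) ≤ Real.exp j := by linarith [Real.add_one_le_exp (j : ℝ)]
  calc (2 * (2 * C * √(N * ℓ) + 2 * C₁ * √(N * (ℓ + j))) * √(Fintype.card ι)) ^ 2
      ≤ (2 * (3 * C * √(N * (ℓ + j))) * √(Real.exp j)) ^ 2 := by gcongr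
    _ = 36 * C ^ 2 * N * ((ℓ + j) * Real.exp j) := by
        simp only [mul_pow]
        rw [Real.sq_sqrt (by positivity), Real.sq_sqrt (by positivity)]
        ring
    _ ≤ 36 * C ^ 2 * N * ((Real.exp j + Real.exp j) * Real.exp j) := by
        gcongr
        linarith
    _ = 72 * C ^ 2 * N * (Real.exp (2 * j) * 1) := by rw [two_mul (j : ℝ), Real.exp_add]; ring
    _ ≤ 72 * C ^ 2 * N * (t * (s * ℓ)) := by
        gcongr
        exact one_le_mul_of_one_le_of_one_le hs hℓ
    _ = 72 * C ^ 2 * N * (t * s * ℓ) := by ring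

-- When `j` exceeds `ℓ`, the noise level `√(N (ℓ + j))` may dominate the penalty level `√(N ℓ)`, so
-- that the lasso is no longer sparse; but then the dimension is at most `exp j`.
lemma exists_lasso_cone (hC₁ : 0 ≤ C₁) (hC : 3 * C₁ ≤ C) (hN : 0 ≤ N) (hℓ : 1 ≤ ℓ)
    (hs : 1 ≤ s) (ht : Real.exp (2 * j) ≤ t) (hcard : (Nat.card {k // β₀ k ≠ 0} : ℝ) ≤ s)
    (hι : (Fintype.card ι : ℝ) ≤ Real.exp ℓ)
    (hbasic : Q + 2 * C * √(N * ℓ) * (l1 (β₀ + v) - l1 β₀) ≤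
      2 * C₁ * √(N * (ℓ + j)) * l1 v + E) :
    ∃ H, Q + 2 * C * √(N * ℓ) / 2 * l1 v ≤ H * √(∑ k, v k ^ 2) + E ∧
      H ^ 2 ≤ 72 * C ^ 2 * N * (t * s * ℓ) := by
  have hC₀ : 0 ≤ C := by linarith
  have ht₁ : 1 ≤ t := (Real.one_le_exp (by positivity)).trans ht
  have hw : 0 ≤ 2 * C * √(N * ℓ) := by positivity
  rcases le_or_gt (j : ℝ) ℓ with hjℓ | hjℓ
  · refine ⟨_, lasso_cone_of_noise_le hw ?_ hcard hbasic, ?_⟩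
    · have hsqrt : √(N * (ℓ + j)) ≤ 3 / 2 * √(N * ℓ) := by
        rw [Real.sqrt_le_left (by positivity), mul_pow, Real.sq_sqrt (by positivity)]
        nlinarith [mul_le_mul_of_nonneg_left hjℓ hN, mul_nonneg hN (by linarith : 0 ≤ ℓ)]
      calc 2 * C₁ * √(N * (ℓ + j)) ≤ 2 * C₁ * (3 / 2 * √(N * ℓ)) := by gcongr
        _ = 3 * C₁ * √(N * ℓ) := by ring
        _ ≤ C * √(N * ℓ) := by gcongr
        _ = 2 * C * √(N * ℓ) / 2 := by ring
    · calc (2 * (2 * C * √(N * ℓ)) * √s) ^ 2 = 16 * C ^ 2 * N * (1 * s * ℓ) := by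
            simp only [mul_pow]
            rw [Real.sq_sqrt (by positivity), Real.sq_sqrt (by positivity)]
            ring
        _ ≤ 72 * C ^ 2 * N * (t * s * ℓ) := by gcongr; norm_num
  · exact ⟨_, lasso_cone_of_card hw (by positivity) hbasic,
      lasso_cone_of_card_sq_le hC₁ hC hN hℓ hjℓ.le hs ht hι⟩

lemma lasso_step {q ρ : ℝ} (hC₁ : 0 ≤ C₁) (hC : 3 * C₁ ≤ C) (hC₀ : 0 < C) (hN : 0 < N)
    (hℓ : 1 ≤ ℓ) (hq : 0 < q) (hρ : 0 ≤ ρ) (hs : 1 ≤ s) (ht : Real.exp (2 * j) ≤ t)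
    (hcard : (Nat.card {k // β₀ k ≠ 0} : ℝ) ≤ s) (hι : (Fintype.card ι : ℝ) ≤ Real.exp ℓ)
    (hE : 0 ≤ E) (hQ : 0 ≤ Q)
    (hbasic : Q + 2 * C * √(N * ℓ) * (l1 (β₀ + v) - l1 β₀) ≤
      2 * C₁ * √(N * (ℓ + j)) * l1 v + E)
    (hcurv : q * N * ∑ k, v k ^ 2 - ρ * √(N * (ℓ + j)) * l1 v ^ 2 ≤ Q)
    (hsize : 288 * ρ * (t * s) * √(N * (ℓ + j)) ≤ q * N)
    (hsmall : 8 * (ρ * √(N * (ℓ + j))) * E ≤ 4 * C ^ 2 * (N * ℓ)) :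
    Q ≤ 2 * E + 3 * (72 * C ^ 2 / q * (t * s * ℓ)) ∧
      2 * C * √(N * ℓ) * l1 v ≤ 3 * E + 4 * (72 * C ^ 2 / q * (t * s * ℓ)) := by
  obtain ⟨H, hcone, hH⟩ := exists_lasso_cone hC₁ hC hN.le hℓ hs ht hcard hι hbasic
  have hwsq : (2 * C * √(N * ℓ)) ^ 2 = 4 * C ^ 2 * (N * ℓ) := by
    rw [mul_pow, Real.sq_sqrt (by positivity)]; ring
  have hcurvature_dominates :
      16 * (ρ * √(N * (ℓ + j))) * H ^ 2 ≤ q * N * (2 * C * √(N * ℓ)) ^ 2 :=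
    calc 16 * (ρ * √(N * (ℓ + j))) * H ^ 2
        ≤ 16 * (ρ * √(N * (ℓ + j))) * (72 * C ^ 2 * N * (t * s * ℓ)) := by gcongr
      _ = 288 * ρ * (t * s) * √(N * (ℓ + j)) * (4 * C ^ 2 * (N * ℓ)) := by ring
      _ ≤ q * N * (4 * C ^ 2 * (N * ℓ)) := by gcongr
      _ = q * N * (2 * C * √(N * ℓ)) ^ 2 := by rw [hwsq]
  have hbounds := lasso_bounds_of_curvature (l1_nonneg v) (by positivity) (mul_pos hq hN) hE
    (by positivity) hQ hcone
    (by rwa [Real.sq_sqrt (Finset.sum_nonneg fun _ _ => sq_nonneg _)])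
    hcurvature_dominates (hsmall.trans_eq hwsq.symm)
  have hHq : H ^ 2 / (q * N) ≤ 72 * C ^ 2 / q * (t * s * ℓ) := by
    rw [div_le_iff₀ (mul_pos hq hN)]
    refine hH.trans_eq ?_
    field_simp
  exact ⟨by linarith [hbounds.1], by linarith [hbounds.2]⟩

end Lasso

section Extend

variable {p : ℕ} {r : Fin p}

/-- The vector with `r`-th entry `c` and the other entries given by `γ`. It turns projection
coefficients, indexed by `k ≠ r`, into directions of `ℝᵖ`. -/
def extend (r : Fin p) (c : ℝ) (γ : {k // k ≠ r} → ℝ) (k : Fin p) : ℝ :=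
  if h : k = r then c else γ ⟨k, h⟩

@[simp] lemma extend_self (c : ℝ) (γ : {k // k ≠ r} → ℝ) : extend r c γ r = c := by
  simp [extend]

@[simp] lemma extend_ne (c : ℝ) (γ : {k // k ≠ r} → ℝ) (k : {k // k ≠ r}) :
    extend r c γ k.1 = γ k := by
  simp [extend, k.2]

lemma dotProduct_extend (x : Fin p → ℝ) (c : ℝ) (γ : {k // k ≠ r} → ℝ) :
    x ⬝ᵥ extend r c γ = c * x r + ∑ k : {k // k ≠ r}, x k.1 * γ k := by
  unfold dotProduct
  rw [Fintype.sum_eq_add_sum_subtype_ne _ r]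
  simp [mul_comm]

lemma extend_add (c c' : ℝ) (γ γ' : {k // k ≠ r} → ℝ) :
    extend r (c + c') (γ + γ') = extend r c γ + extend r c' γ' := by
  funext k
  by_cases h : k = r <;> simp [extend, h]

lemma l1_extend (c : ℝ) (γ : {k // k ≠ r} → ℝ) : l1 (extend r c γ) = |c| + l1 γ := by
  unfold l1
  rw [Fintype.sum_eq_add_sum_subtype_ne _ r]
  simp

lemma sum_sq_extend (c : ℝ) (γ : {k // k ≠ r} → ℝ) :
    ∑ k, extend r c γ k ^ 2 = c ^ 2 + ∑ k, γ k ^ 2 := by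
  rw [Fintype.sum_eq_add_sum_subtype_ne _ r]
  simp

lemma projQuad_eq_extend {M : Matrix (Fin p) (Fin p) ℝ} (hM : M.IsSymm) (γ : {k // k ≠ r} → ℝ) :
    projQuad M r γ = extend r (-1) γ ⬝ᵥ (M *ᵥ extend r (-1) γ) := by
  have hrow (k : Fin p) :
      (M *ᵥ extend r (-1) γ) k = -M k r + ∑ l : {k // k ≠ r}, M k l.1 * γ l :=
    (dotProduct_extend (M k) (-1) γ).trans (by ring)
  have hoff : ∑ k : {k // k ≠ r}, (-M k.1 r + ∑ l : {k // k ≠ r}, M k.1 l.1 * γ l) * γ k =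
      -∑ k : {k // k ≠ r}, M r k.1 * γ k +
        ∑ k : {k // k ≠ r}, ∑ l : {k // k ≠ r}, γ k * M k.1 l.1 * γ l := by
    rw [← Finset.sum_neg_distrib, ← Finset.sum_add_distrib]
    refine Finset.sum_congr rfl fun k _ => ?_
    rw [add_mul, Finset.sum_mul, hM.apply, neg_mul]
    congr 1
    exact Finset.sum_congr rfl fun l _ => by ring
  rw [dotProduct_comm, dotProduct_extend]
  simp only [hrow, hoff, projQuad]
  ring

end Extend

section Convex

lemma GLM.convexOn_d (G : GLM) (y : ℝ) : ConvexOn ℝ Set.univ fun t => G.d y (G.g t) := by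
  refine MonotoneOn.convexOn_of_deriv convex_univ
    (fun t _ => (G.hasDerivAt_d y t).continuousAt.continuousWithinAt)
    (fun t _ => (G.hasDerivAt_d y t).differentiableAt.differentiableWithinAt) ?_
  rw [show deriv (fun t => G.d y (G.g t)) = fun t => G.g t - y from
    funext fun t => (G.hasDerivAt_d y t).deriv]
  exact fun s _ t _ hst => sub_le_sub_right (G.monotone_g hst) y

lemma convexOn_finsetSum {ι E : Type*} [AddCommGroup E] [Module ℝ E] {D : Set E}
    (hD : Convex ℝ D) {T : Finset ι} {f : ι → E → ℝ} (hf : ∀ i ∈ T, ConvexOn ℝ D (f i)) :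
    ConvexOn ℝ D fun x => ∑ i ∈ T, f i x := by
  refine ⟨hD, fun x hx y hy a b ha hb hab => ?_⟩
  rw [Finset.smul_sum, Finset.smul_sum, ← Finset.sum_add_distrib]
  exact Finset.sum_le_sum fun i hi => (hf i hi).2 hx hy ha hb hab

lemma convexOn_mul_sq_dotProduct_sub {ι : Type*} [Fintype ι] {c : ℝ} (hc : 0 ≤ c)
    (x β' : ι → ℝ) :
    ConvexOn ℝ Set.univ fun β : ι → ℝ => c * (x ⬝ᵥ (β - β')) * (x ⬝ᵥ (β - β')) := by
  have hsq : ConvexOn ℝ Set.univ fun t : ℝ => c * (t - x ⬝ᵥ β') ^ 2 :=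
    (((even_two.convexOn_pow (𝕜 := ℝ)).translate_left (-(x ⬝ᵥ β'))).smul hc)
  refine (hsq.comp_linearMap (dotProductBilin ℝ ℝ x)).congr fun β _ => ?_
  change c * (x ⬝ᵥ β - x ⬝ᵥ β') ^ 2 = _
  rw [dotProduct_sub]
  ring

end Convex

namespace Stream

variable {Ω : Type*} (S : Stream Ω) (G : GLM)

lemma N_zero : S.N 0 = 0 := by simp [N]

lemma N_succ (j : ℕ) : S.N (j + 1) = S.N j + S.n (j + 1) := by
  simp [N, Finset.sum_Icc_succ_top]

lemma N_mono : Monotone S.N :=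
  monotone_nat_of_le_succ fun j => by rw [N_succ]; exact Nat.le_add_right _ _

lemma sum_range_N_eq (j : ℕ) (f : ℕ → ℝ) :
    ∑ i ∈ Finset.range (S.N j), f i =
      ∑ i ∈ Finset.range (S.N (j - 1)), f i + ∑ i ∈ S.batch j, f i :=
  (Finset.sum_range_add_sum_Ico f (S.N_mono (Nat.sub_le j 1))).symm

lemma sum_batches (j : ℕ) (f : ℕ → ℝ) :
    ∑ l ∈ Finset.Icc 1 j, ∑ i ∈ S.batch l, f i = ∑ i ∈ Finset.range (S.N j), f i := by
  induction j with
  | zero => simp [N_zero]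
  | succ j ih =>
    rw [Finset.sum_Icc_succ_top (by omega), ih, S.sum_range_N_eq (j + 1), Nat.add_sub_cancel]

lemma lt_N_of_mem_batch {i j : ℕ} (hi : i ∈ S.batch j) (hj : j ≤ S.b) : i < S.N S.b :=
  (Finset.mem_Ico.1 hi).2.trans_le (S.N_mono hj)

lemma J_eq_sum (j : ℕ) (β : Fin S.p → ℝ) (ω : Ω) :
    S.J G j β ω = ∑ i ∈ S.batch j,
      deriv G.g (S.x i ω ⬝ᵥ β) • Matrix.vecMulVec (S.x i ω) (S.x i ω) := by
  ext k l
  simp [J, Matrix.sum_apply, Matrix.vecMulVec_apply, mul_assoc]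

lemma dotProduct_smul_vecMulVec_mulVec {n : Type*} [Fintype n] (a : ℝ) (x u v : n → ℝ) :
    u ⬝ᵥ ((a • Matrix.vecMulVec x x) *ᵥ v) = a * (x ⬝ᵥ u) * (x ⬝ᵥ v) := by
  rw [Matrix.smul_mulVec, dotProduct_smul, Matrix.vecMulVec_mulVec, dotProduct_smul,
    dotProduct_comm u]
  simp only [MulOpposite.smul_eq_mul_unop, MulOpposite.unop_op, smul_eq_mul]
  ring

lemma dotProduct_J_mulVec (j : ℕ) (β u v : Fin S.p → ℝ) (ω : Ω) :
    u ⬝ᵥ (S.J G j β ω *ᵥ v) =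
      ∑ i ∈ S.batch j, deriv G.g (S.x i ω ⬝ᵥ β) * (S.x i ω ⬝ᵥ u) * (S.x i ω ⬝ᵥ v) := by
  rw [J_eq_sum, Matrix.sum_mulVec, dotProduct_sum]
  exact Finset.sum_congr rfl fun i _ => dotProduct_smul_vecMulVec_mulVec _ _ u v

lemma J_isSymm (j : ℕ) (β : Fin S.p → ℝ) (ω : Ω) : (S.J G j β ω).IsSymm := by
  ext k l
  simp only [J, Matrix.transpose_apply, Matrix.of_apply]
  exact Finset.sum_congr rfl fun i _ => by ring

lemma Jtilde_isSymm (j : ℕ) (ω : Ω) : (S.Jtilde G j ω).IsSymm := by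
  unfold Jtilde Matrix.IsSymm
  rw [Matrix.transpose_sum]
  exact Finset.sum_congr rfl fun i _ => S.J_isSymm G i _ ω

lemma dotProduct_Jtilde_mulVec (j : ℕ) (u v : Fin S.p → ℝ) (ω : Ω) :
    u ⬝ᵥ (S.Jtilde G j ω *ᵥ v) = ∑ l ∈ Finset.Icc 1 j, ∑ i ∈ S.batch l,
      deriv G.g (S.x i ω ⬝ᵥ S.βhat l ω) * (S.x i ω ⬝ᵥ u) * (S.x i ω ⬝ᵥ v) := by
  unfold Jtilde
  rw [Matrix.sum_mulVec, dotProduct_sum]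
  exact Finset.sum_congr rfl fun l _ => S.dotProduct_J_mulVec G l _ u v ω

lemma γtilde_eq_extend (j : ℕ) (ω : Ω) : S.γtilde j ω = extend S.r (-1) (S.γhat j ω) := rfl

lemma zhat_eq (j i : ℕ) (ω : Ω) : S.zhat j i ω = -(S.x i ω ⬝ᵥ S.γtilde j ω) := by
  rw [γtilde_eq_extend, dotProduct_extend, zhat]
  ring

lemma Jtilde_mulVec_γtilde_self (j : ℕ) (ω : Ω) :
    (S.Jtilde G j ω *ᵥ S.γtilde j ω) S.r = -S.τhat G j ω := by
  have := dotProduct_extend (S.Jtilde G j ω S.r) (-1) (S.γhat j ω)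
  rw [γtilde_eq_extend, Matrix.mulVec, this, τhat]
  ring

lemma two_mul_N_mul_lam {j : ℕ} (hN : 0 < S.N j) (C : ℝ) :
    2 * (S.N j : ℝ) * S.lam C j = 2 * C * √(S.N j * Real.log S.p) := by
  have hN' : (0 : ℝ) < S.N j := by exact_mod_cast hN
  have hsqrt : √((S.N j : ℝ) * Real.log S.p) = S.N j * √(Real.log S.p / S.N j) := by
    rw [show (S.N j : ℝ) * Real.log S.p = (S.N j : ℝ) ^ 2 * (Real.log S.p / S.N j) by field_simp,
      Real.sqrt_mul (sq_nonneg _), Real.sqrt_sq hN'.le]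
  rw [hsqrt, lam]
  ring

lemma sub_add_penalty_le {j : ℕ} (hN : 0 < S.N j) {C a b c d : ℝ}
    (h : 1 / (2 * (S.N j : ℝ)) * a + S.lam C j * b ≤ 1 / (2 * (S.N j : ℝ)) * c + S.lam C j * d) :
    a - c + 2 * C * √(S.N j * Real.log S.p) * (b - d) ≤ 0 := by
  have : (0 : ℝ) < S.N j := by exact_mod_cast hN
  rw [← S.two_mul_N_mul_lam hN]
  have hscaled := mul_le_mul_of_nonneg_left h (by positivity : (0 : ℝ) ≤ 2 * S.N j)
  have hcancel (a : ℝ) : 2 * (S.N j : ℝ) * (1 / (2 * (S.N j : ℝ)) * a) = a := by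
    field_simp
  rw [mul_add, mul_add, hcancel, hcancel] at hscaled
  linarith

lemma convexOn_lassoObjective {C : ℝ} (hC : 0 ≤ C) (j : ℕ) (ω : Ω) :
    ConvexOn ℝ Set.univ (S.lassoObjective G C j ω) := by
  have hdata : ConvexOn ℝ Set.univ fun β =>
      ∑ i ∈ S.batch j, G.d (S.y i ω) (G.g (S.x i ω ⬝ᵥ β)) :=
    convexOn_finsetSum convex_univ fun i _ =>
      (G.convexOn_d (S.y i ω)).comp_linearMap (dotProductBilin ℝ ℝ (S.x i ω))
  have hquad : ConvexOn ℝ Set.univ fun β => (β - S.βhat (j - 1) ω) ⬝ᵥ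
      (S.Jtilde G (j - 1) ω *ᵥ (β - S.βhat (j - 1) ω)) := by
    simp only [dotProduct_Jtilde_mulVec]
    exact convexOn_finsetSum convex_univ fun l _ => convexOn_finsetSum convex_univ fun i _ =>
      convexOn_mul_sq_dotProduct_sub (G.deriv_g_nonneg _) _ _
  have hlam : 0 ≤ S.lam C j := mul_nonneg hC (Real.sqrt_nonneg _)
  exact ((hdata.add (hquad.smul (by norm_num : (0 : ℝ) ≤ 1 / 2))).smul
    (by positivity : (0 : ℝ) ≤ 1 / (2 * (S.N j : ℝ)))).add (convexOn_l1.smul hlam)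

lemma lassoObjective_segment_le {C : ℝ} (hC : 0 ≤ C) {j : ℕ} {ω : Ω} {θ : ℝ} (hθ₀ : 0 ≤ θ)
    (hθ₁ : θ ≤ 1) (hmin : IsMinOn (S.lassoObjective G C j ω) Set.univ (S.βhat j ω)) :
    S.lassoObjective G C j ω (S.β₀ + θ • (S.βhat j ω - S.β₀)) ≤
      S.lassoObjective G C j ω S.β₀ := by
  have hconv := (S.convexOn_lassoObjective G hC j ω).2 (Set.mem_univ S.β₀)
    (Set.mem_univ (S.βhat j ω)) (sub_nonneg.2 hθ₁) hθ₀ (sub_add_cancel _ _)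
  have hle : S.lassoObjective G C j ω (S.βhat j ω) ≤ S.lassoObjective G C j ω S.β₀ :=
    hmin (Set.mem_univ _)
  rw [show S.β₀ + θ • (S.βhat j ω - S.β₀) = (1 - θ) • S.β₀ + θ • S.βhat j ω by module]
  refine hconv.trans ?_
  rw [smul_eq_mul, smul_eq_mul]
  linarith [mul_le_mul_of_nonneg_left hle hθ₀]

end Stream

/-! ### Constants and the good event -/

/-- The constants of the regularity conditions, normalized to have the signs that the conditions
give them. -/
structure ModelConstants (G : GLM) where
  K : ℝ
  M : ℝ
  L : ℝ
  δ : ℝ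
  K₂ : ℝ
  K₃ : ℝ
  κ : ℝ
  K_nonneg : 0 ≤ K
  M_nonneg : 0 ≤ M
  L_nonneg : 0 ≤ L
  δ_pos : 0 < δ
  one_le_K₂ : 1 ≤ K₂
  one_le_K₃ : 1 ≤ K₃
  κ_pos : 0 < κ

namespace ModelConstants

/-- Constants of the regularity conditions of arbitrary sign, enlarged where that is needed. -/
def normalize (G : GLM) (K M L K₂ K₃ : ℝ) {δ κ : ℝ} (hδ : 0 < δ) (hκ : 0 < κ) :
    ModelConstants G where
  K := max K 0
  M := max M 0
  L := max L 0
  δ := δ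
  K₂ := max K₂ 1
  K₃ := max K₃ 1
  κ := κ
  K_nonneg := le_max_right _ _
  M_nonneg := le_max_right _ _
  L_nonneg := le_max_right _ _
  δ_pos := hδ
  one_le_K₂ := le_max_right _ _
  one_le_K₃ := le_max_right _ _
  κ_pos := hκ

variable {G : GLM} (c : ModelConstants G)

/-- The constant `C₁` in the concentration bounds `C₁ √(N_j (log p + j))` for the score, the
information matrix and the projection residuals. -/
def noise : ℝ :=
  2 * G.φ * c.K₂ * c.K ^ 2 + (2 * c.K₂ * c.K ^ 2) ^ 2 + (c.K₂ * c.K * (c.K + c.M)) ^ 2 + 4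

lemma K₂_pos : 0 < c.K₂ := zero_lt_one.trans_le c.one_le_K₂

lemma K₃_pos : 0 < c.K₃ := zero_lt_one.trans_le c.one_le_K₃

lemma noise_pos : 0 < c.noise := by
  have := G.φ_pos
  have := c.K₂_pos
  unfold noise
  positivity

end ModelConstants

/-- The constants of the regularity conditions together with the factor `C` of the tuning
parameters, which has to dominate the noise. -/
structure Constants (G : GLM) extends ModelConstants G where
  C : ℝ
  three_mul_noise_le : 3 * toModelConstants.noise ≤ C

namespace Constants

variable {G : GLM} (c : Constants G)

/-- The factor by which the error bounds deteriorate from one batch to the next. -/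
def growth : ℝ := 16 * c.K₂ * c.K₃

/-- The constant in the error bounds of a lasso with an exactly known loss. -/
def oracle : ℝ := 72 * c.C ^ 2 / (c.κ / (4 * c.K₂ * c.K₃))

/-- The constant in the bound on the squared prediction error of the online lasso. -/
def pred : ℝ := 24 * c.K₃ * c.oracle

/-- The constant in the `ℓ₁` error bound of the online lasso. -/
def lasso : ℝ := 3 * c.pred + 4 * c.oracle

/-- The constant in the bound on the effect that plugging the online lasso into the information
matrix has on the low-dimensional projection. -/
def plugIn : ℝ := 4 * c.K₃ * (c.L * (c.K + c.M)) ^ 2 * c.pred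

/-- The constant in the `ℓ₁` error bound of the low-dimensional projection. -/
def proj : ℝ := 3 * c.plugIn + 4 * c.oracle

/-- The square root of the constant in the sample size condition: the sum of the thresholds that
the single steps of the analysis need. -/
def size : ℝ :=
  1 + 288 * c.noise / c.κ + c.noise * c.pred / c.C ^ 2 + c.noise * c.plugIn / c.C ^ 2 +
    c.lasso / (c.C * c.δ) + 2 * G.φ / c.δ

lemma C_pos : 0 < c.C := by linarith [c.three_mul_noise_le, c.noise_pos]

lemma one_le_K₂_mul_K₃ : 1 ≤ c.K₂ * c.K₃ :=
  one_le_mul_of_one_le_of_one_le c.one_le_K₂ c.one_le_K₃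

lemma sixteen_le_growth : 16 ≤ c.growth := by
  unfold growth
  linarith [c.one_le_K₂_mul_K₃]

lemma one_le_growth : 1 ≤ c.growth := by linarith [c.sixteen_le_growth]

lemma growth_pos : 0 < c.growth := zero_lt_one.trans_le c.one_le_growth

lemma oracle_pos : 0 < c.oracle := by
  have := c.C_pos
  have := c.κ_pos
  have := c.K₂_pos
  have := c.K₃_pos
  unfold oracle
  positivity

lemma pred_pos : 0 < c.pred := by
  have := c.K₃_pos
  have := c.oracle_pos
  unfold pred
  positivity

lemma lasso_pos : 0 < c.lasso := by
  have := c.pred_pos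
  have := c.oracle_pos
  unfold lasso
  positivity

lemma plugIn_nonneg : 0 ≤ c.plugIn := by
  have := c.K₃_pos
  have := c.pred_pos
  unfold plugIn
  positivity

lemma proj_nonneg : 0 ≤ c.proj := by
  have := c.plugIn_nonneg
  have := c.oracle_pos
  unfold proj
  positivity

lemma thresholds_le_size :
    1 ≤ c.size ∧ 288 * c.noise / c.κ ≤ c.size ∧ c.noise * c.pred / c.C ^ 2 ≤ c.size ∧
      c.noise * c.plugIn / c.C ^ 2 ≤ c.size ∧ c.lasso / (c.C * c.δ) ≤ c.size ∧
      2 * G.φ / c.δ ≤ c.size := by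
  have hC := c.C_pos
  have hnoise := c.noise_pos
  have : 0 ≤ 288 * c.noise / c.κ := div_nonneg (by positivity) c.κ_pos.le
  have : 0 ≤ c.noise * c.pred / c.C ^ 2 :=
    div_nonneg (mul_nonneg hnoise.le c.pred_pos.le) (by positivity)
  have : 0 ≤ c.noise * c.plugIn / c.C ^ 2 :=
    div_nonneg (mul_nonneg hnoise.le c.plugIn_nonneg) (by positivity)
  have : 0 ≤ c.lasso / (c.C * c.δ) := div_nonneg c.lasso_pos.le (mul_pos hC c.δ_pos).le
  have : 0 ≤ 2 * G.φ / c.δ := div_nonneg (by linarith [G.φ_pos]) c.δ_pos.le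
  unfold size
  refine ⟨?_, ?_, ?_, ?_, ?_, ?_⟩ <;> linarith

lemma size_pos : 0 < c.size := zero_lt_one.trans_le c.thresholds_le_size.1

lemma exp_two_mul_le_growth_pow (j : ℕ) : Real.exp (2 * j) ≤ c.growth ^ j := by
  rw [mul_comm, Real.exp_nat_mul]
  have hexp : Real.exp 2 ≤ 16 := by
    rw [show (2 : ℝ) = 1 + 1 by norm_num, Real.exp_add]
    nlinarith [Real.exp_one_lt_d9, Real.exp_pos 1]
  gcongr
  exact hexp.trans c.sixteen_le_growth

lemma sum_growth_pow_le (j : ℕ) : ∑ l ∈ Finset.Icc 1 j, c.growth ^ l ≤ 2 * c.growth ^ j := by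
  have hgrowth := c.sixteen_le_growth
  induction j with
  | zero => simp
  | succ j ih =>
    rw [Finset.sum_Icc_succ_top (by omega), pow_succ]
    nlinarith [pow_pos c.growth_pos j]

end Constants

namespace Stream

variable {Ω : Type*} {S : Stream Ω} {G : GLM} {c : Constants G}
  {Jpop : Matrix (Fin S.p) (Fin S.p) ℝ} {s₀ sr s : ℝ} {ω : Ω} {j : ℕ}

/-- The rate of the squared prediction error after `j` batches at sparsity `s`. -/
def rate (S : Stream Ω) (c : Constants G) (s : ℝ) (j : ℕ) : ℝ :=
  c.growth ^ j * s * Real.log S.p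

/-- The sample size condition of the deterministic analysis, at upper bounds `s₀` and `sr` for the
sparsities of the target and of the population projection. -/
structure SampleSize (S : Stream Ω) (c : Constants G) (s₀ sr : ℝ) : Prop where
  one_le_log : 1 ≤ Real.log S.p
  one_le_s₀ : 1 ≤ s₀
  one_le_sr : 1 ≤ sr
  card_β₀_le : (Nat.card {k // S.β₀ k ≠ 0} : ℝ) ≤ s₀
  card_γ₀_le : (Nat.card {k // S.γ₀ k ≠ 0} : ℝ) ≤ sr
  le_N : ∀ j ∈ Finset.Icc 1 S.b,
    (c.size * (c.growth ^ j * (s₀ * sr))) ^ 2 * (Real.log S.p + j) ≤ S.N j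

namespace SampleSize

variable (hs : S.SampleSize c s₀ sr)

include hs

lemma s₀_pos : 0 < s₀ := zero_lt_one.trans_le hs.one_le_s₀

lemma sr_pos : 0 < sr := zero_lt_one.trans_le hs.one_le_sr

lemma log_pos : 0 < Real.log S.p := zero_lt_one.trans_le hs.one_le_log

lemma p_pos : 0 < S.p := by
  by_contra hp
  have := hs.log_pos
  simp_all

lemma N_pos (hj : j ∈ Finset.Icc 1 S.b) : (0 : ℝ) < S.N j := by
  refine lt_of_lt_of_le ?_ (hs.le_N j hj)
  have := c.growth_pos
  have := hs.s₀_pos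
  have := hs.sr_pos
  have := hs.log_pos
  have := c.size_pos
  positivity

lemma N_one_pos (hj : j ∈ Finset.Icc 1 S.b) : 0 < S.N 1 := by
  have hb := Finset.mem_Icc.1 hj
  exact_mod_cast hs.N_pos (Finset.mem_Icc.2 ⟨le_rfl, hb.1.trans hb.2⟩)

lemma s₀_le_mul : s₀ ≤ s₀ * sr := le_mul_of_one_le_right hs.s₀_pos.le hs.one_le_sr

lemma sr_le_mul : sr ≤ s₀ * sr := le_mul_of_one_le_left hs.sr_pos.le hs.one_le_s₀

lemma rate_pos (hpos : 0 < s) (j : ℕ) : 0 < S.rate c s j := by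
  have := c.growth_pos
  have := hs.log_pos
  unfold rate
  positivity

lemma mul_sqrt_le (hj : j ∈ Finset.Icc 1 S.b) {B : ℝ} (hB : 0 ≤ B) (hBsize : B ≤ c.size)
    (hs₀ : 0 ≤ s) (hsle : s ≤ s₀ * sr) :
    B * (c.growth ^ j * s) * √(S.N j * (Real.log S.p + j)) ≤ S.N j := by
  have hgrowth := c.growth_pos
  have hlog := hs.log_pos
  have hsq : (B * (c.growth ^ j * s)) ^ 2 * (Real.log S.p + j) ≤ S.N j := by
    have : 0 ≤ c.size := hB.trans hBsize
    refine le_trans ?_ (hs.le_N j hj)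
    gcongr
  rw [← Real.sqrt_sq (by positivity : 0 ≤ B * (c.growth ^ j * s)),
    ← Real.sqrt_mul (sq_nonneg _), Real.sqrt_le_left (Nat.cast_nonneg _)]
  nlinarith [Nat.cast_nonneg (α := ℝ) (S.N j)]

lemma sqrt_div_le (hj : j ∈ Finset.Icc 1 S.b) :
    √((Real.log S.p + j) / S.N j) ≤ c.δ / (2 * G.φ) := by
  have hφ := G.φ_pos
  have hδ := c.δ_pos
  have hN := hs.N_pos hj
  have hle := hs.mul_sqrt_le hj (by positivity) c.thresholds_le_size.2.2.2.2.2 zero_le_one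
    (hs.one_le_s₀.trans hs.s₀_le_mul)
  have hpow : 1 ≤ c.growth ^ j := one_le_pow₀ c.one_le_growth
  have hsq : (Real.log S.p + j) / S.N j = S.N j * (Real.log S.p + j) / S.N j ^ 2 := by field_simp
  rw [hsq, Real.sqrt_div' _ (sq_nonneg _), Real.sqrt_sq hN.le, div_le_div_iff₀ hN (by positivity)]
  calc √(S.N j * (Real.log S.p + j)) * (2 * G.φ)
      = c.δ * (2 * G.φ / c.δ * √(S.N j * (Real.log S.p + j))) := by field_simp
    _ ≤ c.δ * (2 * G.φ / c.δ * (c.growth ^ j * 1) * √(S.N j * (Real.log S.p + j))) := by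
        gcongr
        exact le_mul_of_one_le_right (by positivity) (by rwa [mul_one])
    _ ≤ c.δ * S.N j := by gcongr

lemma mul_rate_le_sqrt (hj : j ∈ Finset.Icc 1 S.b) {B : ℝ} (hB : 0 ≤ B) (hBsize : B ≤ c.size)
    (hs₀ : 0 ≤ s) (hsle : s ≤ s₀ * sr) : B * S.rate c s j ≤ √(S.N j * Real.log S.p) := by
  have hgrowth := c.growth_pos
  have hlog := hs.log_pos
  have hN := hs.N_pos hj
  have hsqrt : 0 < √(S.N j * Real.log S.p) := Real.sqrt_pos.2 (mul_pos hN hlog)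
  refine le_of_mul_le_mul_right ?_ hsqrt
  calc B * S.rate c s j * √(S.N j * Real.log S.p)
      = B * (c.growth ^ j * s) * √(S.N j * Real.log S.p) * Real.log S.p := by unfold rate; ring
    _ ≤ B * (c.growth ^ j * s) * √(S.N j * (Real.log S.p + j)) * Real.log S.p := by
        gcongr
        exact le_add_of_nonneg_right (Nat.cast_nonneg j)
    _ ≤ S.N j * Real.log S.p := by gcongr; exact hs.mul_sqrt_le hj hB hBsize hs₀ hsle
    _ = √(S.N j * Real.log S.p) * √(S.N j * Real.log S.p) :=
        (Real.mul_self_sqrt (by positivity)).symm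

end SampleSize

/-- The event on which the analysis is deterministic: the regularity conditions hold at `ω`, the
estimators are minimizers, the score, the information matrix and the projection residuals
concentrate, and the population information matrix `Jpop` is positive definite. -/
structure GoodOutcome (S : Stream Ω) (c : Constants G) (Jpop : Matrix (Fin S.p) (Fin S.p) ℝ)
    (ω : Ω) : Prop where
  curvature : ∀ u : Fin S.p → ℝ, c.κ * ∑ k, u k ^ 2 ≤ u ⬝ᵥ (Jpop *ᵥ u)
  bounded_x : ∀ i < S.N S.b, ∀ k, |S.x i ω k| ≤ c.K
  bounded_projection : ∀ i < S.N S.b, |∑ k : {k // k ≠ S.r}, S.x i ω k.1 * S.γ₀ k| ≤ c.M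
  lipschitz : ∀ i < S.N S.b, ∀ β β' : Fin S.p → ℝ,
    l1 (β - S.β₀) ≤ c.δ → l1 (β' - S.β₀) ≤ c.δ →
      |deriv G.g (S.x i ω ⬝ᵥ β) - deriv G.g (S.x i ω ⬝ᵥ β')| ≤
        c.L * |S.x i ω ⬝ᵥ β - S.x i ω ⬝ᵥ β'|
  deriv_le : ∀ i < S.N S.b, ∀ β : Fin S.p → ℝ, l1 (β - S.β₀) ≤ c.δ →
    deriv G.g (S.x i ω ⬝ᵥ β) ≤ c.K₂
  one_le_mul_deriv : ∀ i < S.N S.b, ∀ β : Fin S.p → ℝ, l1 (β - S.β₀) ≤ c.δ →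
    1 ≤ c.K₃ * deriv G.g (S.x i ω ⬝ᵥ β)
  lasso : ∀ j ∈ Finset.Icc 1 S.b, IsMinOn (S.lassoObjective G c.C j ω) Set.univ (S.βhat j ω)
  proj : ∀ j ∈ Finset.Icc 1 S.b, IsMinOn (S.projObjective G c.C j ω) Set.univ (S.γhat j ω)
  score : ∀ j ∈ Finset.Icc 1 S.b, ∀ k,
    |∑ i ∈ S.batch j, (S.y i ω - G.g (S.x i ω ⬝ᵥ S.β₀)) * S.x i ω k| ≤
      c.noise * √(S.N j * (Real.log S.p + j))
  info : ∀ j ∈ Finset.Icc 1 S.b, ∀ k l,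
    |∑ i ∈ Finset.range (S.N j), (deriv G.g (S.x i ω ⬝ᵥ S.β₀) * S.x i ω k * S.x i ω l -
      Jpop k l)| ≤ c.noise * √(S.N j * (Real.log S.p + j))
  resid : ∀ j ∈ Finset.Icc 1 S.b, ∀ k ≠ S.r,
    |∑ i ∈ Finset.range (S.N j), deriv G.g (S.x i ω ⬝ᵥ S.β₀) * S.x i ω k *
      (S.x i ω ⬝ᵥ extend S.r (-1) S.γ₀)| ≤ c.noise * √(S.N j * (Real.log S.p + j))

end Stream

/-! ### The online lasso -/

lemma l1_segment_sub_le {ι : Type*} [Fintype ι] {β₀ v : ι → ℝ} {δ θ : ℝ}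
    (hθ : θ ∈ Set.Icc (0 : ℝ) 1) (hv : l1 v ≤ δ) : l1 (β₀ + θ • v - β₀) ≤ δ := by
  rw [add_sub_cancel_left, l1_smul, abs_of_nonneg hθ.1]
  exact (mul_le_of_le_one_left (l1_nonneg v) hθ.2).trans hv

namespace Stream

variable {Ω : Type*} {S : Stream Ω} {G : GLM} {c : Constants G}
  {Jpop : Matrix (Fin S.p) (Fin S.p) ℝ} {s₀ sr s : ℝ} {ω : Ω} {j : ℕ}

/-- The sum of the squares of `x_iᵀ u` over the first `N_j` observations. -/
def energy (S : Stream Ω) (ω : Ω) (j : ℕ) (u : Fin S.p → ℝ) : ℝ :=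
  ∑ i ∈ Finset.range (S.N j), (S.x i ω ⬝ᵥ u) ^ 2

lemma energy_nonneg (u : Fin S.p → ℝ) : 0 ≤ S.energy ω j u :=
  Finset.sum_nonneg fun _ _ => sq_nonneg _

lemma sum_batches_sq_eq_energy (u : Fin S.p → ℝ) :
    ∑ l ∈ Finset.Icc 1 j, ∑ i ∈ S.batch l, (S.x i ω ⬝ᵥ u) ^ 2 = S.energy ω j u :=
  S.sum_batches j _

lemma energy_eq_pred_add_batch (u : Fin S.p → ℝ) :
    S.energy ω j u = S.energy ω (j - 1) u + ∑ i ∈ S.batch j, (S.x i ω ⬝ᵥ u) ^ 2 :=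
  S.sum_range_N_eq j _

namespace GoodOutcome

variable (h : S.GoodOutcome c Jpop ω)

include h

lemma sum_deriv_mul_sq_sub_le (hj : j ∈ Finset.Icc 1 S.b) (u : Fin S.p → ℝ) :
    |∑ i ∈ Finset.range (S.N j), deriv G.g (S.x i ω ⬝ᵥ S.β₀) * (S.x i ω ⬝ᵥ u) ^ 2 -
      S.N j * (u ⬝ᵥ (Jpop *ᵥ u))| ≤
      c.noise * √(S.N j * (Real.log S.p + j)) * l1 u ^ 2 := by
  set D := ∑ i ∈ Finset.range (S.N j),
    (deriv G.g (S.x i ω ⬝ᵥ S.β₀) • Matrix.vecMulVec (S.x i ω) (S.x i ω) - Jpop) with hD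
  have hentry (k l : Fin S.p) : |D k l| ≤ c.noise * √(S.N j * (Real.log S.p + j)) := by
    simp only [hD, Matrix.sum_apply, Matrix.sub_apply, Matrix.smul_apply,
      Matrix.vecMulVec_apply, smul_eq_mul, ← mul_assoc]
    exact h.info j hj k l
  have hquad : u ⬝ᵥ (D *ᵥ u) =
      ∑ i ∈ Finset.range (S.N j), deriv G.g (S.x i ω ⬝ᵥ S.β₀) * (S.x i ω ⬝ᵥ u) ^ 2 -
        S.N j * (u ⬝ᵥ (Jpop *ᵥ u)) := by
    simp only [hD, Matrix.sum_mulVec, dotProduct_sum, Matrix.sub_mulVec, dotProduct_sub,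
      dotProduct_smul_vecMulVec_mulVec, mul_assoc, sq]
    rw [Finset.sum_sub_distrib, Finset.sum_const, Finset.card_range, nsmul_eq_mul]
  rw [← hquad, sq, ← mul_assoc]
  exact abs_dotProduct_mulVec_le_l1 hentry u u

lemma restricted_eigenvalue (hj : j ∈ Finset.Icc 1 S.b) (u : Fin S.p → ℝ) :
    c.κ * S.N j * ∑ k, u k ^ 2 - c.noise * √(S.N j * (Real.log S.p + j)) * l1 u ^ 2 ≤
      c.K₂ * S.energy ω j u := by
  have hdev := neg_le_of_abs_le (h.sum_deriv_mul_sq_sub_le hj u)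
  have hderiv : ∑ i ∈ Finset.range (S.N j),
      deriv G.g (S.x i ω ⬝ᵥ S.β₀) * (S.x i ω ⬝ᵥ u) ^ 2 ≤ c.K₂ * S.energy ω j u := by
    rw [energy, Finset.mul_sum]
    refine Finset.sum_le_sum fun i hi => mul_le_mul_of_nonneg_right ?_ (sq_nonneg _)
    exact h.deriv_le i ((Finset.mem_range.1 hi).trans_le (S.N_mono (Finset.mem_Icc.1 hj).2)) _
      (by simpa [l1] using c.δ_pos.le)
  have hcurv := mul_le_mul_of_nonneg_left (h.curvature u) (Nat.cast_nonneg (α := ℝ) (S.N j))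
  linarith

lemma scaled_restricted_eigenvalue (hj : j ∈ Finset.Icc 1 S.b) (u : Fin S.p → ℝ) :
    c.κ / (4 * c.K₂ * c.K₃) * S.N j * ∑ k, u k ^ 2 -
        c.noise / (4 * c.K₂ * c.K₃) * √(S.N j * (Real.log S.p + j)) * l1 u ^ 2 ≤
      1 / (4 * c.K₃) * S.energy ω j u := by
  have hK₂ := c.K₂_pos
  have hK₃ := c.K₃_pos
  have hscaled := mul_le_mul_of_nonneg_left (h.restricted_eigenvalue hj u)
    (by positivity : 0 ≤ 1 / (4 * c.K₂ * c.K₃))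
  calc _ = 1 / (4 * c.K₂ * c.K₃) * (c.κ * S.N j * ∑ k, u k ^ 2 -
        c.noise * √(S.N j * (Real.log S.p + j)) * l1 u ^ 2) := by ring
    _ ≤ 1 / (4 * c.K₂ * c.K₃) * (c.K₂ * S.energy ω j u) := hscaled
    _ = 1 / (4 * c.K₃) * S.energy ω j u := by field_simp

/-- The estimation error `v` of the sparse vector `β₀` enters the loss through the direction `u`
of `ℝᵖ`: `u = v` for the online lasso, and `u` has `r`-th entry `0` for the projection. -/
lemma error_bounds_of_basic {ι : Type*} [Fintype ι] {β₀ v : ι → ℝ} {u : Fin S.p → ℝ} {D E : ℝ}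
    (hs : S.SampleSize c s₀ sr) (hj : j ∈ Finset.Icc 1 S.b) (hone : 1 ≤ s)
    (hsle : s ≤ s₀ * sr) (hcard : (Nat.card {k // β₀ k ≠ 0} : ℝ) ≤ s)
    (hι : Fintype.card ι ≤ S.p) (hl1 : l1 u = l1 v) (hsq : ∑ k, u k ^ 2 = ∑ k, v k ^ 2)
    (hD : 0 ≤ D) (hDsize : c.noise * D / c.C ^ 2 ≤ c.size) (hE : 0 ≤ E)
    (hED : E ≤ D * S.rate c s₀ j)
    (hbasic : 1 / (4 * c.K₃) * S.energy ω j u +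
        2 * c.C * √(S.N j * Real.log S.p) * (l1 (β₀ + v) - l1 β₀) ≤
      2 * c.noise * √(S.N j * (Real.log S.p + j)) * l1 v + E) :
    1 / (4 * c.K₃) * S.energy ω j u ≤ 2 * E + 3 * (c.oracle * S.rate c s j) ∧
      2 * c.C * √(S.N j * Real.log S.p) * l1 v ≤ 3 * E + 4 * (c.oracle * S.rate c s j) := by
  have hK₂ := c.K₂_pos
  have hK₃ := c.K₃_pos
  have hκ := c.κ_pos
  have hC := c.C_pos
  have hnoise := c.noise_pos
  have hlog := hs.log_pos
  have hcurv := h.scaled_restricted_eigenvalue hj u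
  rw [hl1, hsq] at hcurv
  refine lasso_step hnoise.le c.three_mul_noise_le hC (hs.N_pos hj) hs.one_le_log
    (by positivity) (by positivity) hone (c.exp_two_mul_le_growth_pow j) hcard ?_ hE ?_ hbasic
    hcurv ?_ ?_
  · rw [Real.exp_log (Nat.cast_pos.2 hs.p_pos)]
    exact_mod_cast hι
  · exact mul_nonneg (by positivity) (energy_nonneg u)
  · have hN := hs.mul_sqrt_le hj (by positivity) c.thresholds_le_size.2.1
      (zero_le_one.trans hone) hsle
    calc _ = c.κ / (4 * c.K₂ * c.K₃) * (288 * c.noise / c.κ * (c.growth ^ j * s) *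
          √(S.N j * (Real.log S.p + j))) := by field_simp
      _ ≤ c.κ / (4 * c.K₂ * c.K₃) * S.N j := by gcongr
  · have hN := hs.mul_sqrt_le hj (by positivity) hDsize hs.s₀_pos.le hs.s₀_le_mul
    calc 8 * (c.noise / (4 * c.K₂ * c.K₃) * √(S.N j * (Real.log S.p + j))) * E
        ≤ 8 * (c.noise / (4 * c.K₂ * c.K₃) * √(S.N j * (Real.log S.p + j))) *
          (D * S.rate c s₀ j) := by gcongr
      _ = 2 / (c.K₂ * c.K₃) * (c.C ^ 2 * Real.log S.p *
          (c.noise * D / c.C ^ 2 * (c.growth ^ j * s₀) * √(S.N j * (Real.log S.p + j)))) := by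
          unfold rate; field_simp; ring
      _ ≤ 2 * (c.C ^ 2 * Real.log S.p * S.N j) := by
          gcongr
          · have : 0 ≤ c.noise * D / c.C ^ 2 := by positivity
            have := c.growth_pos
            have := hs.s₀_pos
            positivity
          · exact div_le_self two_pos.le c.one_le_K₂_mul_K₃
      _ ≤ 4 * (c.C ^ 2 * Real.log S.p * S.N j) := by gcongr; norm_num
      _ = 4 * c.C ^ 2 * (S.N j * Real.log S.p) := by ring

lemma abs_score_dotProduct_le (hj : j ∈ Finset.Icc 1 S.b) (v : Fin S.p → ℝ) :
    |∑ i ∈ S.batch j, (S.y i ω - G.g (S.x i ω ⬝ᵥ S.β₀)) * (S.x i ω ⬝ᵥ v)| ≤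
      c.noise * √(S.N j * (Real.log S.p + j)) * l1 v := by
  have hsum : ∑ i ∈ S.batch j, (S.y i ω - G.g (S.x i ω ⬝ᵥ S.β₀)) * (S.x i ω ⬝ᵥ v) =
      (∑ i ∈ S.batch j, (S.y i ω - G.g (S.x i ω ⬝ᵥ S.β₀)) • S.x i ω) ⬝ᵥ v := by
    simp only [sum_dotProduct, smul_dotProduct, smul_eq_mul]
  rw [hsum]
  refine abs_dotProduct_le_l1 fun k => ?_
  simpa [Finset.sum_apply] using h.score j hj k

lemma data_fit_sub_ge (hj : j ≤ S.b) {v : Fin S.p → ℝ} (hv : l1 v ≤ c.δ) :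
    1 / (4 * c.K₃) * ∑ i ∈ S.batch j, (S.x i ω ⬝ᵥ v) ^ 2 -
        ∑ i ∈ S.batch j, (S.y i ω - G.g (S.x i ω ⬝ᵥ S.β₀)) * (S.x i ω ⬝ᵥ v) ≤
      ∑ i ∈ S.batch j, G.d (S.y i ω) (G.g (S.x i ω ⬝ᵥ (S.β₀ + v))) -
        ∑ i ∈ S.batch j, G.d (S.y i ω) (G.g (S.x i ω ⬝ᵥ S.β₀)) := by
  have hK₃ := c.K₃_pos
  rw [Finset.mul_sum, ← Finset.sum_sub_distrib, ← Finset.sum_sub_distrib]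
  refine Finset.sum_le_sum fun i hi => ?_
  rw [G.d_sub_d, dotProduct_add]
  have hcumulant := G.le_cumulant_sub_sub (η := S.x i ω ⬝ᵥ S.β₀) (t := S.x i ω ⬝ᵥ v)
    (m := 1 / c.K₃) fun θ hθ => by
      rw [div_le_iff₀' hK₃]
      have := h.one_le_mul_deriv i (S.lt_N_of_mem_batch hi hj) (S.β₀ + θ • v)
        (l1_segment_sub_le hθ hv)
      rwa [dotProduct_add, dotProduct_smul, smul_eq_mul] at this
  have hhalf : 1 / (4 * c.K₃) * (S.x i ω ⬝ᵥ v) ^ 2 ≤ 1 / c.K₃ / 2 * (S.x i ω ⬝ᵥ v) ^ 2 := by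
    refine mul_le_mul_of_nonneg_right ?_ (sq_nonneg _)
    rw [div_div]
    exact one_div_le_one_div_of_le (by positivity) (by linarith)
  linarith

lemma history_sub_ge (hj : j ≤ S.b) (hβ : ∀ l ∈ Finset.Icc 1 j, l1 (S.βhat l ω - S.β₀) ≤ c.δ)
    (v : Fin S.p → ℝ) :
    1 / (4 * c.K₃) * S.energy ω j v - c.K₂ * S.energy ω j (S.βhat j ω - S.β₀) ≤
      1 / 2 * ((S.β₀ + v - S.βhat j ω) ⬝ᵥ (S.Jtilde G j ω *ᵥ (S.β₀ + v - S.βhat j ω))) -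
      1 / 2 * ((S.β₀ - S.βhat j ω) ⬝ᵥ (S.Jtilde G j ω *ᵥ (S.β₀ - S.βhat j ω))) := by
  have hK₃ := c.K₃_pos
  rw [dotProduct_Jtilde_mulVec, dotProduct_Jtilde_mulVec, ← sum_batches_sq_eq_energy,
    ← sum_batches_sq_eq_energy]
  simp only [Finset.mul_sum, ← Finset.sum_sub_distrib]
  refine Finset.sum_le_sum fun l hl => Finset.sum_le_sum fun i hi => ?_
  have hi' := S.lt_N_of_mem_batch hi ((Finset.mem_Icc.1 hl).2.trans hj)
  have hle := h.deriv_le i hi' _ (hβ l hl)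
  have hge := h.one_le_mul_deriv i hi' _ (hβ l hl)
  simp only [dotProduct_add, dotProduct_sub]
  set w := deriv G.g (S.x i ω ⬝ᵥ S.βhat l ω)
  set a := S.x i ω ⬝ᵥ v
  set e := S.x i ω ⬝ᵥ S.βhat j ω - S.x i ω ⬝ᵥ S.β₀ with he
  have hw : 1 / (4 * c.K₃) ≤ w / 4 := by
    rw [div_le_div_iff₀ (by positivity) (by norm_num)]
    linarith
  have hw₀ : 0 ≤ w := by linarith [(by positivity : 0 ≤ 1 / (4 * c.K₃))]
  have hβ₀ : S.x i ω ⬝ᵥ S.β₀ = S.x i ω ⬝ᵥ S.βhat j ω - e := by rw [he]; ring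
  calc 1 / (4 * c.K₃) * a ^ 2 - c.K₂ * e ^ 2 ≤ w / 4 * a ^ 2 - w * e ^ 2 := by gcongr
    _ ≤ w / 4 * a ^ 2 - w * e ^ 2 + w * (a / 2 - e) ^ 2 :=
        le_add_of_nonneg_right (by positivity)
    _ = _ := by rw [hβ₀]; ring

lemma lasso_basic (hN : 0 < S.N j) (hj : j ∈ Finset.Icc 1 S.b)
    (hprev : ∀ l ∈ Finset.Icc 1 (j - 1), l1 (S.βhat l ω - S.β₀) ≤ c.δ)
    {θ : ℝ} (hθ : θ ∈ Set.Icc (0 : ℝ) 1) (hδ : l1 (θ • (S.βhat j ω - S.β₀)) ≤ c.δ) :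
    1 / (4 * c.K₃) * S.energy ω j (θ • (S.βhat j ω - S.β₀)) +
        2 * c.C * √(S.N j * Real.log S.p) *
          (l1 (S.β₀ + θ • (S.βhat j ω - S.β₀)) - l1 S.β₀) ≤
      c.noise * √(S.N j * (Real.log S.p + j)) * l1 (θ • (S.βhat j ω - S.β₀)) +
        c.K₂ * S.energy ω (j - 1) (S.βhat (j - 1) ω - S.β₀) := by
  have hjb := (Finset.mem_Icc.1 hj).2
  have hmin := S.sub_add_penalty_le hN
    (S.lassoObjective_segment_le G c.C_pos.le hθ.1 hθ.2 (h.lasso j hj))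
  have hfit := h.data_fit_sub_ge hjb hδ
  have hhistory := h.history_sub_ge ((Nat.sub_le j 1).trans hjb) hprev
    (θ • (S.βhat j ω - S.β₀))
  have hscore := (le_abs_self _).trans
    (h.abs_score_dotProduct_le hj (θ • (S.βhat j ω - S.β₀)))
  rw [energy_eq_pred_add_batch, mul_add]
  linarith

end GoodOutcome

end Stream

namespace Stream

variable {Ω : Type*} {S : Stream Ω} {G : GLM} {c : Constants G}
  {Jpop : Matrix (Fin S.p) (Fin S.p) ℝ} {s₀ sr : ℝ} {ω : Ω} {j : ℕ}

/-- The error bounds for the online lasso after `j` batches. -/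
structure LassoBounds (S : Stream Ω) (c : Constants G) (s₀ : ℝ) (ω : Ω) (j : ℕ) : Prop where
  l1_le_δ : l1 (S.βhat j ω - S.β₀) ≤ c.δ
  energy_le : S.energy ω j (S.βhat j ω - S.β₀) ≤ c.pred * S.rate c s₀ j
  l1_le : 2 * c.C * √(S.N j * Real.log S.p) * l1 (S.βhat j ω - S.β₀) ≤ c.lasso * S.rate c s₀ j

lemma growth_mul_rate_pred (hj : j ≠ 0) (s : ℝ) :
    c.growth * S.rate c s (j - 1) = S.rate c s j := by
  unfold rate
  rw [← mul_pow_sub_one hj c.growth]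
  ring

lemma SampleSize.previous_energy_le (hs : S.SampleSize c s₀ sr) (hj : j ∈ Finset.Icc 1 S.b)
    (hprev : ∀ l ∈ Finset.Icc 1 (j - 1), S.LassoBounds c s₀ ω l) :
    16 * c.K₃ * (c.K₂ * S.energy ω (j - 1) (S.βhat (j - 1) ω - S.β₀)) ≤
      c.pred * S.rate c s₀ j := by
  have hgrowth := c.growth_pos
  rcases Nat.eq_zero_or_pos (j - 1) with hzero | hpos
  · have := mul_pos c.pred_pos (hs.rate_pos hs.s₀_pos j)
    simp [energy, hzero, N_zero, this.le]
  · calc 16 * c.K₃ * (c.K₂ * S.energy ω (j - 1) (S.βhat (j - 1) ω - S.β₀))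
        = c.growth * S.energy ω (j - 1) (S.βhat (j - 1) ω - S.β₀) := by
          unfold Constants.growth; ring
      _ ≤ c.growth * (c.pred * S.rate c s₀ (j - 1)) := by
          gcongr
          exact (hprev _ (Finset.mem_Icc.2 ⟨hpos, le_rfl⟩)).energy_le
      _ = c.pred * S.rate c s₀ j := by
          rw [← growth_mul_rate_pred (Nat.one_le_iff_ne_zero.1 (Finset.mem_Icc.1 hj).1)]
          ring

lemma SampleSize.lasso_mul_rate_lt (hs : S.SampleSize c s₀ sr) (hj : j ∈ Finset.Icc 1 S.b) :
    c.lasso * S.rate c s₀ j < 2 * c.C * √(S.N j * Real.log S.p) * c.δ := by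
  have hC := c.C_pos
  have hδ := c.δ_pos
  have hsqrt : 0 < √(S.N j * Real.log S.p) := Real.sqrt_pos.2 (mul_pos (hs.N_pos hj) hs.log_pos)
  have hle := hs.mul_rate_le_sqrt hj (div_nonneg c.lasso_pos.le (mul_pos hC hδ).le)
    c.thresholds_le_size.2.2.2.2.1 hs.s₀_pos.le hs.s₀_le_mul
  rw [div_mul_eq_mul_div, div_le_iff₀ (mul_pos hC hδ)] at hle
  nlinarith [mul_pos hsqrt (mul_pos hC hδ)]

namespace GoodOutcome

variable (h : S.GoodOutcome c Jpop ω) (hs : S.SampleSize c s₀ sr)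

include h hs

lemma lasso_segment_bounds (hj : j ∈ Finset.Icc 1 S.b)
    (hprev : ∀ l ∈ Finset.Icc 1 (j - 1), S.LassoBounds c s₀ ω l) {θ : ℝ}
    (hθ : θ ∈ Set.Icc (0 : ℝ) 1) (hδ : l1 (θ • (S.βhat j ω - S.β₀)) ≤ c.δ) :
    S.energy ω j (θ • (S.βhat j ω - S.β₀)) ≤ c.pred * S.rate c s₀ j ∧
      2 * c.C * √(S.N j * Real.log S.p) * l1 (θ • (S.βhat j ω - S.β₀)) ≤
        c.lasso * S.rate c s₀ j := by
  have hK₂ := c.K₂_pos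
  have hK₃ := c.K₃_pos
  have hnoise := c.noise_pos
  have hpred := c.pred_pos
  set v := θ • (S.βhat j ω - S.β₀)
  set E := c.K₂ * S.energy ω (j - 1) (S.βhat (j - 1) ω - S.β₀)
  have hE : 0 ≤ E := mul_nonneg hK₂.le (energy_nonneg _)
  have hprevious : 16 * c.K₃ * E ≤ c.pred * S.rate c s₀ j := hs.previous_energy_le hj hprev
  have hE₁ : 16 * E ≤ c.pred * S.rate c s₀ j := by nlinarith [c.one_le_K₃]
  have hbasic := h.lasso_basic (by exact_mod_cast hs.N_pos hj) hj
    (fun l hl => (hprev l hl).l1_le_δ) hθ hδ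
  have hdouble : 0 ≤ c.noise * √(S.N j * (Real.log S.p + j)) * l1 v :=
    mul_nonneg (by positivity) (l1_nonneg v)
  obtain ⟨henergy, hl1⟩ := h.error_bounds_of_basic hs hj hs.one_le_s₀ hs.s₀_le_mul
    hs.card_β₀_le (Fintype.card_fin _).le rfl rfl hpred.le c.thresholds_le_size.2.2.1 hE
    (by linarith) (by linarith : _ ≤ 2 * c.noise * √(S.N j * (Real.log S.p + j)) * l1 v + E)
  refine ⟨?_, ?_⟩
  · rw [div_mul_eq_mul_div, div_le_iff₀ (by positivity), one_mul] at henergy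
    have : c.pred * S.rate c s₀ j = 24 * c.K₃ * (c.oracle * S.rate c s₀ j) := by
      unfold Constants.pred; ring
    linarith
  · unfold Constants.lasso
    linarith

lemma l1_lasso_error_le_δ (hj : j ∈ Finset.Icc 1 S.b)
    (hprev : ∀ l ∈ Finset.Icc 1 (j - 1), S.LassoBounds c s₀ ω l) :
    l1 (S.βhat j ω - S.β₀) ≤ c.δ := by
  by_contra! hfar
  have hδ := c.δ_pos
  set v := S.βhat j ω - S.β₀
  have hpos : 0 < l1 v := hδ.trans hfar
  have hl1 : l1 ((c.δ / l1 v) • v) = c.δ := by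
    rw [l1_smul, abs_of_pos (by positivity), div_mul_cancel₀ _ hpos.ne']
  have hbound := (h.lasso_segment_bounds hs hj hprev
    ⟨by positivity, (div_le_one hpos).2 hfar.le⟩ hl1.le).2
  rw [hl1] at hbound
  exact (hs.lasso_mul_rate_lt hj).not_ge hbound

lemma lassoBounds (hj : j ∈ Finset.Icc 1 S.b) : S.LassoBounds c s₀ ω j := by
  induction j using Nat.strong_induction_on with
  | _ j ih =>
    have hprev : ∀ l ∈ Finset.Icc 1 (j - 1), S.LassoBounds c s₀ ω l := fun l hl => by
      rw [Finset.mem_Icc] at hl hj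
      exact ih l (by omega) (Finset.mem_Icc.2 (by omega))
    have hδ := h.l1_lasso_error_le_δ hs hj hprev
    have hbounds := h.lasso_segment_bounds hs hj hprev (θ := 1) (by simp) (by rwa [one_smul])
    rw [one_smul] at hbounds
    exact ⟨hδ, hbounds.1, hbounds.2⟩

end GoodOutcome

/-- The squared prediction errors of the online lassos, each on its own batch, summed over the
first `j` batches. -/
def batchError (S : Stream Ω) (ω : Ω) (j : ℕ) : ℝ :=
  ∑ l ∈ Finset.Icc 1 j, ∑ i ∈ S.batch l, (S.x i ω ⬝ᵥ (S.βhat l ω - S.β₀)) ^ 2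

lemma batchError_nonneg : 0 ≤ S.batchError ω j :=
  Finset.sum_nonneg fun _ _ => Finset.sum_nonneg fun _ _ => sq_nonneg _

lemma SampleSize.batchError_le (hs : S.SampleSize c s₀ sr)
    (hβ : ∀ l ∈ Finset.Icc 1 j, S.LassoBounds c s₀ ω l) :
    S.batchError ω j ≤ 2 * (c.pred * S.rate c s₀ j) := by
  have hpred := c.pred_pos
  have hlog := hs.log_pos
  have hs₀ := hs.s₀_pos
  calc S.batchError ω j ≤ ∑ l ∈ Finset.Icc 1 j, c.pred * S.rate c s₀ l := by
        refine Finset.sum_le_sum fun l hl => le_trans ?_ (hβ l hl).energy_le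
        rw [energy_eq_pred_add_batch]
        exact le_add_of_nonneg_left (energy_nonneg _)
    _ = c.pred * (s₀ * Real.log S.p) * ∑ l ∈ Finset.Icc 1 j, c.growth ^ l := by
        rw [Finset.mul_sum]
        exact Finset.sum_congr rfl fun l _ => by unfold rate; ring
    _ ≤ c.pred * (s₀ * Real.log S.p) * (2 * c.growth ^ j) := by
        gcongr
        exact c.sum_growth_pow_le j
    _ = 2 * (c.pred * S.rate c s₀ j) := by unfold rate; ring

lemma perturbed_weight_mul_sq_sub_ge {w w₀ u e Δ K₃ B : ℝ} (hK₃ : 0 < K₃) (hw : 1 ≤ K₃ * w)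
    (hperturb : |w - w₀| * |u| ≤ B * |Δ|) :
    1 / (4 * K₃) * e ^ 2 + 2 * (w₀ * u * e) - 2 * K₃ * B ^ 2 * Δ ^ 2 ≤
      w * (u + e) * (u + e) - w * u * u := by
  have hcurv : 1 / K₃ * e ^ 2 ≤ w * e ^ 2 := by
    gcongr
    rwa [div_le_iff₀' hK₃]
  have hcross : -(B * |Δ| * |e|) ≤ (w - w₀) * u * e := by
    refine neg_le_of_abs_le ?_
    rw [abs_mul, abs_mul]
    gcongr
  have hyoung : 2 * (B * |Δ| * |e|) ≤ 1 / (2 * K₃) * e ^ 2 + 2 * K₃ * B ^ 2 * Δ ^ 2 := by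
    have hsq : 1 / (2 * K₃) * e ^ 2 + 2 * K₃ * B ^ 2 * Δ ^ 2 - 2 * (B * |Δ| * |e|) =
        1 / (2 * K₃) * (|e| - 2 * K₃ * B * |Δ|) ^ 2 := by
      rw [← sq_abs e, ← sq_abs Δ]
      field_simp
      ring
    have : 0 ≤ 1 / (2 * K₃) * (|e| - 2 * K₃ * B * |Δ|) ^ 2 := by positivity
    linarith
  have hquarters : 1 / K₃ * e ^ 2 =
      1 / (4 * K₃) * e ^ 2 + 1 / (2 * K₃) * e ^ 2 + 1 / (4 * K₃) * e ^ 2 := by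
    field_simp
    ring
  have : 0 ≤ 1 / (4 * K₃) * e ^ 2 := by positivity
  linarith

namespace GoodOutcome

variable (h : S.GoodOutcome c Jpop ω)

include h

lemma abs_dotProduct_extend_γ₀_le {i : ℕ} (hi : i < S.N S.b) :
    |S.x i ω ⬝ᵥ extend S.r (-1) S.γ₀| ≤ c.K + c.M := by
  rw [dotProduct_extend]
  refine (abs_add_le _ _).trans (add_le_add ?_ (h.bounded_projection i hi))
  simpa using h.bounded_x i hi S.r

lemma abs_resid_dotProduct_le (hj : j ∈ Finset.Icc 1 S.b) (v : {k // k ≠ S.r} → ℝ) :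
    |∑ i ∈ Finset.range (S.N j), deriv G.g (S.x i ω ⬝ᵥ S.β₀) *
      (S.x i ω ⬝ᵥ extend S.r (-1) S.γ₀) * (S.x i ω ⬝ᵥ extend S.r 0 v)| ≤
      c.noise * √(S.N j * (Real.log S.p + j)) * l1 v := by
  have hsum : ∑ i ∈ Finset.range (S.N j), deriv G.g (S.x i ω ⬝ᵥ S.β₀) *
      (S.x i ω ⬝ᵥ extend S.r (-1) S.γ₀) * (S.x i ω ⬝ᵥ extend S.r 0 v) =
      (fun k : {k // k ≠ S.r} => ∑ i ∈ Finset.range (S.N j), deriv G.g (S.x i ω ⬝ᵥ S.β₀) *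
        S.x i ω k.1 * (S.x i ω ⬝ᵥ extend S.r (-1) S.γ₀)) ⬝ᵥ v := by
    simp only [dotProduct_extend _ 0, zero_mul, zero_add, Finset.mul_sum]
    rw [Finset.sum_comm]
    refine Finset.sum_congr rfl fun k _ => ?_
    rw [Finset.sum_mul]
    exact Finset.sum_congr rfl fun i _ => by ring
  rw [hsum]
  exact abs_dotProduct_le_l1 fun k => h.resid j hj k.1 k.2

lemma projection_fit_sub_ge (hj : j ≤ S.b)
    (hβ : ∀ l ∈ Finset.Icc 1 j, l1 (S.βhat l ω - S.β₀) ≤ c.δ) (v : {k // k ≠ S.r} → ℝ) :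
    1 / (4 * c.K₃) * S.energy ω j (extend S.r 0 v) +
        2 * ∑ i ∈ Finset.range (S.N j), deriv G.g (S.x i ω ⬝ᵥ S.β₀) *
          (S.x i ω ⬝ᵥ extend S.r (-1) S.γ₀) * (S.x i ω ⬝ᵥ extend S.r 0 v) -
        2 * c.K₃ * (c.L * (c.K + c.M)) ^ 2 * S.batchError ω j ≤
      projQuad (S.Jtilde G j ω) S.r (S.γ₀ + v) - projQuad (S.Jtilde G j ω) S.r S.γ₀ := by
  have hext : extend S.r (-1) (S.γ₀ + v) = extend S.r (-1) S.γ₀ + extend S.r 0 v := by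
    rw [← extend_add, add_zero]
  rw [projQuad_eq_extend (S.Jtilde_isSymm G j ω), projQuad_eq_extend (S.Jtilde_isSymm G j ω),
    dotProduct_Jtilde_mulVec, dotProduct_Jtilde_mulVec, ← sum_batches_sq_eq_energy,
    ← S.sum_batches, batchError]
  simp only [Finset.mul_sum, ← Finset.sum_sub_distrib, ← Finset.sum_add_distrib]
  refine Finset.sum_le_sum fun l hl => Finset.sum_le_sum fun i hi => ?_
  have hib := S.lt_N_of_mem_batch hi ((Finset.mem_Icc.1 hl).2.trans hj)
  have hlipschitz := h.lipschitz i hib _ _ (hβ l hl) (by simpa [l1] using c.δ_pos.le :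
    l1 (S.β₀ - S.β₀) ≤ c.δ)
  rw [hext, dotProduct_add]
  refine perturbed_weight_mul_sq_sub_ge c.K₃_pos (h.one_le_mul_deriv i hib _ (hβ l hl)) ?_
  have hL := c.L_nonneg
  calc _ ≤ c.L * |S.x i ω ⬝ᵥ (S.βhat l ω - S.β₀)| * (c.K + c.M) := by
        rw [dotProduct_sub]
        gcongr
        exact h.abs_dotProduct_extend_γ₀_le hib
    _ = c.L * (c.K + c.M) * |S.x i ω ⬝ᵥ (S.βhat l ω - S.β₀)| := by ring

lemma proj_basic (hN : 0 < S.N j) (hj : j ∈ Finset.Icc 1 S.b)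
    (hβ : ∀ l ∈ Finset.Icc 1 j, l1 (S.βhat l ω - S.β₀) ≤ c.δ) :
    1 / (4 * c.K₃) * S.energy ω j (extend S.r 0 (S.γhat j ω - S.γ₀)) +
        2 * c.C * √(S.N j * Real.log S.p) * (l1 (S.γ₀ + (S.γhat j ω - S.γ₀)) - l1 S.γ₀) ≤
      2 * c.noise * √(S.N j * (Real.log S.p + j)) * l1 (S.γhat j ω - S.γ₀) +
        2 * c.K₃ * (c.L * (c.K + c.M)) ^ 2 * S.batchError ω j := by
  have hmin : S.projObjective G c.C j ω (S.γ₀ + (S.γhat j ω - S.γ₀)) ≤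
      S.projObjective G c.C j ω S.γ₀ := by
    rw [add_sub_cancel]
    exact h.proj j hj (Set.mem_univ _)
  have hpenalized := S.sub_add_penalty_le hN hmin
  have hfit := h.projection_fit_sub_ge (Finset.mem_Icc.1 hj).2 hβ (S.γhat j ω - S.γ₀)
  have hresid := neg_le_of_abs_le (h.abs_resid_dotProduct_le hj (S.γhat j ω - S.γ₀))
  linarith

lemma l1_proj_error_le (hs : S.SampleSize c s₀ sr) (hj : j ∈ Finset.Icc 1 S.b) :
    2 * c.C * √(S.N j * Real.log S.p) * l1 (S.γhat j ω - S.γ₀) ≤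
      c.proj * S.rate c (s₀ + sr) j := by
  have hK₃ := c.K₃_pos
  have hgrowth := c.growth_pos
  have hlog := hs.log_pos
  have hs₀ := hs.s₀_pos
  have hsr := hs.sr_pos
  have hplugIn := c.plugIn_nonneg
  have horacle := c.oracle_pos
  have hβ : ∀ l ∈ Finset.Icc 1 j, S.LassoBounds c s₀ ω l := fun l hl =>
    h.lassoBounds hs (Finset.Icc_subset_Icc le_rfl (Finset.mem_Icc.1 hj).2 hl)
  have hE : 2 * c.K₃ * (c.L * (c.K + c.M)) ^ 2 * S.batchError ω j ≤
      c.plugIn * S.rate c s₀ j :=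
    calc _ ≤ 2 * c.K₃ * (c.L * (c.K + c.M)) ^ 2 * (2 * (c.pred * S.rate c s₀ j)) := by
          gcongr
          exact hs.batchError_le hβ
      _ = c.plugIn * S.rate c s₀ j := by unfold Constants.plugIn; ring
  have hdim : Fintype.card {k // k ≠ S.r} ≤ S.p :=
    (Fintype.card_subtype_le _).trans_eq (Fintype.card_fin _)
  have hbound := (h.error_bounds_of_basic hs hj hs.one_le_sr hs.sr_le_mul hs.card_γ₀_le hdim
    (u := extend S.r 0 (S.γhat j ω - S.γ₀)) (by simp [l1_extend]) (by simp [sum_sq_extend])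
    hplugIn c.thresholds_le_size.2.2.2.1 (mul_nonneg (by positivity) batchError_nonneg) hE
    (h.proj_basic (by exact_mod_cast hs.N_pos hj) hj fun l hl => (hβ l hl).l1_le_δ)).2
  calc _ ≤ 3 * (c.plugIn * S.rate c s₀ j) + 4 * (c.oracle * S.rate c sr j) := by linarith
    _ ≤ 3 * (c.plugIn * S.rate c (s₀ + sr) j) + 4 * (c.oracle * S.rate c (s₀ + sr) j) := by
        unfold rate
        gcongr <;> linarith
    _ = c.proj * S.rate c (s₀ + sr) j := by unfold Constants.proj; ring

end GoodOutcome

end Stream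

/-! ### The low-dimensional projection -/

lemma nonneg_of_forall_nonneg_add_mul {x z : ℝ} (h : ∀ t : ℝ, 0 < t → t ≤ 1 → 0 ≤ x + t * z) :
    0 ≤ x := by
  have hlim : Tendsto (fun t : ℝ => x + t * z) (𝓝[>] 0) (𝓝 (x + 0 * z)) :=
    (tendsto_const_nhds.add (tendsto_id.mul_const z)).mono_left nhdsWithin_le_nhds
  rw [zero_mul, add_zero] at hlim
  refine ge_of_tendsto hlim ?_
  filter_upwards [Ioc_mem_nhdsGT one_pos] with t ht using h t ht.1 ht.2

lemma dotProduct_mulVec_comm {ι : Type*} [Fintype ι] {M : Matrix ι ι ℝ} (hM : M.IsSymm)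
    (u v : ι → ℝ) : u ⬝ᵥ (M *ᵥ v) = v ⬝ᵥ (M *ᵥ u) := by
  rw [Matrix.dotProduct_mulVec, ← Matrix.mulVec_transpose, hM.eq, dotProduct_comm]

lemma dotProduct_mulVec_add_smul {ι : Type*} [Fintype ι] {M : Matrix ι ι ℝ} (hM : M.IsSymm)
    (u v : ι → ℝ) (t : ℝ) :
    (u + t • v) ⬝ᵥ (M *ᵥ (u + t • v)) =
      u ⬝ᵥ (M *ᵥ u) + 2 * t * (v ⬝ᵥ (M *ᵥ u)) + t ^ 2 * (v ⬝ᵥ (M *ᵥ v)) := by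
  simp only [Matrix.mulVec_add, Matrix.mulVec_smul, add_dotProduct, dotProduct_add,
    smul_dotProduct, dotProduct_smul, smul_eq_mul, dotProduct_mulVec_comm hM u v]
  ring

section Extend

variable {p : ℕ} {r : Fin p}

lemma extend_zero_smul (t : ℝ) (γ : {k // k ≠ r} → ℝ) :
    extend r 0 (t • γ) = t • extend r 0 γ := by
  funext k
  by_cases h : k = r <;> simp [extend, h]

lemma extend_zero_sub (γ γ' : {k // k ≠ r} → ℝ) (c : ℝ) :
    extend r 0 (γ - γ') = extend r c γ - extend r c γ' := by
  funext k
  by_cases h : k = r <;> simp [extend, h]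

lemma single_add_extend_zero (v : Fin p → ℝ) :
    Pi.single r (v r) + extend r 0 (fun k => v k.1) = v := by
  funext k
  by_cases h : k = r
  · subst h; simp
  · simp [extend, h]

lemma l1_subtype_ne_le (v : Fin p → ℝ) : l1 (fun k : {k // k ≠ r} => v k.1) ≤ l1 v := by
  unfold l1
  rw [Fintype.sum_eq_add_sum_subtype_ne _ r]
  exact le_add_of_nonneg_left (abs_nonneg _)

end Extend

namespace Stream

section Decomposition

variable {Ω : Type*} (S : Stream Ω) (G : GLM) (ω : Ω)

lemma extend_dotProduct_Jtilde_mulVec_γtilde (v : Fin S.p → ℝ) :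
    extend S.r 0 (fun k => v k.1) ⬝ᵥ (S.Jtilde G S.b ω *ᵥ S.γtilde S.b ω) =
      S.γtilde S.b ω ⬝ᵥ (S.Jtilde G S.b ω *ᵥ v) + S.τhat G S.b ω * v S.r := by
  have hsplit := congrArg (· ⬝ᵥ (S.Jtilde G S.b ω *ᵥ S.γtilde S.b ω))
    (single_add_extend_zero (r := S.r) v)
  simp only [add_dotProduct, single_dotProduct, Jtilde_mulVec_γtilde_self] at hsplit
  rw [dotProduct_mulVec_comm (S.Jtilde_isSymm G S.b ω) (S.γtilde S.b ω)]
  linarith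

lemma dotProduct_Jtilde_mulVec_eq_sum_J (j : ℕ) (u v : Fin S.p → ℝ) :
    u ⬝ᵥ (S.Jtilde G j ω *ᵥ v) =
      ∑ l ∈ Finset.Icc 1 j, u ⬝ᵥ (S.J G l (S.βhat l ω) ω *ᵥ v) := by
  rw [Jtilde, Matrix.sum_mulVec, dotProduct_sum]

lemma batch_correction_eq (j : ℕ) (u v : Fin S.p → ℝ) :
    ∑ i ∈ S.batch j, S.zhat j i ω * (S.y i ω - G.g (S.x i ω ⬝ᵥ S.βhat j ω)) +
        S.γtilde j ω ⬝ᵥ (S.J G j (S.βhat j ω) ω *ᵥ (S.β₀ + v - S.βhat j ω)) =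
      ∑ i ∈ S.batch j, S.zhat j i ω * (S.y i ω - G.g (S.x i ω ⬝ᵥ S.β₀)) +
        (S.γtilde j ω - u) ⬝ᵥ (S.J G j (S.βhat j ω) ω *ᵥ v) +
        u ⬝ᵥ (S.J G j (S.βhat j ω) ω *ᵥ v) +
        ∑ i ∈ S.batch j, S.zhat j i ω *
          (G.g (S.x i ω ⬝ᵥ S.β₀) - G.g (S.x i ω ⬝ᵥ S.βhat j ω) +
            deriv G.g (S.x i ω ⬝ᵥ S.βhat j ω) * (S.x i ω ⬝ᵥ (S.βhat j ω - S.β₀))) := by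
  rw [sub_dotProduct, add_assoc (∑ i ∈ S.batch j, _), sub_add_cancel, dotProduct_J_mulVec,
    dotProduct_J_mulVec, ← Finset.sum_add_distrib, ← Finset.sum_add_distrib,
    ← Finset.sum_add_distrib]
  refine Finset.sum_congr rfl fun i _ => ?_
  simp only [zhat_eq, dotProduct_sub, dotProduct_add]
  ring

lemma τhat_mul_βon_sub (hτ : S.τhat G S.b ω ≠ 0) :
    S.τhat G S.b ω * (S.βon G ω - S.β₀ S.r) =
      ∑ j ∈ Finset.Icc 1 S.b, ∑ i ∈ S.batch j,
        S.zhat j i ω * (S.y i ω - G.g (S.x i ω ⬝ᵥ S.β₀)) +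
      (extend S.r 0 (fun k => (S.βhat S.b ω - S.β₀) k.1) ⬝ᵥ
          (S.Jtilde G S.b ω *ᵥ S.γtilde S.b ω) +
        ∑ j ∈ Finset.Icc 1 S.b, (S.γtilde j ω - S.γtilde S.b ω) ⬝ᵥ
          (S.J G j (S.βhat j ω) ω *ᵥ (S.βhat S.b ω - S.β₀)) +
        ∑ j ∈ Finset.Icc 1 S.b, ∑ i ∈ S.batch j, S.zhat j i ω *
          (G.g (S.x i ω ⬝ᵥ S.β₀) - G.g (S.x i ω ⬝ᵥ S.βhat j ω) +
            deriv G.g (S.x i ω ⬝ᵥ S.βhat j ω) * (S.x i ω ⬝ᵥ (S.βhat j ω - S.β₀)))) := by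
  have hcorrection := Finset.sum_congr (rfl : Finset.Icc 1 S.b = Finset.Icc 1 S.b) fun j _ =>
    S.batch_correction_eq G ω j (S.γtilde S.b ω) (S.βhat S.b ω - S.β₀)
  simp only [Finset.sum_add_distrib, add_sub_cancel] at hcorrection
  have hβon : S.τhat G S.b ω * (S.βon G ω - S.β₀ S.r) =
      S.τhat G S.b ω * (S.βhat S.b ω - S.β₀) S.r +
        (∑ j ∈ Finset.Icc 1 S.b, ∑ i ∈ S.batch j,
          S.zhat j i ω * (S.y i ω - G.g (S.x i ω ⬝ᵥ S.βhat j ω)) +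
        ∑ j ∈ Finset.Icc 1 S.b,
          S.γtilde j ω ⬝ᵥ (S.J G j (S.βhat j ω) ω *ᵥ (S.βhat S.b ω - S.βhat j ω))) := by
    rw [βon, Pi.sub_apply]
    field_simp
    ring
  rw [hβon, hcorrection, extend_dotProduct_Jtilde_mulVec_γtilde, dotProduct_Jtilde_mulVec_eq_sum_J]
  ring

end Decomposition

section Projection

variable {Ω : Type*} {S : Stream Ω} {G : GLM} {c : Constants G}
  {Jpop : Matrix (Fin S.p) (Fin S.p) ℝ} {s₀ sr : ℝ} {ω : Ω} {i j : ℕ}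

namespace GoodOutcome

variable (h : S.GoodOutcome c Jpop ω)

include h

lemma proj_stationarity (hj : j ∈ Finset.Icc 1 S.b) (hN : 0 < S.N j) {d : {k // k ≠ S.r} → ℝ}
    {m : ℝ}
    (hm : ∀ t : ℝ, 0 < t → t ≤ 1 → l1 (S.γhat j ω + t • d) ≤ l1 (S.γhat j ω) + t * m) :
    0 ≤ extend S.r 0 d ⬝ᵥ (S.Jtilde G j ω *ᵥ S.γtilde j ω) +
      c.C * √(S.N j * Real.log S.p) * m := by
  have hC := c.C_pos
  have hsym := S.Jtilde_isSymm G j ω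
  refine nonneg_of_mul_nonneg_right (nonneg_of_forall_nonneg_add_mul
    (z := extend S.r 0 d ⬝ᵥ (S.Jtilde G j ω *ᵥ extend S.r 0 d)) fun t ht ht1 => ?_) two_pos
  have hmin := S.sub_add_penalty_le hN (h.proj j hj (Set.mem_univ (S.γhat j ω + t • d)))
  have hext : extend S.r (-1) (S.γhat j ω + t • d) = S.γtilde j ω + t • extend S.r 0 d := by
    rw [γtilde_eq_extend, ← extend_zero_smul, ← extend_add, add_zero]
  rw [projQuad_eq_extend hsym, projQuad_eq_extend hsym, hext, ← S.γtilde_eq_extend,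
    dotProduct_mulVec_add_smul hsym] at hmin
  have hpenalty : 2 * c.C * √(S.N j * Real.log S.p) *
      (l1 (S.γhat j ω + t • d) - l1 (S.γhat j ω)) ≤
        2 * c.C * √(S.N j * Real.log S.p) * (t * m) := by
    gcongr
    linarith [hm t ht ht1]
  refine nonneg_of_mul_nonneg_right (a := t) ?_ ht
  linarith

lemma abs_extend_dotProduct_le (hj : j ∈ Finset.Icc 1 S.b) (hN : 0 < S.N j)
    (d : {k // k ≠ S.r} → ℝ) :
    |extend S.r 0 d ⬝ᵥ (S.Jtilde G j ω *ᵥ S.γtilde j ω)| ≤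
      c.C * √(S.N j * Real.log S.p) * l1 d := by
  have hgrowth (d : {k // k ≠ S.r} → ℝ) (t : ℝ) (ht : 0 < t) :
      l1 (S.γhat j ω + t • d) ≤ l1 (S.γhat j ω) + t * l1 d := by
    simpa only [l1_smul, abs_of_pos ht] using l1_add_le (S.γhat j ω) (t • d)
  have hpos := h.proj_stationarity hj hN fun t ht _ => hgrowth d t ht
  have hneg := h.proj_stationarity hj hN fun t ht _ => hgrowth (-d) t ht
  rw [← neg_one_smul ℝ d, extend_zero_smul, smul_dotProduct, neg_one_smul ℝ d, l1_neg,
    smul_eq_mul] at hneg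
  exact abs_le.2 ⟨by linarith, by linarith⟩

/-- First order condition in the direction `-γhat`, along which the penalty decreases at the full
rate `l1 γhat`. -/
lemma dotProduct_Jtilde_mulVec_γtilde_add_le_τhat (hj : j ∈ Finset.Icc 1 S.b) (hN : 0 < S.N j) :
    S.γtilde j ω ⬝ᵥ (S.Jtilde G j ω *ᵥ S.γtilde j ω) +
      c.C * √(S.N j * Real.log S.p) * l1 (S.γhat j ω) ≤ S.τhat G j ω := by
  have hstat := h.proj_stationarity hj hN (d := -S.γhat j ω) (m := -l1 (S.γhat j ω))
    fun t _ ht1 => by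
      rw [show S.γhat j ω + t • -S.γhat j ω = (1 - t) • S.γhat j ω by module, l1_smul,
        abs_of_nonneg (sub_nonneg.2 ht1)]
      linarith
  have hext : extend S.r 0 (-S.γhat j ω) = -(S.γtilde j ω) + -(Pi.single S.r (1 : ℝ)) := by
    funext k
    by_cases hk : k = S.r
    · subst hk; simp [γtilde]
    · simp [extend, γtilde, hk]
  rw [hext, add_dotProduct, neg_dotProduct, neg_dotProduct, single_one_dotProduct,
    Jtilde_mulVec_γtilde_self] at hstat
  linarith

lemma energy_div_le_dotProduct_Jtilde_mulVec (hj : j ≤ S.b)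
    (hβ : ∀ l ∈ Finset.Icc 1 j, l1 (S.βhat l ω - S.β₀) ≤ c.δ) (u : Fin S.p → ℝ) :
    1 / c.K₃ * S.energy ω j u ≤ u ⬝ᵥ (S.Jtilde G j ω *ᵥ u) := by
  have hK₃ := c.K₃_pos
  rw [dotProduct_Jtilde_mulVec, ← sum_batches_sq_eq_energy]
  simp only [Finset.mul_sum]
  refine Finset.sum_le_sum fun l hl => Finset.sum_le_sum fun i hi => ?_
  rw [mul_assoc, ← sq]
  gcongr
  rw [div_le_iff₀' hK₃]
  exact h.one_le_mul_deriv i (S.lt_N_of_mem_batch hi ((Finset.mem_Icc.1 hl).2.trans hj)) _ (hβ l hl)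

lemma energy_γtilde_pos (hs : S.SampleSize c s₀ sr) (hj : j ∈ Finset.Icc 1 S.b)
    (hγ : l1 (S.γhat j ω) = 0) : 0 < S.energy ω j (S.γtilde j ω) := by
  have hκ := c.κ_pos
  have hN := hs.N_pos hj
  have hgrowth : 1 ≤ c.growth ^ j := one_le_pow₀ c.one_le_growth
  have hre := h.restricted_eigenvalue hj (S.γtilde j ω)
  have hsq : 1 ≤ ∑ k, S.γtilde j ω k ^ 2 := by
    rw [γtilde_eq_extend, sum_sq_extend]
    have : 0 ≤ ∑ k, S.γhat j ω k ^ 2 := Finset.sum_nonneg fun _ _ => sq_nonneg _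
    linarith
  rw [γtilde_eq_extend, l1_extend, hγ, ← γtilde_eq_extend, abs_neg, abs_one, add_zero, one_pow,
    mul_one] at hre
  have hnoise : 288 * c.noise * √(S.N j * (Real.log S.p + j)) ≤ c.κ * S.N j := by
    have hsize := hs.mul_sqrt_le hj (div_nonneg (by linarith [c.noise_pos]) hκ.le)
      c.thresholds_le_size.2.1 hs.s₀_pos.le hs.s₀_le_mul
    have : 1 ≤ c.growth ^ j * s₀ := one_le_mul_of_one_le_of_one_le hgrowth hs.one_le_s₀
    have hfactor : 288 * c.noise / c.κ ≤ 288 * c.noise / c.κ * (c.growth ^ j * s₀) :=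
      le_mul_of_one_le_right (div_nonneg (by linarith [c.noise_pos]) hκ.le) this
    have := (mul_le_mul_of_nonneg_right hfactor (Real.sqrt_nonneg _)).trans hsize
    rwa [div_mul_eq_mul_div, div_le_iff₀' hκ] at this
  have hnoise_nonneg : 0 ≤ c.noise * √(S.N j * (Real.log S.p + j)) :=
    mul_nonneg c.noise_pos.le (Real.sqrt_nonneg _)
  refine pos_of_mul_pos_right (lt_of_lt_of_le ?_ hre) c.K₂_pos.le
  nlinarith [mul_pos hκ hN]

lemma τhat_pos (hs : S.SampleSize c s₀ sr) (hj : j ∈ Finset.Icc 1 S.b) : 0 < S.τhat G j ω := by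
  have hjb := (Finset.mem_Icc.1 hj).2
  have hN := hs.N_pos hj
  have hτ := h.dotProduct_Jtilde_mulVec_γtilde_add_le_τhat hj (Nat.cast_pos.1 hN)
  have henergy := h.energy_div_le_dotProduct_Jtilde_mulVec hjb (fun l hl =>
    (h.lassoBounds hs (Finset.Icc_subset_Icc_right hjb hl)).l1_le_δ) (S.γtilde j ω)
  have hpenalty : 0 < c.C * √(S.N j * Real.log S.p) :=
    mul_pos c.C_pos (Real.sqrt_pos.2 (mul_pos hN hs.log_pos))
  have hK₃ : 0 < 1 / c.K₃ := one_div_pos.2 c.K₃_pos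
  rcases (l1_nonneg (S.γhat j ω)).eq_or_lt' with hzero | hpos
  · have := mul_pos hK₃ (h.energy_γtilde_pos hs hj hzero)
    rw [hzero] at hτ
    linarith
  · have := mul_nonneg hK₃.le (energy_nonneg (S := S) (ω := ω) (j := j) (S.γtilde j ω))
    have := mul_pos hpenalty hpos
    linarith

end GoodOutcome

end Projection

end Stream

/-! ### The expansion of the debiased estimator -/

/-- The constant in the bound on the remainder of the expansion of the debiased estimator. -/
def Constants.remainder {G : GLM} (c : Constants G) : ℝ :=
  c.lasso + c.K₂ * c.K ^ 2 * (c.proj * c.lasso / c.C ^ 2) +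
    c.L * (c.K + c.M + c.K * (c.proj / c.C)) * c.pred

namespace Stream

variable {Ω : Type*} {S : Stream Ω} {G : GLM} {c : Constants G}
  {Jpop : Matrix (Fin S.p) (Fin S.p) ℝ} {s₀ sr : ℝ} {ω : Ω} {i j : ℕ}

/-- The rate of the contribution of one batch to the remainder of the expansion of the debiased
estimator. -/
def remainderRate (S : Stream Ω) (c : Constants G) (s₀ sr : ℝ) : ℝ :=
  (c.growth ^ S.b) ^ 2 * ((s₀ + sr) * s₀ * Real.log S.p)

namespace SampleSize

variable (hs : S.SampleSize c s₀ sr)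

include hs

lemma rate_mono {s : ℝ} (hpos : 0 < s) : Monotone (S.rate c s) := fun l m hlm => by
  have := hs.log_pos
  have := c.one_le_growth
  unfold rate
  gcongr

lemma rate_le_remainderRate (hj : j ≤ S.b) : S.rate c s₀ j ≤ S.remainderRate c s₀ sr := by
  have hlog := hs.log_pos
  have hs₀ := hs.s₀_pos
  have hgrowth : 1 ≤ c.growth ^ S.b := one_le_pow₀ c.one_le_growth
  refine (hs.rate_mono hs₀ hj).trans ?_
  unfold rate remainderRate
  rw [mul_assoc, mul_assoc (s₀ + sr)]
  exact mul_le_mul (le_self_pow₀ hgrowth two_ne_zero)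
    (le_mul_of_one_le_left (by positivity) (by linarith [hs.one_le_s₀, hs.sr_pos]))
    (by positivity) (by positivity)

lemma remainderRate_pos : 0 < S.remainderRate c s₀ sr :=
  (hs.rate_pos hs.s₀_pos 0).trans_le (hs.rate_le_remainderRate (Nat.zero_le _))

end SampleSize

namespace GoodOutcome

variable (h : S.GoodOutcome c Jpop ω)

include h

lemma abs_g_expansion_le (hi : i < S.N S.b) (hβ : l1 (S.βhat j ω - S.β₀) ≤ c.δ) :
    |G.g (S.x i ω ⬝ᵥ S.β₀) - G.g (S.x i ω ⬝ᵥ S.βhat j ω) +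
      deriv G.g (S.x i ω ⬝ᵥ S.βhat j ω) * (S.x i ω ⬝ᵥ (S.βhat j ω - S.β₀))| ≤
      c.L * (S.x i ω ⬝ᵥ (S.βhat j ω - S.β₀)) ^ 2 := by
  rw [dotProduct_sub]
  refine (abs_sub_add_deriv_mul_le G.differentiable_g
    (B := c.L * |S.x i ω ⬝ᵥ S.βhat j ω - S.x i ω ⬝ᵥ S.β₀|) fun θ hθ => ?_).trans_eq ?_
  · have hlip := h.lipschitz i hi (S.β₀ + θ • (S.βhat j ω - S.β₀)) (S.βhat j ω)
      (l1_segment_sub_le hθ hβ) hβ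
    simp only [dotProduct_add, dotProduct_smul, dotProduct_sub, smul_eq_mul] at hlip
    refine hlip.trans (mul_le_mul_of_nonneg_left ?_ c.L_nonneg)
    rw [show S.x i ω ⬝ᵥ S.β₀ + θ * (S.x i ω ⬝ᵥ S.βhat j ω - S.x i ω ⬝ᵥ S.β₀) -
      S.x i ω ⬝ᵥ S.βhat j ω = -((1 - θ) * (S.x i ω ⬝ᵥ S.βhat j ω - S.x i ω ⬝ᵥ S.β₀)) by ring,
      abs_neg, abs_mul, abs_of_nonneg (by linarith [hθ.2])]
    exact mul_le_of_le_one_left (abs_nonneg _) (by linarith [hθ.1])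
  · rw [mul_assoc, abs_mul_abs_self, sq]

lemma abs_dotProduct_J_mulVec_le (hj : j ≤ S.b) (hβ : l1 (S.βhat j ω - S.β₀) ≤ c.δ)
    (u v : Fin S.p → ℝ) :
    |u ⬝ᵥ (S.J G j (S.βhat j ω) ω *ᵥ v)| ≤ c.K₂ * c.K ^ 2 * (S.N j * (l1 u * l1 v)) := by
  have hK := c.K_nonneg
  have hK₂ := c.K₂_pos
  have hu := l1_nonneg u
  have hv := l1_nonneg v
  have hterm : ∀ i ∈ S.batch j, |deriv G.g (S.x i ω ⬝ᵥ S.βhat j ω) * (S.x i ω ⬝ᵥ u) *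
      (S.x i ω ⬝ᵥ v)| ≤ c.K₂ * (c.K * l1 u) * (c.K * l1 v) := fun i hi => by
    have hib := S.lt_N_of_mem_batch hi hj
    rw [abs_mul, abs_mul, abs_of_nonneg (G.deriv_g_nonneg _)]
    gcongr
    · exact h.deriv_le i hib _ hβ
    · exact abs_dotProduct_le_l1 (h.bounded_x i hib)
    · exact abs_dotProduct_le_l1 (h.bounded_x i hib)
  have hcard : ((S.batch j).card : ℝ) ≤ S.N j := by
    rw [batch, Nat.card_Ico]
    exact_mod_cast Nat.sub_le _ _
  rw [dotProduct_J_mulVec]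
  calc |∑ i ∈ S.batch j, deriv G.g (S.x i ω ⬝ᵥ S.βhat j ω) * (S.x i ω ⬝ᵥ u) * (S.x i ω ⬝ᵥ v)|
      ≤ (S.batch j).card * (c.K₂ * (c.K * l1 u) * (c.K * l1 v)) := by
        refine (Finset.abs_sum_le_sum_abs _ _).trans ((Finset.sum_le_sum hterm).trans_eq ?_)
        rw [Finset.sum_const, nsmul_eq_mul]
    _ ≤ S.N j * (c.K₂ * (c.K * l1 u) * (c.K * l1 v)) := by gcongr
    _ = c.K₂ * c.K ^ 2 * (S.N j * (l1 u * l1 v)) := by ring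

lemma abs_zhat_le (hi : i < S.N S.b) :
    |S.zhat j i ω| ≤ c.K + c.M + c.K * l1 (S.γhat j ω - S.γ₀) := by
  have hsplit : S.γtilde j ω = extend S.r (-1) S.γ₀ + extend S.r 0 (S.γhat j ω - S.γ₀) := by
    rw [← extend_add, add_zero, add_sub_cancel, γtilde_eq_extend]
  rw [zhat_eq, abs_neg, hsplit, dotProduct_add]
  refine (abs_add_le _ _).trans (add_le_add (h.abs_dotProduct_extend_γ₀_le hi) ?_)
  refine (abs_dotProduct_le_l1 (h.bounded_x i hi)).trans_eq ?_
  rw [l1_extend, abs_zero, zero_add]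

variable (hs : S.SampleSize c s₀ sr)

include hs

lemma sqrt_mul_l1_proj_error_le (hj : j ∈ Finset.Icc 1 S.b) :
    √(S.N j * Real.log S.p) * l1 (S.γhat j ω - S.γ₀) ≤
      c.proj / (2 * c.C) * S.rate c (s₀ + sr) S.b := by
  have hC := c.C_pos
  have hproj := h.l1_proj_error_le hs hj
  have hmono : c.proj * S.rate c (s₀ + sr) j ≤ c.proj * S.rate c (s₀ + sr) S.b :=
    mul_le_mul_of_nonneg_left (hs.rate_mono (add_pos hs.s₀_pos hs.sr_pos) (Finset.mem_Icc.1 hj).2)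
      c.proj_nonneg
  rw [div_mul_eq_mul_div, le_div_iff₀ (by positivity)]
  linarith

lemma sqrt_mul_l1_lasso_error_le (hb : S.b ∈ Finset.Icc 1 S.b) :
    √(S.N S.b * Real.log S.p) * l1 (S.βhat S.b ω - S.β₀) ≤
      c.lasso / (2 * c.C) * S.rate c s₀ S.b := by
  have hC := c.C_pos
  have hlasso := (h.lassoBounds hs hb).l1_le
  rw [div_mul_eq_mul_div, le_div_iff₀ (by positivity)]
  linarith

lemma l1_proj_error_le_div (hj : j ∈ Finset.Icc 1 S.b) :
    l1 (S.γhat j ω - S.γ₀) ≤ c.proj / c.C := by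
  have hgrowth := c.growth_pos
  have hlog := hs.log_pos
  have hsqrt : 0 < √(S.N j * Real.log S.p) := Real.sqrt_pos.2 (mul_pos (hs.N_pos hj) hlog)
  have hrate : S.rate c (s₀ + sr) j ≤ 2 * √(S.N j * Real.log S.p) := by
    have hsize := hs.mul_rate_le_sqrt hj zero_le_one c.thresholds_le_size.1
      (mul_pos hs.s₀_pos hs.sr_pos).le le_rfl
    calc S.rate c (s₀ + sr) j ≤ S.rate c (2 * (s₀ * sr)) j := by
          unfold rate
          gcongr
          linarith [hs.s₀_le_mul, hs.sr_le_mul]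
      _ = 2 * (1 * S.rate c (s₀ * sr) j) := by unfold rate; ring
      _ ≤ 2 * √(S.N j * Real.log S.p) := by gcongr
  have hproj := (h.l1_proj_error_le hs hj).trans (mul_le_mul_of_nonneg_left hrate c.proj_nonneg)
  rw [le_div_iff₀ c.C_pos]
  exact le_of_mul_le_mul_left (by linarith) (mul_pos two_pos hsqrt)

lemma abs_stationarity_remainder_le (hb : S.b ∈ Finset.Icc 1 S.b) :
    |extend S.r 0 (fun k => (S.βhat S.b ω - S.β₀) k.1) ⬝ᵥ
      (S.Jtilde G S.b ω *ᵥ S.γtilde S.b ω)| ≤ c.lasso * (S.b * S.remainderRate c s₀ sr) := by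
  have hC := c.C_pos
  have hlasso := c.lasso_pos
  have hb₁ : (1 : ℝ) ≤ S.b := by exact_mod_cast (Finset.mem_Icc.1 hb).1
  refine (h.abs_extend_dotProduct_le hb (Nat.cast_pos.1 (hs.N_pos hb)) _).trans ?_
  calc c.C * √(S.N S.b * Real.log S.p) * l1 (fun k : {k // k ≠ S.r} => (S.βhat S.b ω - S.β₀) k.1)
      ≤ c.C * (√(S.N S.b * Real.log S.p) * l1 (S.βhat S.b ω - S.β₀)) := by
        rw [mul_assoc]
        gcongr
        exact l1_subtype_ne_le _
    _ ≤ c.C * (c.lasso / (2 * c.C) * S.rate c s₀ S.b) := by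
        exact mul_le_mul_of_nonneg_left (h.sqrt_mul_l1_lasso_error_le hs hb) hC.le
    _ = c.lasso / 2 * S.rate c s₀ S.b := by field_simp
    _ ≤ c.lasso * (S.b * S.remainderRate c s₀ sr) := by
        have hrate := hs.rate_le_remainderRate le_rfl
        have hnonneg := hs.remainderRate_pos
        gcongr
        · exact (hs.rate_pos hs.s₀_pos _).le
        · linarith
        · exact hrate.trans (le_mul_of_one_le_left hnonneg.le hb₁)

lemma sqrt_mul_l1_γtilde_sub_le (hj : j ∈ Finset.Icc 1 S.b) :
    √(S.N j * Real.log S.p) * l1 (S.γtilde j ω - S.γtilde S.b ω) ≤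
      c.proj / c.C * S.rate c (s₀ + sr) S.b := by
  have hC := c.C_pos
  have hlog := hs.log_pos
  have hjb := Finset.mem_Icc.1 hj
  have hmono : √(S.N j * Real.log S.p) ≤ √(S.N S.b * Real.log S.p) := by
    gcongr
    exact S.N_mono hjb.2
  have hsub : l1 (S.γtilde j ω - S.γtilde S.b ω) ≤
      l1 (S.γhat j ω - S.γ₀) + l1 (S.γhat S.b ω - S.γ₀) := by
    rw [γtilde_eq_extend, γtilde_eq_extend, ← extend_zero_sub, l1_extend, abs_zero, zero_add,
      ← sub_sub_sub_cancel_right _ _ S.γ₀]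
    exact l1_sub_le _ _
  calc √(S.N j * Real.log S.p) * l1 (S.γtilde j ω - S.γtilde S.b ω)
      ≤ √(S.N j * Real.log S.p) * l1 (S.γhat j ω - S.γ₀) +
          √(S.N S.b * Real.log S.p) * l1 (S.γhat S.b ω - S.γ₀) := by
        refine (mul_le_mul_of_nonneg_left hsub (Real.sqrt_nonneg _)).trans ?_
        rw [mul_add]
        have := l1_nonneg (S.γhat S.b ω - S.γ₀)
        gcongr
    _ ≤ c.proj / (2 * c.C) * S.rate c (s₀ + sr) S.b +
          c.proj / (2 * c.C) * S.rate c (s₀ + sr) S.b :=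
        add_le_add (h.sqrt_mul_l1_proj_error_le hs hj)
          (h.sqrt_mul_l1_proj_error_le hs (Finset.mem_Icc.2 ⟨hjb.1.trans hjb.2, le_rfl⟩))
    _ = c.proj / c.C * S.rate c (s₀ + sr) S.b := by field_simp; ring

lemma N_mul_l1_mul_l1_le (hj : j ∈ Finset.Icc 1 S.b) :
    S.N j * (l1 (S.γtilde j ω - S.γtilde S.b ω) * l1 (S.βhat S.b ω - S.β₀)) ≤
      c.proj * c.lasso / c.C ^ 2 * S.remainderRate c s₀ sr := by
  have hC := c.C_pos
  have hproj := c.proj_nonneg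
  have hlasso := c.lasso_pos
  have hlog := hs.log_pos
  have hjb := Finset.mem_Icc.1 hj
  have hsqrt := Real.mul_self_sqrt (mul_nonneg (Nat.cast_nonneg (α := ℝ) (S.N j)) hlog.le)
  have hlassoError : √(S.N j * Real.log S.p) * l1 (S.βhat S.b ω - S.β₀) ≤
      c.lasso / (2 * c.C) * S.rate c s₀ S.b := by
    refine le_trans ?_
      (h.sqrt_mul_l1_lasso_error_le hs (Finset.mem_Icc.2 ⟨hjb.1.trans hjb.2, le_rfl⟩))
    have := l1_nonneg (S.βhat S.b ω - S.β₀)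
    gcongr
    exact S.N_mono hjb.2
  have hrates : 0 ≤ c.proj / c.C * S.rate c (s₀ + sr) S.b :=
    mul_nonneg (by positivity) (hs.rate_pos (add_pos hs.s₀_pos hs.sr_pos) _).le
  refine le_of_mul_le_mul_right ?_ hlog
  calc S.N j * (l1 (S.γtilde j ω - S.γtilde S.b ω) * l1 (S.βhat S.b ω - S.β₀)) * Real.log S.p
      = (√(S.N j * Real.log S.p) * l1 (S.γtilde j ω - S.γtilde S.b ω)) *
          (√(S.N j * Real.log S.p) * l1 (S.βhat S.b ω - S.β₀)) := by
        linear_combination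
          -(l1 (S.γtilde j ω - S.γtilde S.b ω) * l1 (S.βhat S.b ω - S.β₀)) * hsqrt
    _ ≤ (c.proj / c.C * S.rate c (s₀ + sr) S.b) * (c.lasso / (2 * c.C) * S.rate c s₀ S.b) :=
        mul_le_mul (h.sqrt_mul_l1_γtilde_sub_le hs hj) hlassoError
          (mul_nonneg (Real.sqrt_nonneg _) (l1_nonneg _)) hrates
    _ = c.proj * c.lasso / c.C ^ 2 * S.remainderRate c s₀ sr * Real.log S.p / 2 := by
        unfold rate remainderRate
        field_simp
    _ ≤ c.proj * c.lasso / c.C ^ 2 * S.remainderRate c s₀ sr * Real.log S.p := by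
        have := hs.remainderRate_pos
        exact half_le_self (by positivity)

lemma abs_projection_drift_le (hj : j ∈ Finset.Icc 1 S.b) :
    |(S.γtilde j ω - S.γtilde S.b ω) ⬝ᵥ
      (S.J G j (S.βhat j ω) ω *ᵥ (S.βhat S.b ω - S.β₀))| ≤
      c.K₂ * c.K ^ 2 * (c.proj * c.lasso / c.C ^ 2) * S.remainderRate c s₀ sr := by
  refine (h.abs_dotProduct_J_mulVec_le (Finset.mem_Icc.1 hj).2 (h.lassoBounds hs hj).l1_le_δ
    _ _).trans ?_
  rw [mul_assoc (c.K₂ * c.K ^ 2)]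
  exact mul_le_mul_of_nonneg_left (h.N_mul_l1_mul_l1_le hs hj)
    (mul_nonneg c.K₂_pos.le (sq_nonneg _))

lemma abs_linearization_remainder_le (hj : j ∈ Finset.Icc 1 S.b) :
    |∑ i ∈ S.batch j, S.zhat j i ω *
      (G.g (S.x i ω ⬝ᵥ S.β₀) - G.g (S.x i ω ⬝ᵥ S.βhat j ω) +
        deriv G.g (S.x i ω ⬝ᵥ S.βhat j ω) * (S.x i ω ⬝ᵥ (S.βhat j ω - S.β₀)))| ≤
      c.L * (c.K + c.M + c.K * (c.proj / c.C)) * c.pred * S.remainderRate c s₀ sr := by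
  have hC := c.C_pos
  have hK := c.K_nonneg
  have hM := c.M_nonneg
  have hL := c.L_nonneg
  have hproj := c.proj_nonneg
  have hpred := c.pred_pos
  have hβ := h.lassoBounds hs hj
  refine (Finset.abs_sum_le_sum_abs _ _).trans ?_
  calc _ ≤ ∑ i ∈ S.batch j, (c.K + c.M + c.K * (c.proj / c.C)) *
          (c.L * (S.x i ω ⬝ᵥ (S.βhat j ω - S.β₀)) ^ 2) := by
        refine Finset.sum_le_sum fun i hi => ?_
        have hib := S.lt_N_of_mem_batch hi (Finset.mem_Icc.1 hj).2
        rw [abs_mul]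
        gcongr
        · refine (h.abs_zhat_le hib).trans ?_
          gcongr
          exact h.l1_proj_error_le_div hs hj
        · exact h.abs_g_expansion_le hib hβ.l1_le_δ
    _ = c.L * (c.K + c.M + c.K * (c.proj / c.C)) *
          ∑ i ∈ S.batch j, (S.x i ω ⬝ᵥ (S.βhat j ω - S.β₀)) ^ 2 := by
        rw [Finset.mul_sum]
        exact Finset.sum_congr rfl fun i _ => by ring
    _ ≤ c.L * (c.K + c.M + c.K * (c.proj / c.C)) * (c.pred * S.remainderRate c s₀ sr) := by
        gcongr
        have henergy := hβ.energy_le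
        have hpast := energy_nonneg (S := S) (ω := ω) (j := j - 1) (S.βhat j ω - S.β₀)
        have hrate : c.pred * S.rate c s₀ j ≤ c.pred * S.remainderRate c s₀ sr := by
          gcongr
          exact hs.rate_le_remainderRate (Finset.mem_Icc.1 hj).2
        rw [energy_eq_pred_add_batch] at henergy
        linarith
    _ = _ := by ring

theorem abs_expansion_remainder_le (hb : 1 ≤ S.b) :
    |S.τhat G S.b ω * (S.βon G ω - S.β₀ S.r) - ∑ j ∈ Finset.Icc 1 S.b, ∑ i ∈ S.batch j,
        S.zhat j i ω * (S.y i ω - G.g (S.x i ω ⬝ᵥ S.β₀))| ≤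
      c.remainder * (S.b * S.remainderRate c s₀ sr) := by
  have hmem : S.b ∈ Finset.Icc 1 S.b := Finset.mem_Icc.2 ⟨hb, le_rfl⟩
  have hsum {f : ℕ → ℝ} {B : ℝ} (hf : ∀ j ∈ Finset.Icc 1 S.b, |f j| ≤ B) :
      |∑ j ∈ Finset.Icc 1 S.b, f j| ≤ S.b * B := by
    refine (Finset.abs_sum_le_sum_abs _ _).trans ((Finset.sum_le_card_nsmul _ _ _ hf).trans_eq ?_)
    simp
  rw [S.τhat_mul_βon_sub G ω (h.τhat_pos hs hmem).ne', add_sub_cancel_left]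
  refine (abs_add_three _ _ _).trans ?_
  have hstationarity := h.abs_stationarity_remainder_le hs hmem
  have hdrift := hsum fun j hj => h.abs_projection_drift_le hs hj
  have hlinearization := hsum fun j hj => h.abs_linearization_remainder_le hs hj
  unfold Constants.remainder
  linarith

end GoodOutcome

end Stream

/-! ### The population information matrix -/

section Projection

variable {ι : Type*} [Fintype ι] [DecidableEq ι]

lemma mul_sum_sq_le_of_hasEigenvalue {A : Matrix ι ι ℝ} (hA : A.IsSymm) {κ : ℝ}
    (h : ∀ t : ℝ, Module.End.HasEigenvalue (Matrix.toLin' A) t → κ ≤ t) (u : ι → ℝ) :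
    κ * ∑ k, u k ^ 2 ≤ u ⬝ᵥ (A *ᵥ u) := by
  have hherm : (A - κ • (1 : Matrix ι ι ℝ)).IsHermitian := by
    rw [Matrix.IsHermitian, Matrix.conjTranspose_eq_transpose_of_trivial, Matrix.transpose_sub,
      Matrix.transpose_smul, Matrix.transpose_one, hA.eq]
  have hmulVec (v : ι → ℝ) : (A - κ • (1 : Matrix ι ι ℝ)) *ᵥ v = A *ᵥ v - κ • v := by
    rw [Matrix.sub_mulVec, Matrix.smul_mulVec, Matrix.one_mulVec]
  have hpsd : (A - κ • (1 : Matrix ι ι ℝ)).PosSemidef := by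
    refine hherm.posSemidef_iff_eigenvalues_nonneg.2 fun i => ?_
    have hne : (hherm.eigenvectorBasis i : ι → ℝ) ≠ 0 := fun h0 =>
      hherm.eigenvectorBasis.orthonormal.ne_zero i (by ext k; exact congrFun h0 k)
    have heig := hherm.mulVec_eigenvectorBasis i
    rw [hmulVec, sub_eq_iff_eq_add, ← add_smul] at heig
    have hle := h _ (Module.End.hasEigenvalue_of_hasEigenvector (Module.End.hasEigenvector_iff.2
      ⟨Module.End.mem_eigenspace_iff.2 ((Matrix.toLin'_apply A _).trans heig), hne⟩))
    simpa using hle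
  have hnonneg := hpsd.dotProduct_mulVec_nonneg u
  have hsq : u ⬝ᵥ u = ∑ k, u k ^ 2 := Finset.sum_congr rfl fun k _ => (sq _).symm
  rw [star_trivial, hmulVec, dotProduct_sub, dotProduct_smul, smul_eq_mul, hsq] at hnonneg
  linarith

lemma det_ne_zero_of_mul_sum_sq_le {A : Matrix ι ι ℝ} {κ : ℝ} (hκ : 0 < κ)
    (h : ∀ u : ι → ℝ, κ * ∑ k, u k ^ 2 ≤ u ⬝ᵥ (A *ᵥ u)) : A.det ≠ 0 := by
  intro hdet
  obtain ⟨v, hv, hAv⟩ := Matrix.exists_mulVec_eq_zero_iff.2 hdet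
  obtain ⟨k, hk⟩ := Function.ne_iff.1 hv
  have hpos : 0 < ∑ k, v k ^ 2 :=
    Finset.sum_pos' (fun _ _ => sq_nonneg _) ⟨k, Finset.mem_univ k, sq_pos_of_ne_zero hk⟩
  have hle := h v
  rw [hAv, dotProduct_zero] at hle
  exact (mul_pos hκ hpos).not_ge hle

variable {p : ℕ} {A : Matrix (Fin p) (Fin p) ℝ} {r : Fin p} {γ : {k // k ≠ r} → ℝ}

lemma extend_zero_single (k : {k // k ≠ r}) (s : ℝ) :
    extend r 0 (Pi.single k s) = Pi.single k.1 s := by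
  funext l
  by_cases hl : l = r
  · subst hl
    simp [k.2.symm]
  · simp [extend, hl, Pi.single_apply, Subtype.ext_iff]

lemma mulVec_extend_eq_zero_of_isMinOn (hA : A.IsSymm) (h : IsMinOn (projQuad A r) Set.univ γ)
    {k : Fin p} (hk : k ≠ r) : (A *ᵥ extend r (-1) γ) k = 0 := by
  have hnonneg (s : ℝ) : 0 ≤ s * (A *ᵥ extend r (-1) γ) k := by
    refine nonneg_of_mul_nonneg_right (nonneg_of_forall_nonneg_add_mul
      (z := Pi.single k s ⬝ᵥ (A *ᵥ Pi.single k s)) fun t ht _ => ?_) two_pos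
    have hmin : projQuad A r γ ≤ projQuad A r (γ + t • Pi.single ⟨k, hk⟩ s) :=
      h (Set.mem_univ _)
    have hext : extend r (-1) (γ + t • Pi.single ⟨k, hk⟩ s) =
        extend r (-1) γ + t • Pi.single k s := by
      rw [← extend_zero_single ⟨k, hk⟩, ← extend_zero_smul, ← extend_add, add_zero]
    rw [projQuad_eq_extend hA, projQuad_eq_extend hA, hext, dotProduct_mulVec_add_smul hA,
      single_dotProduct] at hmin
    refine nonneg_of_mul_nonneg_right (a := t) ?_ ht
    linarith
  linarith [hnonneg 1, hnonneg (-1)]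

/-- By the normal equations, `(-1, γ)` is a multiple of the `r`-th column of `A⁻¹`. -/
lemma card_support_le_of_isMinOn (hA : A.IsSymm) (hdet : A.det ≠ 0)
    (h : IsMinOn (projQuad A r) Set.univ γ) :
    Nat.card {k // γ k ≠ 0} ≤ Nat.card {k // k ≠ r ∧ A⁻¹ k r ≠ 0} := by
  set u := extend r (-1) γ with hu
  have hAu : A *ᵥ u = Pi.single r ((A *ᵥ u) r) := by
    funext k
    by_cases hk : k = r
    · subst hk; simp
    · rw [mulVec_extend_eq_zero_of_isMinOn hA h hk, Pi.single_eq_of_ne hk]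
  have hcol (k : Fin p) : u k = A⁻¹ k r * (A *ᵥ u) r :=
    calc u k = (A⁻¹ *ᵥ (A *ᵥ u)) k := by
          rw [Matrix.mulVec_mulVec, Matrix.nonsing_inv_mul _ (isUnit_iff_ne_zero.2 hdet),
            Matrix.one_mulVec]
      _ = A⁻¹ k r * (A *ᵥ u) r := by rw [hAu, Matrix.mulVec_single]; simp
  refine Nat.card_le_card_of_injective
    (fun k : {k // γ k ≠ 0} => (⟨k.1.1, k.1.2, fun h0 => k.2 ?_⟩ :
      {k // k ≠ r ∧ A⁻¹ k r ≠ 0})) fun k l hkl => ?_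
  · rw [← extend_ne (-1) γ, ← hu, hcol, h0, zero_mul]
  · exact Subtype.ext (Subtype.ext (congrArg (fun k => k.1) hkl))

end Projection

namespace Stream

variable {Ω : Type*} {S : Stream Ω} {G : GLM} [MeasurableSpace Ω] {μ : Measure Ω}

/-- The part of the regularity conditions that the analysis rests on: next to bounds on the
covariates and on the population projections, two-sided bounds on `g'` near `β₀`. -/
structure LocallyRegular (S : Stream Ω) (μ : Measure Ω) (c : ModelConstants G) : Prop where
  bounded_x : ∀ᵐ ω ∂μ, ∀ i < S.N S.b, ∀ k, |S.x i ω k| ≤ c.K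
  isMinOn_γ₀ : IsMinOn (projQuad (S.popJ G μ) S.r) Set.univ S.γ₀
  bounded_projection : ∀ᵐ ω ∂μ, ∀ i < S.N S.b,
    |∑ k : {k // k ≠ S.r}, S.x i ω k.1 * S.γ₀ k| ≤ c.M
  lipschitz : ∀ᵐ ω ∂μ, ∀ i < S.N S.b, ∀ β β' : Fin S.p → ℝ,
    l1 (β - S.β₀) ≤ c.δ → l1 (β' - S.β₀) ≤ c.δ →
      |deriv G.g (S.x i ω ⬝ᵥ β) - deriv G.g (S.x i ω ⬝ᵥ β')| ≤
        c.L * |S.x i ω ⬝ᵥ β - S.x i ω ⬝ᵥ β'|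
  deriv_le : ∀ᵐ ω ∂μ, ∀ i < S.N S.b, ∀ β : Fin S.p → ℝ, l1 (β - S.β₀) ≤ c.δ →
    deriv G.g (S.x i ω ⬝ᵥ β) ≤ c.K₂
  one_le_mul_deriv : ∀ᵐ ω ∂μ, ∀ i < S.N S.b, ∀ β : Fin S.p → ℝ, l1 (β - S.β₀) ≤ c.δ →
    1 ≤ c.K₃ * deriv G.g (S.x i ω ⬝ᵥ β)
  eigenvalue : ∀ t : ℝ, Module.End.HasEigenvalue (Matrix.toLin' (S.popJ G μ)) t → c.κ ≤ t

lemma popJ_isSymm : (S.popJ G μ).IsSymm := by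
  ext k l
  simp only [popJ, Matrix.transpose_apply, Matrix.of_apply]
  congr 2
  funext ω
  exact (S.J_isSymm G 1 S.β₀ ω).apply k l

lemma Regular.locallyRegular {K M L δ K₂ K₃ κ : ℝ} (hδ : 0 < δ) (hκ : 0 < κ)
    (hR : S.Regular G μ K M L δ K₂ K₃ κ) :
    S.LocallyRegular μ (.normalize G K M L K₂ K₃ hδ hκ) where
  bounded_x := hR.bounded_x.mono fun _ h i hi k => (h i hi k).trans (le_max_left _ _)
  isMinOn_γ₀ := hR.isMinOn_γ₀
  bounded_projection := hR.bounded_projection.mono fun _ h i hi =>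
    (h i hi).trans (le_max_left _ _)
  lipschitz := hR.lipschitz.mono fun _ h i hi β β' hβ hβ' =>
    (h i hi β β' hβ hβ').trans (mul_le_mul_of_nonneg_right (le_max_left _ _) (abs_nonneg _))
  deriv_le := hR.bounded_deriv.mono fun _ h i hi β hβ =>
    (le_abs_self _).trans ((h i hi β hβ).trans (le_max_left _ _))
  one_le_mul_deriv := hR.bounded_inv_deriv.mono fun ω h i hi β hβ => by
    obtain ⟨hne, hle⟩ := h i hi β hβ
    have hpos : 0 < deriv G.g (S.x i ω ⬝ᵥ β) := (G.deriv_g_nonneg _).lt_of_ne' hne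
    rw [abs_of_pos (one_div_pos.2 hpos), div_le_iff₀ hpos] at hle
    exact hle.trans (mul_le_mul_of_nonneg_right (le_max_left _ _) hpos.le)
  eigenvalue := hR.eigenvalue

section LocallyRegular

variable {c : ModelConstants G} (hR : S.LocallyRegular μ c)

include hR

lemma LocallyRegular.mul_sum_sq_le (u : Fin S.p → ℝ) :
    c.κ * ∑ k, u k ^ 2 ≤ u ⬝ᵥ (S.popJ G μ *ᵥ u) :=
  mul_sum_sq_le_of_hasEigenvalue popJ_isSymm hR.eigenvalue u

lemma LocallyRegular.card_γ₀_le : Nat.card {k // S.γ₀ k ≠ 0} ≤ S.sr G μ :=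
  (card_support_le_of_isMinOn popJ_isSymm (det_ne_zero_of_mul_sum_sq_le c.κ_pos hR.mul_sum_sq_le)
    hR.isMinOn_γ₀).trans (le_max_right _ _)

lemma LocallyRegular.abs_deriv_le :
    ∀ᵐ ω ∂μ, ∀ i < S.N S.b, |deriv G.g (S.x i ω ⬝ᵥ S.β₀)| ≤ c.K₂ := by
  filter_upwards [hR.deriv_le] with ω hω i hi
  rw [abs_of_nonneg (G.deriv_g_nonneg _)]
  exact hω i hi S.β₀ (by simpa [l1] using c.δ_pos.le)

lemma LocallyRegular.abs_info_le :
    ∀ᵐ ω ∂μ, ∀ i < S.N S.b, ∀ k l,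
      |deriv G.g (S.x i ω ⬝ᵥ S.β₀) * S.x i ω k * S.x i ω l| ≤ c.K₂ * c.K ^ 2 := by
  have := c.K_nonneg
  have := c.one_le_K₂
  filter_upwards [hR.abs_deriv_le, hR.bounded_x] with ω hderiv hx i hi k l
  calc |deriv G.g (S.x i ω ⬝ᵥ S.β₀) * S.x i ω k * S.x i ω l|
      = |deriv G.g (S.x i ω ⬝ᵥ S.β₀)| * |S.x i ω k| * |S.x i ω l| := by rw [abs_mul, abs_mul]
    _ ≤ c.K₂ * c.K * c.K := by
        gcongr
        exacts [hderiv i hi, hx i hi k, hx i hi l]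
    _ = c.K₂ * c.K ^ 2 := by ring

lemma LocallyRegular.abs_resid_le :
    ∀ᵐ ω ∂μ, ∀ i < S.N S.b, ∀ k, |deriv G.g (S.x i ω ⬝ᵥ S.β₀) * S.x i ω k *
      (S.x i ω ⬝ᵥ extend S.r (-1) S.γ₀)| ≤ c.K₂ * c.K * (c.K + c.M) := by
  have := c.K_nonneg
  have := c.one_le_K₂
  filter_upwards [hR.abs_deriv_le, hR.bounded_x, hR.bounded_projection]
    with ω hderiv hx hproj i hi k
  have hresid : |S.x i ω ⬝ᵥ extend S.r (-1) S.γ₀| ≤ c.K + c.M := by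
    rw [dotProduct_extend]
    refine (abs_add_le _ _).trans (add_le_add ?_ (hproj i hi))
    simpa using hx i hi S.r
  rw [abs_mul, abs_mul]
  gcongr
  exacts [hderiv i hi, hx i hi k]

/-- The tilt of the density at `η` by `θ (y - g η)` is the density at `η + 2 φ θ`, and the
perturbation of the linear predictor in the direction of one covariate stays within the region
where `g'` is bounded. -/
lemma LocallyRegular.lintegral_exp_score_le :
    ∀ᵐ ω ∂μ, ∀ i < S.N S.b, ∀ (k : Fin S.p) (θ : ℝ), |θ| ≤ c.δ / (2 * G.φ) →
      ∫⁻ y, ENNReal.ofReal (Real.exp (θ * ((y - G.g (S.x i ω ⬝ᵥ S.β₀)) * S.x i ω k))) *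
          ENNReal.ofReal (G.density (S.x i ω ⬝ᵥ S.β₀) y) ∂G.ν ≤
        ENNReal.ofReal (Real.exp (2 * G.φ * c.K₂ * c.K ^ 2 * θ ^ 2)) := by
  have hφ := G.φ_pos
  have := c.one_le_K₂
  filter_upwards [hR.bounded_x, hR.deriv_le] with ω hx hderiv i hi k θ hθ
  rw [le_div_iff₀ (by positivity)] at hθ
  have hcumulant := G.cumulant_sub_sub_le (η := S.x i ω ⬝ᵥ S.β₀)
    (t := 2 * G.φ * (θ * S.x i ω k)) (B := c.K₂) fun s hs => by
      have hball : l1 (S.β₀ + Pi.single k (s * (2 * G.φ * θ)) - S.β₀) ≤ c.δ := by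
        rw [add_sub_cancel_left, l1_single, abs_mul, abs_of_nonneg hs.1, abs_mul,
          abs_of_pos (by positivity : 0 < 2 * G.φ)]
        refine (mul_le_of_le_one_left (by positivity) hs.2).trans ?_
        rwa [mul_comm]
      convert hderiv i hi _ hball using 2
      rw [dotProduct_add, dotProduct_single]
      ring
  have hassoc (y : ℝ) : θ * ((y - G.g (S.x i ω ⬝ᵥ S.β₀)) * S.x i ω k) =
      θ * S.x i ω k * (y - G.g (S.x i ω ⬝ᵥ S.β₀)) := by ring
  simp_rw [hassoc, G.lintegral_exp_mul_density]
  refine ENNReal.ofReal_le_ofReal (Real.exp_le_exp.2 ?_)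
  rw [div_le_iff₀ (by positivity)]
  have hxsq : S.x i ω k ^ 2 ≤ c.K ^ 2 := sq_le_sq' (abs_le.1 (hx i hi k)).1 (abs_le.1 (hx i hi k)).2
  calc G.cumulant (S.x i ω ⬝ᵥ S.β₀ + 2 * G.φ * (θ * S.x i ω k)) - G.cumulant (S.x i ω ⬝ᵥ S.β₀) -
        2 * G.φ * (θ * S.x i ω k) * G.g (S.x i ω ⬝ᵥ S.β₀)
      ≤ c.K₂ / 2 * (2 * G.φ * (θ * S.x i ω k)) ^ 2 := hcumulant
    _ = 2 * G.φ ^ 2 * c.K₂ * θ ^ 2 * S.x i ω k ^ 2 := by ring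
    _ ≤ 4 * G.φ ^ 2 * c.K₂ * θ ^ 2 * c.K ^ 2 := by gcongr; norm_num
    _ = 2 * G.φ * c.K₂ * c.K ^ 2 * θ ^ 2 * (2 * G.φ) := by ring

end LocallyRegular

end Stream

/-! ### Concentration -/

namespace Stream

section Measurability

variable {p : ℕ} (G : GLM) (β u : Fin p → ℝ) (k l : Fin p)

lemma measurable_score :
    Measurable fun z : (Fin p → ℝ) × ℝ => (z.2 - G.g (z.1 ⬝ᵥ β)) * z.1 k :=
  (measurable_snd.sub (G.differentiable_g.continuous.measurable.comp
    (measurable_dotProduct_left measurable_fst β))).mul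
      ((measurable_pi_apply k).comp measurable_fst)

lemma measurable_deriv_g_mul :
    Measurable fun z : (Fin p → ℝ) × ℝ => deriv G.g (z.1 ⬝ᵥ β) * z.1 k :=
  ((measurable_deriv G.g).comp (measurable_dotProduct_left measurable_fst β)).mul
    ((measurable_pi_apply k).comp measurable_fst)

lemma measurable_info :
    Measurable fun z : (Fin p → ℝ) × ℝ => deriv G.g (z.1 ⬝ᵥ β) * z.1 k * z.1 l :=
  (measurable_deriv_g_mul G β k).mul ((measurable_pi_apply l).comp measurable_fst)

lemma measurable_resid :
    Measurable fun z : (Fin p → ℝ) × ℝ => deriv G.g (z.1 ⬝ᵥ β) * z.1 k * (z.1 ⬝ᵥ u) :=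
  (measurable_deriv_g_mul G β k).mul (measurable_dotProduct_left measurable_fst u)

end Measurability

variable {Ω : Type*} {S : Stream Ω} {G : GLM} [MeasurableSpace Ω] {μ : Measure Ω}

namespace IsSample

variable {F : (Fin S.p → ℝ) × ℝ → ℝ} {σ ρ : ℝ} {i : ℕ}

lemma measurable_comp (hS : S.IsSample G μ) (hF : Measurable F) (hi : i < S.N S.b) :
    Measurable fun ω => F (S.x i ω, S.y i ω) :=
  hF.comp ((hS.measurable_x i hi).prodMk (hS.measurable_y i hi))

variable [IsProbabilityMeasure μ]

lemma isSubExponential_of_lintegral_exp_le (hS : S.IsSample G μ) (hi : i < S.N S.b)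
    (hF : Measurable F) (h : ∀ᵐ ω ∂μ, ∀ θ : ℝ, |θ| ≤ ρ →
      ∫⁻ y, ENNReal.ofReal (Real.exp (θ * F (S.x i ω, y))) *
        ENNReal.ofReal (G.density (S.x i ω ⬝ᵥ S.β₀) y) ∂G.ν ≤
          ENNReal.ofReal (Real.exp (σ * θ ^ 2))) :
    IsSubExponential (fun ω => F (S.x i ω, S.y i ω)) σ ρ μ := by
  have hle (θ : ℝ) (hθ : |θ| ≤ ρ) :
      ∫⁻ ω, ENNReal.ofReal (Real.exp (θ * F (S.x i ω, S.y i ω))) ∂μ ≤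
        ENNReal.ofReal (Real.exp (σ * θ ^ 2)) := by
    rw [hS.lintegral_comp hi (hF.const_mul θ).exp.ennreal_ofReal]
    refine (lintegral_mono_ae (h.mono fun ω hω => hω θ hθ)).trans_eq ?_
    rw [lintegral_const, measure_univ, mul_one]
  have hm (θ : ℝ) : AEStronglyMeasurable (fun ω => Real.exp (θ * F (S.x i ω, S.y i ω))) μ :=
    ((hS.measurable_comp hF hi).const_mul θ).exp.aestronglyMeasurable
  have hnonneg (θ : ℝ) : 0 ≤ᵐ[μ] fun ω => Real.exp (θ * F (S.x i ω, S.y i ω)) :=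
    ae_of_all _ fun _ => (Real.exp_pos _).le
  refine ⟨fun θ hθ => ⟨hm θ, ?_⟩, fun θ hθ => ?_⟩
  · rw [hasFiniteIntegral_iff_ofReal (hnonneg θ)]
    exact (hle θ hθ).trans_lt ENNReal.ofReal_lt_top
  · rw [mgf, integral_eq_lintegral_of_nonneg_ae (hnonneg θ) (hm θ)]
    exact ENNReal.toReal_le_of_le_ofReal (Real.exp_pos _).le (hle θ hθ)

variable {c : ModelConstants G} (hS : S.IsSample G μ) (hR : S.LocallyRegular μ c)
  (hi : i < S.N S.b)

include hS hR hi

lemma isSubExponential_score (k : Fin S.p) :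
    IsSubExponential (fun ω => (S.y i ω - G.g (S.x i ω ⬝ᵥ S.β₀)) * S.x i ω k)
      (2 * G.φ * c.K₂ * c.K ^ 2) (c.δ / (2 * G.φ)) μ :=
  hS.isSubExponential_of_lintegral_exp_le hi (measurable_score G S.β₀ k)
    (hR.lintegral_exp_score_le.mono fun _ hω => hω i hi k)

lemma integrable_info (k l : Fin S.p) :
    Integrable (fun ω => deriv G.g (S.x i ω ⬝ᵥ S.β₀) * S.x i ω k * S.x i ω l) μ :=
  Integrable.of_bound (hS.measurable_comp (measurable_info G S.β₀ k l) hi).aestronglyMeasurable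
    (c.K₂ * c.K ^ 2) (hR.abs_info_le.mono fun _ hω => hω i hi k l)

variable (hN : 0 < S.N 1)

include hN

lemma popJ_apply (k l : Fin S.p) :
    S.popJ G μ k l = ∫ ω, deriv G.g (S.x i ω ⬝ᵥ S.β₀) * S.x i ω k * S.x i ω l ∂μ := by
  have hb : 1 ≤ S.b := by
    by_contra! hb
    rw [Nat.lt_one_iff.1 hb, N_zero] at hi
    exact absurd hi (Nat.not_lt_zero i)
  have hident (i' : ℕ) (hi' : i' ∈ S.batch 1) :
      ∫ ω, deriv G.g (S.x i' ω ⬝ᵥ S.β₀) * S.x i' ω k * S.x i' ω l ∂μ =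
        ∫ ω, deriv G.g (S.x i ω ⬝ᵥ S.β₀) * S.x i ω k * S.x i ω l ∂μ :=
    ((hS.ident i' (S.lt_N_of_mem_batch hi' hb) i hi).comp
      (measurable_info G S.β₀ k l)).integral_eq
  have hcard : (S.batch 1).card = S.N 1 := by simp [batch, N_zero]
  simp only [popJ, J, Matrix.of_apply]
  rw [integral_finsetSum _ fun i' hi' =>
      hS.integrable_info hR (S.lt_N_of_mem_batch hi' hb) k l,
    Finset.sum_congr rfl hident, Finset.sum_const, hcard, nsmul_eq_mul]
  exact mul_div_cancel_left₀ _ (Nat.cast_ne_zero.2 hN.ne')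

lemma isSubExponential_info (k l : Fin S.p) :
    IsSubExponential
      (fun ω => deriv G.g (S.x i ω ⬝ᵥ S.β₀) * S.x i ω k * S.x i ω l - S.popJ G μ k l)
      ((2 * c.K₂ * c.K ^ 2) ^ 2) ρ μ := by
  have hJ := hS.popJ_apply hR hi hN k l
  have hbound : |S.popJ G μ k l| ≤ c.K₂ * c.K ^ 2 := by
    have hnorm := norm_integral_le_of_norm_le_const (μ := μ) (C := c.K₂ * c.K ^ 2)
      (f := fun ω => deriv G.g (S.x i ω ⬝ᵥ S.β₀) * S.x i ω k * S.x i ω l)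
      (hR.abs_info_le.mono fun _ hω => hω i hi k l)
    rwa [probReal_univ, mul_one, ← hJ] at hnorm
  refine isSubExponential_of_abs_le
    ((hS.measurable_comp (measurable_info G S.β₀ k l) hi).sub_const _) ?_ ?_
  · filter_upwards [hR.abs_info_le] with ω hω
    linarith [abs_sub (deriv G.g (S.x i ω ⬝ᵥ S.β₀) * S.x i ω k * S.x i ω l) (S.popJ G μ k l),
      hω i hi k l]
  · rw [integral_sub (hS.integrable_info hR hi k l) (integrable_const _), ← hJ]
    simp

lemma isSubExponential_resid {k : Fin S.p} (hk : k ≠ S.r) :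
    IsSubExponential (fun ω => deriv G.g (S.x i ω ⬝ᵥ S.β₀) * S.x i ω k *
        (S.x i ω ⬝ᵥ extend S.r (-1) S.γ₀))
      ((c.K₂ * c.K * (c.K + c.M)) ^ 2) ρ μ := by
  refine isSubExponential_of_abs_le
    (hS.measurable_comp (measurable_resid G S.β₀ (extend S.r (-1) S.γ₀) k) hi)
    (hR.abs_resid_le.mono fun _ hω => hω i hi k) ?_
  have hexpand (ω : Ω) : deriv G.g (S.x i ω ⬝ᵥ S.β₀) * S.x i ω k *
      (S.x i ω ⬝ᵥ extend S.r (-1) S.γ₀) = ∑ l, deriv G.g (S.x i ω ⬝ᵥ S.β₀) * S.x i ω k *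
        S.x i ω l * extend S.r (-1) S.γ₀ l := by
    rw [dotProduct.eq_1 _ (extend S.r (-1) S.γ₀), Finset.mul_sum]
    exact Finset.sum_congr rfl fun l _ => (mul_assoc _ _ _).symm
  simp only [hexpand]
  rw [integral_finsetSum _ fun l _ => (hS.integrable_info hR hi k l).mul_const _]
  simp only [integral_mul_const, ← hS.popJ_apply hR hi hN]
  exact mulVec_extend_eq_zero_of_isMinOn popJ_isSymm hR.isMinOn_γ₀ hk

end IsSample

section Concentration

variable {c : Constants G} {s₀ sr : ℝ} {j : ℕ} {F : (Fin S.p → ℝ) × ℝ → ℝ} {T : Finset ℕ}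
  {σ : ℝ}

lemma IsSample.measure_abs_sum_gt_noise_le (hS : S.IsSample G μ) (hs : S.SampleSize c s₀ sr)
    (hj : j ∈ Finset.Icc 1 S.b) (hF : Measurable F) (hT : T ⊆ Finset.range (S.N j))
    (hσ : 0 ≤ σ) (hnoise : σ + 4 ≤ c.noise)
    (h : ∀ i < S.N S.b,
      IsSubExponential (fun ω => F (S.x i ω, S.y i ω)) σ (c.δ / (2 * G.φ)) μ) :
    μ {ω | c.noise * √(S.N j * (Real.log S.p + j)) < |∑ i ∈ T, F (S.x i ω, S.y i ω)|} ≤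
      ENNReal.ofReal (2 * Real.exp (-(4 * (Real.log S.p + j)))) := by
  have := hs.log_pos
  have hlt (i : ℕ) (hi : i ∈ T) : i < S.N S.b :=
    (Finset.mem_range.1 (hT hi)).trans_le (S.N_mono (Finset.mem_Icc.1 hj).2)
  have hcard : ((T.attachFin hlt).card : ℝ) ≤ S.N j := by
    rw [Finset.card_attachFin]
    exact_mod_cast (Finset.card_le_card hT).trans_eq (Finset.card_range _)
  have hsum (ω : Ω) : ∑ i ∈ T.attachFin hlt, F (S.x i ω, S.y i ω) =
      ∑ i ∈ T, F (S.x i ω, S.y i ω) := by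
    conv_rhs => rw [← Finset.map_valEmbedding_attachFin hlt]
    exact (Finset.sum_map _ Fin.valEmbedding fun i => F (S.x i ω, S.y i ω)).symm
  have htail := OnlineGLM.measure_abs_sum_gt_le (q := 4) (hS.indep.comp (fun _ => F) fun _ => hF)
    (fun i => hS.measurable_comp hF i.2) (T.attachFin hlt) hσ (hs.N_pos hj) hcard
    (by positivity) (hs.sqrt_div_le hj) fun i _ => h i i.2
  refine (measure_mono fun ω hω => ?_).trans htail
  simp only [Set.mem_ofPred_eq, Function.comp_apply, hsum] at hω ⊢
  exact (mul_le_mul_of_nonneg_right hnoise (Real.sqrt_nonneg _)).trans_lt hω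

end Concentration

end Stream

lemma sq_mul_exp_neg_le {p : ℝ} (hp : 1 ≤ p) (j : ℕ) :
    p ^ 2 * Real.exp (-(4 * (Real.log p + j))) ≤ 1 / p * (1 / 2) ^ j := by
  have hp₀ : 0 < p := zero_lt_one.trans_le hp
  have hlog : Real.exp (-Real.log p) = 1 / p := by
    rw [Real.exp_neg, Real.exp_log hp₀, one_div]
  have hhalf : Real.exp (-1) ≤ 1 / 2 := by
    rw [Real.exp_neg, one_div]
    gcongr
    linarith [Real.add_one_le_exp (1 : ℝ)]
  calc p ^ 2 * Real.exp (-(4 * (Real.log p + j)))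
      = Real.exp (2 * Real.log p - 4 * (Real.log p + j)) := by
        rw [sub_eq_add_neg, Real.exp_add, two_mul, Real.exp_add, Real.exp_log hp₀, sq]
    _ ≤ Real.exp (-Real.log p + j * (-1)) := by
        gcongr
        linarith [Real.log_nonneg hp, (Nat.cast_nonneg j : (0 : ℝ) ≤ j)]
    _ = 1 / p * Real.exp (-1) ^ j := by rw [Real.exp_add, hlog, Real.exp_nat_mul]
    _ ≤ 1 / p * (1 / 2) ^ j := by gcongr

lemma measure_biUnion_iUnion_le {Ω ι : Type*} [MeasurableSpace Ω] {μ : Measure Ω} [Fintype ι]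
    {p b : ℕ} (hp : 1 ≤ p) (hι : Fintype.card ι ≤ p ^ 2) {E : ℕ → ι → Set Ω}
    (hE : ∀ j ∈ Finset.Icc 1 b, ∀ k,
      μ (E j k) ≤ ENNReal.ofReal (2 * Real.exp (-(4 * (Real.log p + j))))) :
    μ (⋃ j ∈ Finset.Icc 1 b, ⋃ k, E j k) ≤ ENNReal.ofReal (4 / p) := by
  have hp₁ : (1 : ℝ) ≤ p := by exact_mod_cast hp
  have hunion (j : ℕ) (hj : j ∈ Finset.Icc 1 b) :
      μ (⋃ k, E j k) ≤ ENNReal.ofReal (2 / p * (1 / 2) ^ j) := by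
    refine (measure_iUnion_fintype_le _ _).trans ((Finset.sum_le_sum fun k _ => hE j hj k).trans ?_)
    rw [Finset.sum_const, Finset.card_univ, ← ENNReal.ofReal_nsmul, nsmul_eq_mul]
    refine ENNReal.ofReal_le_ofReal ?_
    calc (Fintype.card ι : ℝ) * (2 * Real.exp (-(4 * (Real.log p + j))))
        ≤ (p : ℝ) ^ 2 * (2 * Real.exp (-(4 * (Real.log p + j)))) := by
          gcongr
          exact_mod_cast hι
      _ = 2 * ((p : ℝ) ^ 2 * Real.exp (-(4 * (Real.log p + j)))) := by ring
      _ ≤ 2 * (1 / p * (1 / 2) ^ j) := by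
          gcongr 2 * ?_
          exact sq_mul_exp_neg_le hp₁ j
      _ = 2 / p * (1 / 2) ^ j := by ring
  have hgeom : ∑ j ∈ Finset.Icc 1 b, (1 / 2 : ℝ) ^ j ≤ 2 :=
    (Finset.sum_le_sum_of_subset_of_nonneg
      (fun j hj => Finset.mem_range_succ_iff.2 (Finset.mem_Icc.1 hj).2)
      fun _ _ _ => by positivity).trans (sum_geometric_two_le (b + 1))
  refine (measure_biUnion_finset_le _ _).trans ((Finset.sum_le_sum hunion).trans ?_)
  rw [← ENNReal.ofReal_sum_of_nonneg fun j _ => by positivity, ← Finset.mul_sum]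
  refine ENNReal.ofReal_le_ofReal ?_
  calc 2 / (p : ℝ) * ∑ j ∈ Finset.Icc 1 b, (1 / 2 : ℝ) ^ j ≤ 2 / p * 2 := by gcongr
    _ = 4 / p := by ring

/-! ### Asymptotics -/

namespace Constants

variable {G : GLM} (c : Constants G)

/-- The base `A` of the factors `c₁^{(j)} = A ^ j`: the first summand leaves a factor `2 ^ j` to
absorb the `j` in `log p + j`, the second one absorbs the constant of the `ℓ₁` error bound. -/
def base : ℝ := 2 * c.growth ^ 2 + c.growth * (c.lasso / (2 * c.C ^ 2))

lemma two_mul_growth_sq_le_base : 2 * c.growth ^ 2 ≤ c.base :=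
  le_add_of_nonneg_right
    (mul_nonneg c.growth_pos.le (div_nonneg c.lasso_pos.le (by positivity)))

lemma one_le_base : 1 ≤ c.base := by
  nlinarith [c.two_mul_growth_sq_le_base, c.sixteen_le_growth]

lemma lasso_div_mul_growth_pow_le_base_pow {j : ℕ} (hj : j ≠ 0) :
    c.lasso / (2 * c.C ^ 2) * c.growth ^ j ≤ c.base ^ j := by
  obtain ⟨i, rfl⟩ := Nat.exists_eq_succ_of_ne_zero hj
  have hgrowth := c.growth_pos
  have hlasso := c.lasso_pos
  have hmul : c.growth * (c.lasso / (2 * c.C ^ 2)) ≤ c.base :=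
    le_add_of_nonneg_left (by positivity)
  have hle : c.growth ≤ c.base := by
    nlinarith [c.two_mul_growth_sq_le_base, c.sixteen_le_growth]
  have := c.one_le_base
  calc c.lasso / (2 * c.C ^ 2) * c.growth ^ (i + 1)
      = c.growth ^ i * (c.growth * (c.lasso / (2 * c.C ^ 2))) := by ring
    _ ≤ c.base ^ i * c.base := by gcongr
    _ = c.base ^ (i + 1) := (pow_succ _ _).symm

end Constants

namespace Stream

variable {Ω : Type*} {S : Stream Ω} {G : GLM} {c : Constants G}

lemma LassoBounds.l1_le_base_pow_mul_lam {s₀ : ℝ} {ω : Ω} {j : ℕ} (h : S.LassoBounds c s₀ ω j)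
    (hj : j ≠ 0) (hs₀ : 0 ≤ s₀) (hN : 0 < S.N j) (hp : 0 < Real.log S.p) :
    l1 (S.βhat j ω - S.β₀) ≤ c.base ^ j * s₀ * S.lam c.C j := by
  have hC := c.C_pos
  have : (0 : ℝ) < S.N j := by exact_mod_cast hN
  have hlam : 0 < S.lam c.C j := by unfold lam; positivity
  have hsq : S.N j * S.lam c.C j ^ 2 = c.C ^ 2 * Real.log S.p := by
    rw [lam, mul_pow, Real.sq_sqrt (by positivity)]
    field_simp
  refine le_of_mul_le_mul_left ?_ (by positivity : 0 < 2 * (S.N j : ℝ) * S.lam c.C j)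
  calc 2 * S.N j * S.lam c.C j * l1 (S.βhat j ω - S.β₀)
      ≤ c.lasso * S.rate c s₀ j := by rw [S.two_mul_N_mul_lam hN]; exact h.l1_le
    _ = c.lasso / (2 * c.C ^ 2) * c.growth ^ j * s₀ * (2 * (c.C ^ 2 * Real.log S.p)) := by
        unfold rate
        field_simp
    _ ≤ c.base ^ j * s₀ * (2 * (c.C ^ 2 * Real.log S.p)) := by
        gcongr
        exact c.lasso_div_mul_growth_pow_le_base_pow hj
    _ = 2 * S.N j * S.lam c.C j * (c.base ^ j * s₀ * S.lam c.C j) := by rw [← hsq]; ring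

section Probability

variable [MeasurableSpace Ω] {μ : Measure Ω}

lemma LocallyRegular.sampleSize (hR : S.LocallyRegular μ c.toModelConstants)
    (hp : 1 ≤ Real.log S.p) (h : ∀ j ∈ Finset.Icc 1 S.b,
      c.size ^ 2 * c.base ^ j * S.s₀ ^ 2 * S.sr G μ ^ 2 * Real.log S.p ≤ S.N j) :
    S.SampleSize c S.s₀ (S.sr G μ) where
  one_le_log := hp
  one_le_s₀ := by exact_mod_cast le_max_left _ _
  one_le_sr := by exact_mod_cast le_max_left _ _
  card_β₀_le := by exact_mod_cast le_max_right _ _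
  card_γ₀_le := by exact_mod_cast hR.card_γ₀_le
  le_N j hj := by
    have hlog : Real.log S.p + j ≤ 2 ^ j * Real.log S.p := by
      have : (j : ℝ) + 1 ≤ 2 ^ j := by exact_mod_cast Nat.lt_two_pow_self (n := j)
      nlinarith [Nat.cast_nonneg (α := ℝ) j]
    calc (c.size * (c.growth ^ j * (S.s₀ * S.sr G μ))) ^ 2 * (Real.log S.p + j)
        ≤ (c.size * (c.growth ^ j * (S.s₀ * S.sr G μ))) ^ 2 * (2 ^ j * Real.log S.p) := by gcongr
      _ = c.size ^ 2 * (2 * c.growth ^ 2) ^ j * S.s₀ ^ 2 * S.sr G μ ^ 2 * Real.log S.p := by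
          rw [mul_pow 2 (c.growth ^ 2) j, ← pow_mul, mul_comm 2 j, pow_mul]
          ring
      _ ≤ c.size ^ 2 * c.base ^ j * S.s₀ ^ 2 * S.sr G μ ^ 2 * Real.log S.p := by
          gcongr
          exact c.two_mul_growth_sq_le_base
      _ ≤ S.N j := h j hj

section Deviations

variable [IsProbabilityMeasure μ] {s₀ sr : ℝ} (hS : S.IsSample G μ)
  (hR : S.LocallyRegular μ c.toModelConstants) (hs : S.SampleSize c s₀ sr)

include hS hR hs

lemma measure_score_deviation_le :
    μ (⋃ j ∈ Finset.Icc 1 S.b, ⋃ k, {ω | c.noise * √(S.N j * (Real.log S.p + j)) <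
      |∑ i ∈ S.batch j, (S.y i ω - G.g (S.x i ω ⬝ᵥ S.β₀)) * S.x i ω k|}) ≤
      ENNReal.ofReal (4 / S.p) := by
  have := G.φ_pos
  have := c.K₂_pos
  refine measure_biUnion_iUnion_le hs.p_pos ?_ fun j hj k =>
    hS.measure_abs_sum_gt_noise_le hs hj (measurable_score G S.β₀ k) (fun i hi => ?_)
      (by positivity) ?_ fun i hi => hS.isSubExponential_score hR hi k
  · rw [Fintype.card_fin]
    exact Nat.le_self_pow two_ne_zero _
  · exact Finset.mem_range.2 (Finset.mem_Ico.1 hi).2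
  · unfold ModelConstants.noise
    linarith [sq_nonneg (2 * c.K₂ * c.K ^ 2), sq_nonneg (c.K₂ * c.K * (c.K + c.M))]

lemma measure_info_deviation_le :
    μ (⋃ j ∈ Finset.Icc 1 S.b, ⋃ k : Fin S.p × Fin S.p,
      {ω | c.noise * √(S.N j * (Real.log S.p + j)) < |∑ i ∈ Finset.range (S.N j),
        (deriv G.g (S.x i ω ⬝ᵥ S.β₀) * S.x i ω k.1 * S.x i ω k.2 - S.popJ G μ k.1 k.2)|}) ≤
      ENNReal.ofReal (4 / S.p) := by
  have := G.φ_pos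
  have := c.K₂_pos
  refine measure_biUnion_iUnion_le hs.p_pos ?_ fun j hj k =>
    hS.measure_abs_sum_gt_noise_le hs hj ((measurable_info G S.β₀ k.1 k.2).sub_const _) subset_rfl
      (sq_nonneg _) ?_ fun i hi => hS.isSubExponential_info hR hi (hs.N_one_pos hj) k.1 k.2
  · rw [Fintype.card_prod, Fintype.card_fin, sq]
  · have : 0 ≤ 2 * G.φ * c.K₂ * c.K ^ 2 := by positivity
    unfold ModelConstants.noise
    linarith [sq_nonneg (c.K₂ * c.K * (c.K + c.M))]

lemma measure_resid_deviation_le :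
    μ (⋃ j ∈ Finset.Icc 1 S.b, ⋃ k : {k // k ≠ S.r},
      {ω | c.noise * √(S.N j * (Real.log S.p + j)) < |∑ i ∈ Finset.range (S.N j),
        deriv G.g (S.x i ω ⬝ᵥ S.β₀) * S.x i ω k.1 * (S.x i ω ⬝ᵥ extend S.r (-1) S.γ₀)|}) ≤
      ENNReal.ofReal (4 / S.p) := by
  have := G.φ_pos
  have := c.K₂_pos
  refine measure_biUnion_iUnion_le hs.p_pos ?_ fun j hj k =>
    hS.measure_abs_sum_gt_noise_le hs hj (measurable_resid G S.β₀ _ k.1) subset_rfl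
      (sq_nonneg _) ?_ fun i hi => hS.isSubExponential_resid hR hi (hs.N_one_pos hj) k.2
  · refine (Fintype.card_subtype_le _).trans ?_
    rw [Fintype.card_fin]
    exact Nat.le_self_pow two_ne_zero _
  · have : 0 ≤ 2 * G.φ * c.K₂ * c.K ^ 2 := by positivity
    unfold ModelConstants.noise
    linarith [sq_nonneg (2 * c.K₂ * c.K ^ 2)]

lemma measure_not_goodOutcome_le (hE : S.IsEstimator G μ c.C) :
    μ {ω | ¬S.GoodOutcome c (S.popJ G μ) ω} ≤ ENNReal.ofReal (12 / S.p) := by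
  have hmem : ∀ᵐ ω ∂μ, ω ∈ {ω | ¬S.GoodOutcome c (S.popJ G μ) ω} → ω ∈
      (⋃ j ∈ Finset.Icc 1 S.b, ⋃ k, {ω | c.noise * √(S.N j * (Real.log S.p + j)) <
        |∑ i ∈ S.batch j, (S.y i ω - G.g (S.x i ω ⬝ᵥ S.β₀)) * S.x i ω k|}) ∪
      (⋃ j ∈ Finset.Icc 1 S.b, ⋃ k : Fin S.p × Fin S.p,
        {ω | c.noise * √(S.N j * (Real.log S.p + j)) < |∑ i ∈ Finset.range (S.N j),
          (deriv G.g (S.x i ω ⬝ᵥ S.β₀) * S.x i ω k.1 * S.x i ω k.2 - S.popJ G μ k.1 k.2)|}) ∪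
      ⋃ j ∈ Finset.Icc 1 S.b, ⋃ k : {k // k ≠ S.r},
        {ω | c.noise * √(S.N j * (Real.log S.p + j)) < |∑ i ∈ Finset.range (S.N j),
          deriv G.g (S.x i ω ⬝ᵥ S.β₀) * S.x i ω k.1 * (S.x i ω ⬝ᵥ extend S.r (-1) S.γ₀)|} := by
    filter_upwards [hR.bounded_x, hR.bounded_projection, hR.lipschitz, hR.deriv_le,
      hR.one_le_mul_deriv, hE.lasso, hE.proj] with ω hx hproj hlip hK₂ hK₃ hβ hγ hbad
    by_contra hdev
    simp only [Set.mem_union, Set.mem_iUnion, Set.mem_ofPred_eq, not_or, not_exists, not_lt]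
      at hdev
    exact hbad ⟨hR.mul_sum_sq_le, hx, hproj, hlip, hK₂, hK₃, hβ, hγ, hdev.1.1,
      fun j hj k l => hdev.1.2 j hj (k, l), fun j hj k hk => hdev.2 j hj ⟨k, hk⟩⟩
  refine (measure_mono_ae hmem).trans ((measure_union_le _ _).trans ((add_le_add
    ((measure_union_le _ _).trans (add_le_add (measure_score_deviation_le hS hR hs)
      (measure_info_deviation_le hS hR hs))) (measure_resid_deviation_le hS hR hs)).trans_eq ?_))
  rw [← ENNReal.ofReal_add (by positivity) (by positivity),
    ← ENNReal.ofReal_add (by positivity) (by positivity)]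
  congr 1
  ring

end Deviations

end Probability

/-- The remainder `V_r` of the expansion of the debiased estimator. -/
def V (S : Stream Ω) (G : GLM) (ω : Ω) : ℝ :=
  S.τhat G S.b ω / √(S.N S.b : ℝ) * (S.βon G ω - S.β₀ S.r) - S.W G ω

/-- The event on which the estimators behave as they should, where `sr` bounds the sparsity of the
population projection. -/
structure ErrorBounds (S : Stream Ω) (c : Constants G) (sr : ℝ) (ω : Ω) : Prop where
  l1_le : ∀ j ∈ Finset.Icc 1 S.b, l1 (S.βhat j ω - S.β₀) ≤ c.base ^ j * S.s₀ * S.lam c.C j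
  τhat_pos : 0 < S.τhat G S.b ω
  abs_V_le : |S.V G ω| ≤ c.remainder * (S.b * S.remainderRate c S.s₀ sr / √(S.N S.b))

lemma GoodOutcome.errorBounds {Jpop : Matrix (Fin S.p) (Fin S.p) ℝ} {sr : ℝ} {ω : Ω}
    (h : S.GoodOutcome c Jpop ω) (hs : S.SampleSize c S.s₀ sr) (hb : 1 ≤ S.b) :
    S.ErrorBounds c sr ω where
  l1_le j hj := (h.lassoBounds hs hj).l1_le_base_pow_mul_lam
    (Nat.one_le_iff_ne_zero.1 (Finset.mem_Icc.1 hj).1) hs.s₀_pos.le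
    (by exact_mod_cast hs.N_pos hj) hs.log_pos
  τhat_pos := h.τhat_pos hs (Finset.mem_Icc.2 ⟨hb, le_rfl⟩)
  abs_V_le := by
    have hV : S.V G ω = (S.τhat G S.b ω * (S.βon G ω - S.β₀ S.r) -
        ∑ j ∈ Finset.Icc 1 S.b, ∑ i ∈ S.batch j,
          S.zhat j i ω * (S.y i ω - G.g (S.x i ω ⬝ᵥ S.β₀))) / √(S.N S.b) := by
      rw [V, W, one_div_mul_eq_div, div_mul_eq_mul_div, sub_div]
    rw [hV, abs_div, abs_of_nonneg (Real.sqrt_nonneg _), ← mul_div_assoc]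
    exact div_le_div_of_nonneg_right (h.abs_expansion_remainder_le hs hb) (Real.sqrt_nonneg _)

theorem measure_not_errorBounds_le [MeasurableSpace Ω] {μ : Measure Ω} [IsProbabilityMeasure μ]
    (hS : S.IsSample G μ) (hR : S.LocallyRegular μ c.toModelConstants)
    (hE : S.IsEstimator G μ c.C) (hb : 1 ≤ S.b) (hp : 1 ≤ Real.log S.p)
    (hsize : ∀ j ∈ Finset.Icc 1 S.b,
      c.size ^ 2 * c.base ^ j * S.s₀ ^ 2 * S.sr G μ ^ 2 * Real.log S.p ≤ S.N j) :
    μ {ω | ¬S.ErrorBounds c (S.sr G μ) ω} ≤ ENNReal.ofReal (12 / S.p) :=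
  have hs := hR.sampleSize hp hsize
  (measure_mono (Set.compl_subset_compl.2 fun _ hω => GoodOutcome.errorBounds hω hs hb)).trans
    (measure_not_goodOutcome_le hS hR hs hE)

end Stream

section Asymptotics

lemma nat_mul_pow_sq_le_rpow {b : ℕ} {a x ε : ℝ} (ha : 1 ≤ a) (hx : 0 < x)
    (hb : b * Real.log (2 * a ^ 2) ≤ ε * Real.log x) : b * (a ^ b) ^ 2 ≤ x ^ ε := by
  have hpow : (b : ℝ) ≤ 2 ^ b := by exact_mod_cast (Nat.lt_two_pow_self (n := b)).le
  calc b * (a ^ b) ^ 2 ≤ 2 ^ b * (a ^ b) ^ 2 := by gcongr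
    _ = (2 * a ^ 2) ^ b := by rw [mul_pow, ← pow_mul, ← pow_mul, mul_comm b 2]
    _ = Real.exp (b * Real.log (2 * a ^ 2)) := by
        rw [Real.exp_nat_mul, Real.exp_log (by positivity)]
    _ ≤ Real.exp (Real.log x * ε) := by rw [mul_comm (Real.log x)]; gcongr
    _ = x ^ ε := (Real.rpow_def_of_pos hx ε).symm

lemma tendsto_remainder_zero {b N : ℕ → ℕ} {s₀ sr ℓ : ℕ → ℝ} {a ε : ℝ} (ha : 1 ≤ a) (hε : 0 < ε)
    (hs₀ : ∀ m, 0 ≤ s₀ m) (hsr : ∀ m, 0 ≤ sr m) (hℓ : ∀ m, 0 ≤ ℓ m) (hN : Tendsto N atTop atTop)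
    (hb : (fun m => (b m : ℝ)) =o[atTop] fun m => Real.log (N m))
    (h₁ : Tendsto (fun m => s₀ m ^ 2 * ℓ m * Real.log (N m) * (N m : ℝ) ^ (-(1 / 2) + ε : ℝ))
      atTop (𝓝 0))
    (h₂ : Tendsto (fun m => s₀ m * sr m * ℓ m * (N m : ℝ) ^ (-(1 / 2) + ε : ℝ)) atTop (𝓝 0)) :
    Tendsto (fun m => b m * ((a ^ b m) ^ 2 * ((s₀ m + sr m) * s₀ m * ℓ m)) / √(N m))
      atTop (𝓝 0) := by
  have hlog : 0 < Real.log (2 * a ^ 2) := Real.log_pos (by nlinarith)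
  have hN' : Tendsto (fun m => (N m : ℝ)) atTop atTop := tendsto_natCast_atTop_atTop.comp hN
  have hsum := h₁.add h₂
  rw [add_zero] at hsum
  refine squeeze_zero' (Eventually.of_forall fun m => ?_) ?_ hsum
  · have := hs₀ m
    have := hsr m
    have := hℓ m
    positivity
  filter_upwards [hb.bound (div_pos hε hlog), hN'.eventually_gt_atTop 0,
    (Real.tendsto_log_atTop.comp hN').eventually_ge_atTop 1] with m hbm hNm hlogN
  have := hs₀ m
  have := hsr m
  have := hℓ m
  simp only [Function.comp_apply] at hlogN
  rw [Real.norm_of_nonneg (Nat.cast_nonneg _), Real.norm_of_nonneg (by linarith),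
    div_mul_eq_mul_div, le_div_iff₀ hlog] at hbm
  have hrpow : (N m : ℝ) ^ (-(1 / 2) + ε : ℝ) = (N m : ℝ) ^ ε / √(N m) := by
    rw [Real.rpow_add hNm, Real.rpow_neg hNm.le, ← Real.sqrt_eq_rpow]
    ring
  rw [hrpow]
  calc b m * ((a ^ b m) ^ 2 * ((s₀ m + sr m) * s₀ m * ℓ m)) / √(N m)
      = b m * (a ^ b m) ^ 2 * ((s₀ m + sr m) * s₀ m * ℓ m) / √(N m) := by rw [← mul_assoc (b m : ℝ)]
    _ ≤ (N m : ℝ) ^ ε * ((s₀ m + sr m) * s₀ m * ℓ m) / √(N m) := by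
        gcongr
        exact nat_mul_pow_sq_le_rpow ha hNm hbm
    _ = s₀ m ^ 2 * ℓ m * 1 * ((N m : ℝ) ^ ε / √(N m)) +
        s₀ m * sr m * ℓ m * ((N m : ℝ) ^ ε / √(N m)) := by ring
    _ ≤ s₀ m ^ 2 * ℓ m * Real.log (N m) * ((N m : ℝ) ^ ε / √(N m)) +
        s₀ m * sr m * ℓ m * ((N m : ℝ) ^ ε / √(N m)) := by gcongr

variable {Ω : ℕ → Type*} [∀ m, MeasurableSpace (Ω m)] {μ : ∀ m, Measure (Ω m)}

lemma tendsto_measure_zero_of_eventually_subset {E F : ∀ m, Set (Ω m)}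
    (hF : Tendsto (fun m => μ m (F m)) atTop (𝓝 0)) (h : ∀ᶠ m in atTop, E m ⊆ F m) :
    Tendsto (fun m => μ m (E m)) atTop (𝓝 0) :=
  tendsto_of_tendsto_of_tendsto_of_le_of_le' tendsto_const_nhds hF
    (Eventually.of_forall fun _ => zero_le) (h.mono fun _ hm => measure_mono hm)

namespace Stream

variable {S : ∀ m, Stream (Ω m)} {G : GLM} {c : Constants G}

lemma tendsto_measure_not_errorBounds [∀ m, IsProbabilityMeasure (μ m)]
    (hS : ∀ m, (S m).IsSample G (μ m))
    (hR : ∀ m, (S m).LocallyRegular (μ m) c.toModelConstants)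
    (hE : ∀ m, (S m).IsEstimator G (μ m) c.C)
    (hN : Tendsto (fun m => (S m).N (S m).b) atTop atTop)
    (hp : Tendsto (fun m => (S m).p) atTop atTop)
    (hsize : ∀ m, ∀ j ∈ Finset.Icc 1 (S m).b, c.size ^ 2 * c.base ^ j * (S m).s₀ ^ 2 *
      (S m).sr G (μ m) ^ 2 * Real.log (S m).p ≤ (S m).N j) :
    Tendsto (fun m => μ m {ω | ¬(S m).ErrorBounds c ((S m).sr G (μ m)) ω}) atTop (𝓝 0) := by
  have hp' : Tendsto (fun m => ((S m).p : ℝ)) atTop atTop :=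
    tendsto_natCast_atTop_atTop.comp hp
  have hlim : Tendsto (fun m => ENNReal.ofReal (12 / (S m).p)) atTop (𝓝 0) := by
    rw [← ENNReal.ofReal_zero]
    exact ENNReal.tendsto_ofReal (hp'.const_div_atTop 12)
  refine tendsto_of_tendsto_of_tendsto_of_le_of_le' tendsto_const_nhds hlim
    (Eventually.of_forall fun _ => zero_le) ?_
  filter_upwards [(Real.tendsto_log_atTop.comp hp').eventually_ge_atTop 1,
    hN.eventually_gt_atTop 0] with m hlog hNm
  refine measure_not_errorBounds_le (hS m) (hR m) (hE m) ?_ hlog (hsize m)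
  by_contra! hb
  simp [Nat.lt_one_iff.1 hb, N_zero] at hNm

end Stream

end Asymptotics

end OnlineGLM

end

theorem theorem3_general (G : OnlineGLM.GLM) (k : OnlineGLM.ModelConstants G) :
    ∃ C₀ : ℝ, 0 < C₀ ∧ ∀ C : ℝ, C₀ ≤ C → ∃ A : ℝ, 1 ≤ A ∧ ∃ c : ℝ, 0 < c ∧
      ∀ (Ω : ℕ → Type*) [∀ m, MeasurableSpace (Ω m)] (μ : ∀ m, Measure (Ω m))
        [∀ m, IsProbabilityMeasure (μ m)] (S : ∀ m, OnlineGLM.Stream (Ω m)),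
        (∀ m, (S m).IsSample G (μ m)) →
        (∀ m, (S m).LocallyRegular (μ m) k) →
        (∀ m, (S m).IsEstimator G (μ m) C) →
        Tendsto (fun m => (S m).N (S m).b) atTop atTop →
        Tendsto (fun m => (S m).p) atTop atTop →
        (fun m => ((S m).b : ℝ)) =o[atTop] (fun m => Real.log ((S m).N (S m).b)) →
        (∀ m, ∀ j ∈ Finset.Icc 1 (S m).b,
          c * A ^ j * (S m).s₀ ^ 2 * (S m).sr G (μ m) ^ 2 * Real.log (S m).p ≤ (S m).N j) →
        (∃ ε : ℝ, 0 < ε ∧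
          Tendsto (fun m => ((S m).s₀ : ℝ) ^ 2 * Real.log (S m).p *
            Real.log ((S m).N (S m).b) * ((S m).N (S m).b : ℝ) ^ (-(1 / 2) + ε : ℝ))
            atTop (𝓝 0) ∧
          Tendsto (fun m => ((S m).s₀ : ℝ) * (S m).sr G (μ m) * Real.log (S m).p *
            ((S m).N (S m).b : ℝ) ^ (-(1 / 2) + ε : ℝ)) atTop (𝓝 0)) →
        Tendsto (fun m => μ m {ω | ∃ j ∈ Finset.Icc 1 (S m).b,
          A ^ j * (S m).s₀ * (S m).lam C j < OnlineGLM.l1 ((S m).βhat j ω - (S m).β₀)})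
          atTop (𝓝 0) ∧
        Tendsto (fun m => μ m {ω | (S m).τhat G (S m).b ω ≤ 0}) atTop (𝓝 0) ∧
        ∃ V : ∀ m, Ω m → ℝ,
          (∀ m ω, (S m).τhat G (S m).b ω / √((S m).N (S m).b : ℝ) *
            ((S m).βon G ω - (S m).β₀ (S m).r) = (S m).W G ω + V m ω) ∧
          ∀ η : ℝ, 0 < η → Tendsto (fun m => μ m {ω | η ≤ |V m ω|}) atTop (𝓝 0) := by
  refine ⟨3 * k.noise, mul_pos three_pos k.noise_pos, fun C hC => ?_⟩
  let c : OnlineGLM.Constants G := ⟨k, C, hC⟩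
  refine ⟨c.base, c.one_le_base, c.size ^ 2, pow_pos c.size_pos 2, ?_⟩
  rintro Ω _ μ _ S hS hR hE hN hp hb hsize ⟨ε, hε, h₁, h₂⟩
  have hbad := OnlineGLM.Stream.tendsto_measure_not_errorBounds (c := c) hS hR hE hN hp hsize
  have hrem := (OnlineGLM.tendsto_remainder_zero c.one_le_growth hε
    (fun _ => Nat.cast_nonneg _) (fun _ => Nat.cast_nonneg _)
    (fun m => Real.log_natCast_nonneg _) hN hb h₁ h₂).const_mul c.remainder
  rw [mul_zero] at hrem
  refine ⟨?_, ?_, fun m => (S m).V G, fun m ω => (add_sub_cancel _ _).symm, fun η hη => ?_⟩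
  · refine OnlineGLM.tendsto_measure_zero_of_eventually_subset hbad (Eventually.of_forall ?_)
    exact fun m ω ⟨j, hj, hlt⟩ herr => (herr.l1_le j hj).not_gt hlt
  · refine OnlineGLM.tendsto_measure_zero_of_eventually_subset hbad (Eventually.of_forall ?_)
    exact fun m ω hτ herr => herr.τhat_pos.not_ge hτ
  · refine OnlineGLM.tendsto_measure_zero_of_eventually_subset hbad ?_
    filter_upwards [hrem.eventually_lt_const hη] with m hm ω hV herr
    exact (herr.abs_V_le.trans_lt hm).not_ge hV

theorem theorem3 (G : OnlineGLM.GLM) (K M L δ K₂ K₃ κ : ℝ) (hδ : 0 < δ) (hκ : 0 < κ) :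
    ∃ C₀ : ℝ, 0 < C₀ ∧ ∀ C : ℝ, C₀ ≤ C → ∃ A : ℝ, 1 ≤ A ∧ ∃ c : ℝ, 0 < c ∧
      ∀ (Ω : ℕ → Type*) [∀ m, MeasurableSpace (Ω m)] (μ : ∀ m, Measure (Ω m))
        [∀ m, IsProbabilityMeasure (μ m)] (S : ∀ m, OnlineGLM.Stream (Ω m)),
        (∀ m, (S m).IsSample G (μ m)) →
        (∀ m, (S m).Regular G (μ m) K M L δ K₂ K₃ κ) →
        (∀ m, (S m).IsEstimator G (μ m) C) →
        -- asymptotic regime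
        Tendsto (fun m => (S m).N (S m).b) atTop atTop →
        Tendsto (fun m => (S m).p) atTop atTop →
        (fun m => ((S m).b : ℝ)) =o[atTop] (fun m => Real.log ((S m).N (S m).b)) →
        -- sample size conditions, with `c₁^{(j)} = A ^ j`
        (∀ m, c * (S m).s₀ * Real.log (S m).p ≤ (S m).n 1) →
        (∀ m, ∀ j ∈ Finset.Icc 1 (S m).b,
          c * A ^ j * (S m).s₀ ^ 2 * (S m).sr G (μ m) ^ 2 * Real.log (S m).p ≤ (S m).N j) →
        (∃ ε : ℝ, 0 < ε ∧
          Tendsto (fun m => ((S m).s₀ : ℝ) ^ 2 * Real.log (S m).p *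
            Real.log ((S m).N (S m).b) * ((S m).N (S m).b : ℝ) ^ (-(1 / 2) + ε : ℝ))
            atTop (𝓝 0) ∧
          Tendsto (fun m => ((S m).s₀ : ℝ) * (S m).sr G (μ m) * Real.log (S m).p *
            ((S m).N (S m).b : ℝ) ^ (-(1 / 2) + ε : ℝ)) atTop (𝓝 0)) →
        -- `A ^ j` is a valid constant in the `ℓ₁` error bound of the online lasso
        Tendsto (fun m => μ m {ω | ∃ j ∈ Finset.Icc 1 (S m).b,
          A ^ j * (S m).s₀ * (S m).lam C j < OnlineGLM.l1 ((S m).βhat j ω - (S m).β₀)})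
          atTop (𝓝 0) ∧
        -- the debiased estimator is well defined
        Tendsto (fun m => μ m {ω | (S m).τhat G (S m).b ω ≤ 0}) atTop (𝓝 0) ∧
        -- the expansion
        ∃ V : ∀ m, Ω m → ℝ,
          (∀ m ω, (S m).τhat G (S m).b ω / √((S m).N (S m).b : ℝ) *
            ((S m).βon G ω - (S m).β₀ (S m).r) = (S m).W G ω + V m ω) ∧
          ∀ η : ℝ, 0 < η → Tendsto (fun m => μ m {ω | η ≤ |V m ω|}) atTop (𝓝 0) := by
  obtain ⟨C₀, hC₀, h⟩ := theorem3_general G (.normalize G K M L K₂ K₃ hδ hκ)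
  refine ⟨C₀, hC₀, fun C hC => (h C hC).imp fun A hA => hA.imp_right fun ⟨c, hc, h⟩ => ⟨c, hc, ?_⟩⟩
  exact fun Ω _ μ _ S hS hR hE hN hp hb _ =>
    h Ω μ S hS (fun m => (hR m).locallyRegular hδ hκ) hE hN hp hb
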